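/- Let $(M,g)$ be a globally hyperbolic space-time: a connected, Hausdorff, second countable smooth $4$-manifold with a smooth Lorentzian metric of signature $(-,+,+,+)$ and a time orientation, strongly causal and such that all sets $J^+(x)\cap J^-(y)$ are compact. Let $S_1,S_2\subset M$ be smooth spacelike Cauchy surfaces (smoothly embedded spacelike hypersurfaces met exactly once by every inextendible causal curve). Let $h_i$ be the Riemannian metric induced on $S_i$, and let $T^*_1S_i\subset T^*S_i$ be the bundle of $h_i$-unit covectors. A unit covector $v\in T^*_1S_i$ at $x\in S_i$ specifies a future pointing null codirection of $M$ at $x$, namely the set of positive multiples of $\hat v+n$, where $n$ is the unit future pointing timelike conormal of $S_i$ at $x$, and $\hat v\in T^*_xM$ is the extension of $v$ that vanishes on the normal of $S_i$. The null geodesics of $M$, with their cotangents, are the integral curves, in the bundle of future pointing null covectors, of the vector field $X_G$ on $T^*M$ given by $X_G\lrcorner\,\omega+dH=0$, where $H(x,p)=\tfrac12 g^{ab}p_ap_b$ and $\omega=dp_a\wedge dx^a$. Then for every $(x_1,v_1)\in T^*_1S_1$ there is exactly one $(x_2,v_2)\in T^*_1S_2$ such that some null geodesic passes through $x_1$ with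 codirection specified by $v_1$ and through $x_2$ with codirection specified by $v_2$, and the resulting map $f_g:T^*_1S_1\to T^*_1S_2$, $(x_1,v_1)\mapsto(x_2,v_2)$, is a diffeomorphism. -/

import Mathlib

open Set Filter Topology Manifold Bundle
open scoped ContDiff

noncomputable section

/-- The cotangent space of an `n`-manifold at `x`. -/
abbrev CotangentSpace (n : ℕ) {X : Type*} [TopologicalSpace X]
    [ChartedSpace (EuclideanSpace ℝ (Fin n)) X] (x : X) : Type :=
  TangentSpace (𝓡 n) x →L[ℝ] ℝ

/-- The cotangent bundle of an `n`-manifold: pairs `⟨x, p⟩` with `p` a covector at `x`. -/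
abbrev CotangentBundle (n : ℕ) (X : Type*) [TopologicalSpace X]
    [ChartedSpace (EuclideanSpace ℝ (Fin n)) X] : Type _ :=
  TotalSpace (EuclideanSpace ℝ (Fin n) →L[ℝ] ℝ)
    (fun x : X => TangentSpace (𝓡 n) x →L[ℝ] ℝ)

/-- The model with corners of the cotangent bundle (a `2n`-dimensional manifold). -/
abbrev cotangentModel (n : ℕ) :=
  (𝓡 n).prod 𝓘(ℝ, EuclideanSpace ℝ (Fin n) →L[ℝ] ℝ)

/-- Sanity check: the preferred chart of the cotangent bundle at `z₀` is the canonical one,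
`⟨x, p⟩ ↦ (xᵃ, p_a)`: the base point is read in the preferred chart of the manifold at `z₀.proj`,
and the covector is precomposed with the inverse of the derivative of that chart at `x`
(`symmL`, the inverse of the tangent bundle trivialization). -/
theorem cotangent_chart_apply {n : ℕ} {X : Type*} [TopologicalSpace X]
    [ChartedSpace (EuclideanSpace ℝ (Fin n)) X] [IsManifold (𝓡 n) ∞ X]
    (z₀ z : CotangentBundle n X) :
    extChartAt (cotangentModel n) z₀ z =
      (extChartAt (𝓡 n) z₀.proj z.proj,
        z.2.comp ((trivializationAt (EuclideanSpace ℝ (Fin n))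
          (TangentSpace (𝓡 n)) z₀.proj).symmL ℝ z.proj)) := by
  have h := hom_chart (HB := EuclideanSpace ℝ (Fin n)) z₀ z
  rw [extChartAt_coe, Function.comp_apply, h]
  ext <;> simp [ContinuousLinearMap.inCoordinates]

/-- The canonical symplectic form `ω = dθ = dp_a ∧ dxᵃ` on the cotangent bundle. The tangent space
at `z` is, by definition in Mathlib, the model space `(dxᵃ, dp_a)` of the preferred chart at `z`,
which is the canonical chart `(xᵃ, p_a)` by `cotangent_chart_apply`. -/
def canonicalSymplectic {n : ℕ} {X : Type*} [TopologicalSpace X]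
    [ChartedSpace (EuclideanSpace ℝ (Fin n)) X] [IsManifold (𝓡 n) ∞ X]
    (z : CotangentBundle n X) (V W : TangentSpace (cotangentModel n) z) : ℝ :=
  let V' : EuclideanSpace ℝ (Fin n) × (EuclideanSpace ℝ (Fin n) →L[ℝ] ℝ) := V
  let W' : EuclideanSpace ℝ (Fin n) × (EuclideanSpace ℝ (Fin n) →L[ℝ] ℝ) := W
  V'.2 W'.1 - W'.2 V'.1

/-- A smooth time-oriented Lorentzian metric, of signature `(-,+,+,+)`, on a smooth 4-manifold.
The time orientation is given by a smooth timelike vector field, declared to be future pointing. -/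
structure SpacetimeMetric (M : Type*) [TopologicalSpace M]
    [ChartedSpace (EuclideanSpace ℝ (Fin 4)) M] [IsManifold (𝓡 4) ∞ M] where
  /-- the metric tensor `g_ab` -/
  val (x : M) : TangentSpace (𝓡 4) x →L[ℝ] TangentSpace (𝓡 4) x →L[ℝ] ℝ
  symm (x : M) (v w : TangentSpace (𝓡 4) x) : val x v w = val x w v
  signature (x : M) : ∃ b : Module.Basis (Fin 4) ℝ (TangentSpace (𝓡 4) x),
    ∀ i j, val x (b i) (b j) = if i = j then (if i = 0 then -1 else 1) else 0
  contMDiff : ContMDiff (𝓡 4)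
    ((𝓡 4).prod 𝓘(ℝ, EuclideanSpace ℝ (Fin 4) →L[ℝ] EuclideanSpace ℝ (Fin 4) →L[ℝ] ℝ)) ∞
    (fun x => TotalSpace.mk'
      (EuclideanSpace ℝ (Fin 4) →L[ℝ] EuclideanSpace ℝ (Fin 4) →L[ℝ] ℝ) x (val x))
  /-- the vector field defining the time orientation -/
  future (x : M) : TangentSpace (𝓡 4) x
  future_contMDiff : ContMDiff (𝓡 4) ((𝓡 4).prod (𝓡 4)) ∞
    (fun x => TotalSpace.mk' (EuclideanSpace ℝ (Fin 4)) x (future x))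
  future_timelike (x : M) : val x (future x) (future x) < 0

namespace SpacetimeMetric

variable {M : Type*} [TopologicalSpace M] [ChartedSpace (EuclideanSpace ℝ (Fin 4)) M]
  [IsManifold (𝓡 4) ∞ M] (g : SpacetimeMetric M)

/-- `v` is causal (nonzero, timelike or null) and future pointing. -/
def IsFutureCausal (x : M) (v : TangentSpace (𝓡 4) x) : Prop :=
  v ≠ 0 ∧ g.val x v v ≤ 0 ∧ g.val x v (g.future x) < 0

/-- Lowering an index, `vᵃ ↦ g_ab vᵇ`, is invertible. -/
theorem flat_isInvertible (x : M) :
    (show TangentSpace (𝓡 4) x →L[ℝ] CotangentSpace 4 x from g.val x).IsInvertible := by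
  obtain ⟨b, hb⟩ := g.signature x
  have hinj : Function.Injective (g.val x) := by
    rw [injective_iff_map_eq_zero]
    intro v hv
    have key : ∀ j, b.repr v j = 0 := by
      intro j
      have h1 : g.val x v (b j) = 0 := by rw [hv]; rfl
      rw [← b.sum_repr v] at h1
      simp only [map_sum, map_smul, _root_.sum_apply,
        _root_.smul_apply, hb, smul_eq_mul] at h1
      rw [Finset.sum_eq_single j] at h1
      · by_cases hj : j = 0 <;> simp_all
      · intro i _ hij; simp [hij]
      · simp
    exact b.repr.map_eq_zero_iff.1 (by ext j; simpa using key j)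
  let f : EuclideanSpace ℝ (Fin 4) →L[ℝ] (EuclideanSpace ℝ (Fin 4) →L[ℝ] ℝ) := g.val x
  have hrank : Module.finrank ℝ (EuclideanSpace ℝ (Fin 4)) =
      Module.finrank ℝ (EuclideanSpace ℝ (Fin 4) →L[ℝ] ℝ) := by
    rw [← (LinearMap.toContinuousLinearMap (𝕜 := ℝ) (E := EuclideanSpace ℝ (Fin 4))
      (F' := ℝ)).finrank_eq]
    exact (Subspace.dual_finrank_eq).symm
  let e := (LinearEquiv.ofInjectiveOfFinrankEq f.toLinearMap hinj hrank).toContinuousLinearEquiv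
  exact ⟨e, by ext1 v; rfl⟩

/-- Raising an index, `p_a ↦ pᵃ = gᵃᵇ p_b`: the inverse of `vᵃ ↦ g_ab vᵇ`. -/
def sharp (x : M) (p : CotangentSpace 4 x) : TangentSpace (𝓡 4) x :=
  (show TangentSpace (𝓡 4) x →L[ℝ] CotangentSpace 4 x from g.val x).inverse p

theorem flat_sharp (x : M) (p : CotangentSpace 4 x) : g.val x (g.sharp x p) = p :=
  ContinuousLinearMap.IsInvertible.self_apply_inverse (g.flat_isInvertible x) p

/-- The Hamiltonian `H(x, p) = ½ gᵃᵇ p_a p_b` on the cotangent bundle. -/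
def hamiltonian (z : CotangentBundle 4 M) : ℝ :=
  (1 / 2) * z.2 (g.sharp z.proj z.2)

/-- `X` is the value at `z` of the geodesic spray `X_G`, the vector field on the cotangent bundle
with `X_G ⌟ ω + dH = 0`. -/
def IsGeodesicSpray (z : CotangentBundle 4 M) (X : TangentSpace (cotangentModel 4) z) : Prop :=
  ∀ Y : TangentSpace (cotangentModel 4) z,
    canonicalSymplectic z X Y +
      (show ℝ from mfderiv (cotangentModel 4) 𝓘(ℝ, ℝ) g.hamiltonian z Y) = 0

/-- The bundle `N'M` of future pointing null covectors. -/
def nullBundle : Set (CotangentBundle 4 M) :=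
  {z | g.hamiltonian z = 0 ∧ g.IsFutureCausal z.proj (g.sharp z.proj z.2)}

/-- `η` is, on `J`, (the cotangent lift of) a future pointing null geodesic: an integral curve of
the geodesic spray that lies in `N'M`. -/
def IsNullGeodesicOn (η : ℝ → CotangentBundle 4 M) (J : Set ℝ) : Prop :=
  ∀ t ∈ J, η t ∈ g.nullBundle ∧ ∃ X : TangentSpace (cotangentModel 4) (η t),
    g.IsGeodesicSpray (η t) X ∧
      HasMFDerivAt 𝓘(ℝ, ℝ) (cotangentModel 4) η t ((1 : ℝ →L[ℝ] ℝ).smulRight X)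

/-- `γ` is a smooth future-directed causal curve on `J`. -/
def IsCausalCurveOn (γ : ℝ → M) (J : Set ℝ) : Prop :=
  ContMDiffOn 𝓘(ℝ, ℝ) (𝓡 4) ∞ γ J ∧
    ∀ t ∈ J, g.IsFutureCausal (γ t) (mfderivWithin 𝓘(ℝ, ℝ) (𝓡 4) γ J t (1 : ℝ))

/-- `γ` is a future-directed causal curve on the nonempty open interval `J`, inextendible: `γ t` has
no limit in `M` as `t` tends to the upper or to the lower end of `J`. -/
def IsInextendibleCausalCurve (γ : ℝ → M) (J : Set ℝ) : Prop :=
  IsOpen J ∧ J.OrdConnected ∧ J.Nonempty ∧ g.IsCausalCurveOn γ J ∧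
    (¬ ∃ x, Tendsto (fun t : J => γ t) atTop (𝓝 x)) ∧
    (¬ ∃ x, Tendsto (fun t : J => γ t) atBot (𝓝 x))

/-- The causal relation `x ≤ y`, that is `y ∈ J⁺(x)`. -/
def CausalLE (x y : M) : Prop :=
  x = y ∨ ∃ (γ : ℝ → M) (a b : ℝ), a < b ∧ g.IsCausalCurveOn γ (Icc a b) ∧ γ a = x ∧ γ b = y

/-- Strong causality: each point has arbitrarily small neighbourhoods `V` such that causal curves
with both ends in `V` do not leave a prescribed neighbourhood `U`. -/
def StronglyCausal : Prop :=
  ∀ x : M, ∀ U ∈ 𝓝 x, ∃ V ∈ 𝓝 x, V ⊆ U ∧ ∀ (γ : ℝ → M) (a b : ℝ), a < b →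
    g.IsCausalCurveOn γ (Icc a b) → γ a ∈ V → γ b ∈ V → ∀ t ∈ Icc a b, γ t ∈ U

/-- Global hyperbolicity: strongly causal, with compact causal diamonds `J⁺(x) ∩ J⁻(y)`. -/
def GloballyHyperbolic : Prop :=
  g.StronglyCausal ∧ ∀ x y : M, IsCompact {z | g.CausalLE x z ∧ g.CausalLE z y}

section Hypersurface

variable {S : Type*} [TopologicalSpace S] [ChartedSpace (EuclideanSpace ℝ (Fin 3)) S]
  [IsManifold (𝓡 3) ∞ S]

/-- The pushforward of tangent vectors along `ι : S → M`. -/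
def push (ι : S → M) (x : S) (u : TangentSpace (𝓡 3) x) : TangentSpace (𝓡 4) (ι x) :=
  mfderiv (𝓡 3) (𝓡 4) ι x u

/-- The metric `h` induced on `S` by `g` along `ι : S → M`. -/
def induced (ι : S → M) (x : S) (u v : TangentSpace (𝓡 3) x) : ℝ :=
  g.val (ι x) (push ι x u) (push ι x v)

/-- `ι : S → M` exhibits `S` as a smooth spacelike Cauchy surface of `M`: it is a smooth embedding
with positive definite induced metric, and every inextendible causal curve meets its image exactly
once. -/
structure IsCauchySurface (ι : S → M) : Prop where
  isSmoothEmbedding : IsSmoothEmbedding (𝓡 3) (𝓡 4) ∞ ι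
  spacelike : ∀ (x : S) (u : TangentSpace (𝓡 3) x), u ≠ 0 → 0 < g.induced ι x u u
  meets_once : ∀ (γ : ℝ → M) (J : Set ℝ), g.IsInextendibleCausalCurve γ J →
    ∃! t, t ∈ J ∧ γ t ∈ range ι

/-- The cotangent sphere bundle `T*₁S`: the covectors of unit length for the induced metric `h`,
i.e. those of the form `h(u, ·)` with `h(u, u) = 1`. -/
def unitCotangent (ι : S → M) : Set (CotangentBundle 3 S) :=
  {z | ∃ u : TangentSpace (𝓡 3) z.proj,
    (∀ w, z.2 w = g.induced ι z.proj u w) ∧ g.induced ι z.proj u u = 1}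

/-- `n` is the unit future pointing timelike conormal of `S` at `x`. -/
def IsUnitFutureConormal (ι : S → M) (x : S) (n : CotangentSpace 4 (ι x)) : Prop :=
  (∀ u, n (push ι x u) = 0) ∧ n (g.sharp (ι x) n) = -1 ∧
    g.IsFutureCausal (ι x) (g.sharp (ι x) n)

/-- The future pointing null covector `z` on `M` represents the codirection specified by the covector
`v` on `S`: it lies over the same point `x` of `S` and is a positive multiple of `v̂ + n`, where `n` is
the unit future conormal of `S` at `x` and `v̂` is `v`, regarded as a covector of `M` by letting it
vanish on the normal direction of `S`. -/
def HasCodirection (ι : S → M) (v : CotangentBundle 3 S) (z : CotangentBundle 4 M) : Prop :=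
  ∃ (n w : CotangentSpace 4 (ι v.proj)) (c : ℝ), 0 < c ∧
    g.IsUnitFutureConormal ι v.proj n ∧
    (∀ u, w (push ι v.proj u) = v.2 u) ∧ w (g.sharp (ι v.proj) n) = 0 ∧
    z = ⟨ι v.proj, c • (w + n)⟩

end Hypersurface

/-- Some null geodesic meets `S₁` at the point and with the codirection of `v₁`, and meets `S₂` at the
point and with the codirection of `v₂` (in either order along the geodesic). This is the graph of
the map `f_g`. -/
def NullGeodesicJoins
    {S₁ : Type*} [TopologicalSpace S₁] [ChartedSpace (EuclideanSpace ℝ (Fin 3)) S₁]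
    [IsManifold (𝓡 3) ∞ S₁]
    {S₂ : Type*} [TopologicalSpace S₂] [ChartedSpace (EuclideanSpace ℝ (Fin 3)) S₂]
    [IsManifold (𝓡 3) ∞ S₂]
    (ι₁ : S₁ → M) (ι₂ : S₂ → M) (v₁ : CotangentBundle 3 S₁) (v₂ : CotangentBundle 3 S₂) : Prop :=
  ∃ (η : ℝ → CotangentBundle 4 M) (J : Set ℝ), IsOpen J ∧ J.OrdConnected ∧
    g.IsNullGeodesicOn η J ∧ ∃ a ∈ J, ∃ b ∈ J,
      g.HasCodirection ι₁ v₁ (η a) ∧ g.HasCodirection ι₂ v₂ (η b)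

end SpacetimeMetric

/-- A map between subsets (here: embedded submanifolds) `A`, `B` of the cotangent bundles of two
3-manifolds is smooth if, near each point of `A`, it is the restriction of a smooth map defined on
an open set of the ambient manifold. -/
def IsSmoothBetween
    {X : Type*} [TopologicalSpace X] [ChartedSpace (EuclideanSpace ℝ (Fin 3)) X]
    [IsManifold (𝓡 3) ∞ X]
    {Y : Type*} [TopologicalSpace Y] [ChartedSpace (EuclideanSpace ℝ (Fin 3)) Y]
    [IsManifold (𝓡 3) ∞ Y]
    {A : Set (CotangentBundle 3 X)} {B : Set (CotangentBundle 3 Y)} (f : A → B) : Prop :=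
  ∀ a : A, ∃ (U : Set (CotangentBundle 3 X)) (F : CotangentBundle 3 X → CotangentBundle 3 Y),
    IsOpen U ∧ (a : CotangentBundle 3 X) ∈ U ∧
    ContMDiffOn (cotangentModel 3) (cotangentModel 3) ∞ F U ∧
    ∀ a' : A, (a' : CotangentBundle 3 X) ∈ U → F a' = f a'

end

/-! The geodesic spray is the Hamiltonian vector field of `H`. Its flow preserves `H` and the future
null covectors, and rescaling a covector by a positive constant only reparametrises its integral
curve. So the flow acts on future null codirections. At a point of a spacelike hypersurface, every
future null covector is `c • (v̂ + n)` for exactly one unit covector `v` of the hypersurface and one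
`c > 0` (`hasCodirection_iff` and the lemmas after it), so unit covectors of a surface are the same
as null codirections over it. A maximal null geodesic projects to an inextendible causal curve,
which meets each Cauchy surface exactly once. This gives the bijection
(`existsUnique_nullGeodesicJoins`), and exchanging the two surfaces gives the inverse.

Two points need analysis. Maximality concerns the curve of covectors, whereas the Cauchy condition
concerns its base curve: the base curve might converge at an end of the parameter interval while the
covectors blow up or the parameter runs to infinity. `exists_isTrapping` excludes this. Near any
point a suitable coordinate is strictly monotone along null geodesics and controls the logarithm of
the size of the covector, so a null geodesic over a small neighbourhood lasts a bounded parameter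
time and stays in a compact set.

Smoothness is local. Near a given unit covector the map is `B ∘ Ψ ∘ A`: `A` is the null lift at the
first surface (`exists_smooth_codirection`), `Ψ` is the spray flow for one fixed time
(`FlowRel.exists_smooth`), and `B` runs along the geodesic to its transversal intersection with the
second surface and takes the normalised restriction there (`exists_smooth_drop`). Smoothness of
flows comes from the inverse function theorem, applied to the integral equation in a space of
continuous functions. -/

/-- Inverse function theorem, with smoothness of the local inverse on a neighbourhood. -/
theorem exists_smooth_localInverse {E F : Type*} [NormedAddCommGroup E] [NormedSpace ℝ E]
    [CompleteSpace E] [NormedAddCommGroup F] [NormedSpace ℝ F] {f : E → F} {a : E}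
    (hf : ∀ᶠ x in 𝓝 a, ContDiffAt ℝ ∞ f x) {f' : E ≃L[ℝ] F}
    (hf' : HasFDerivAt f (f' : E →L[ℝ] F) a) :
    ∃ g : F → E, g (f a) = a ∧ ∀ᶠ y in 𝓝 (f a), ContDiffAt ℝ ∞ g y ∧ f (g y) = y := by
  have h0 : ContDiffAt ℝ ∞ f a := hf.self_of_nhds
  let P := h0.toOpenPartialHomeomorph f hf' (by simp)
  have haP : a ∈ P.source := h0.mem_toOpenPartialHomeomorph_source hf' (by simp)
  have hbP : f a ∈ P.target := P.map_source haP
  have hga : P.symm (f a) = a := P.left_inv haP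
  have hcont : ContinuousAt (fderiv ℝ f) a :=
    (h0.fderiv_right (m := 0) (by simp)).continuousAt
  have hinv : ∀ᶠ x in 𝓝 a, ∃ e : E ≃L[ℝ] F, (e : E →L[ℝ] F) = fderiv ℝ f x := by
    have := ContinuousLinearEquiv.nhds f'
    rw [← hf'.fderiv] at this
    exact hcont this
  have hsymm : Tendsto P.symm (𝓝 (f a)) (𝓝 a) := by
    have := P.symm.continuousAt hbP
    rwa [ContinuousAt, hga] at this
  refine ⟨P.symm, hga, ?_⟩
  filter_upwards [hsymm.eventually (hf.and hinv), P.open_target.mem_nhds hbP] with y hy hyt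
  obtain ⟨hy1, e, he⟩ := hy
  refine ⟨P.contDiffAt_symm (f₀' := e) hyt ?_ hy1, P.right_inv hyt⟩
  rw [he]
  exact (hy1.differentiableAt (by simp)).hasFDerivAt

universe u

/-! ### Composition operators on spaces of continuous functions. -/

section Nemytskii

variable {X : Type*} [TopologicalSpace X] [CompactSpace X]

/-- Pointwise application of a continuous bilinear map to vector-valued functions. -/
noncomputable def ContinuousMap.pointwiseBilin (X : Type*) [TopologicalSpace X] [CompactSpace X]
    {E F G : Type*} [NormedAddCommGroup E] [NormedSpace ℝ E] [NormedAddCommGroup F]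
    [NormedSpace ℝ F] [NormedAddCommGroup G] [NormedSpace ℝ G] (L : G →L[ℝ] E →L[ℝ] F) :
    C(X, G) →L[ℝ] C(X, E) →L[ℝ] C(X, F) :=
  LinearMap.mkContinuous₂
    (LinearMap.mk₂ ℝ (fun (A : C(X, G)) (u : C(X, E)) =>
      (⟨fun s => L (A s) (u s), (L.continuous.comp A.continuous).clm_apply u.continuous⟩ : C(X, F)))
      (fun _ _ _ => by ext; simp) (fun _ _ _ => by ext; simp)
      (fun _ _ _ => by ext; simp) (fun _ _ _ => by ext; simp)) ‖L‖
    (fun A u => by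
      rw [ContinuousMap.norm_le _ (by positivity)]
      intro s
      refine (L.le_opNorm₂ (A s) (u s)).trans ?_
      gcongr
      · exact A.norm_coe_le_norm s
      · exact u.norm_coe_le_norm s)

/-- By the mean value inequality it is enough that `f'` be nearly constant on the ball of radius `δ`
about `α s`, with one `δ` for all `s`. This uniformity follows from continuity of composition with
`f'` in the sup norm. -/
theorem ContinuousMap.hasFDerivAt_postcomp {E F G : Type*} [NormedAddCommGroup E]
    [NormedSpace ℝ E] [NormedAddCommGroup F] [NormedSpace ℝ F] [NormedAddCommGroup G]
    [NormedSpace ℝ G] (L : G →L[ℝ] E →L[ℝ] F) {f : C(E, F)} {f' : C(E, G)}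
    (hf : ∀ x, HasFDerivAt f (L (f' x)) x) (α : C(X, E)) :
    HasFDerivAt (fun β : C(X, E) => f.comp β)
      (ContinuousMap.pointwiseBilin X L (f'.comp α)) α := by
  rw [hasFDerivAt_iff_isLittleO, Asymptotics.isLittleO_iff]
  intro ε hε
  have hc : ContinuousAt (fun β : C(X, E) => f'.comp β) α :=
    (ContinuousMap.continuous_postcomp f').continuousAt
  obtain ⟨δ, hδ, hδ'⟩ := (Metric.continuousAt_iff (α := C(X, E)) (β := C(X, G))).1 hc
    (ε / (‖L‖ + 1)) (by positivity)
  filter_upwards [Metric.ball_mem_nhds α hδ] with β hβ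
  rw [Metric.mem_ball, dist_eq_norm] at hβ
  rw [ContinuousMap.norm_le _ (by positivity)]
  intro s
  -- A pointwise bound is extracted from the sup-norm one by testing it on `α` translated by the
  -- constant `y - α s`, which takes the value `y` at `s`.
  have key : ∀ y ∈ Metric.ball (α s) δ, ‖L (f' y) - L (f' (α s))‖ ≤ ε := by
    intro y hy
    let k : C(X, E) := α + ContinuousMap.const X (y - α s)
    have hk : dist k α < δ := by
      rw [dist_eq_norm, ContinuousMap.norm_lt_iff _ hδ]
      intro r
      simpa [k, dist_eq_norm] using hy
    have h1 := hδ' hk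
    rw [dist_eq_norm] at h1
    have h2 := (ContinuousMap.norm_coe_le_norm (f'.comp k - f'.comp α) s).trans h1.le
    have h3 : ‖f' y - f' (α s)‖ ≤ ε / (‖L‖ + 1) := by simpa [k] using h2
    rw [← map_sub]
    calc ‖L (f' y - f' (α s))‖ ≤ ‖L‖ * ‖f' y - f' (α s)‖ := L.le_opNorm _
      _ ≤ (‖L‖ + 1) * (ε / (‖L‖ + 1)) := by gcongr; linarith
      _ = ε := by field_simp
  have hconv : Convex ℝ (Metric.ball (α s) δ) := convex_ball _ _
  have hmem : β s ∈ Metric.ball (α s) δ := by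
    rw [Metric.mem_ball, dist_eq_norm]
    exact ((β - α).norm_coe_le_norm s).trans_lt hβ
  have := hconv.norm_image_sub_le_of_norm_hasFDerivWithin_le'
    (fun y _ => (hf y).hasFDerivWithinAt) key (Metric.mem_ball_self hδ) hmem
  refine (le_trans (le_of_eq ?_) this).trans ?_
  · rfl
  · gcongr
    exact (β - α).norm_coe_le_norm s

/-- Induction on `n`: the derivative of composition with `f` is composition with `fderiv ℝ f`,
followed by a fixed continuous linear operator. The target changes from `F` to `E →L[ℝ] F`, so the
induction runs over all `F` in a common universe. -/
theorem ContinuousMap.contDiff_nat_postcomp (n : ℕ) {E F : Type u} [NormedAddCommGroup E]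
    [NormedSpace ℝ E] [NormedAddCommGroup F] [NormedSpace ℝ F] (f : C(E, F))
    (hf : ContDiff ℝ n f) : ContDiff ℝ n (fun β : C(X, E) => f.comp β) := by
  induction n generalizing F with
  | zero =>
    exact contDiff_zero.2 (ContinuousMap.continuous_postcomp f)
  | succ n ih =>
    have hf' : ContDiff ℝ n (fderiv ℝ f) := hf.fderiv_right (by norm_cast)
    let f' : C(E, E →L[ℝ] F) := ⟨fderiv ℝ f, hf'.continuous⟩
    have hd := ContinuousMap.hasFDerivAt_postcomp (X := X) (.id ℝ (E →L[ℝ] F)) (f := f) (f' := f')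
      (fun x => (hf.differentiable (by norm_cast) x).hasFDerivAt)
    rw [show ((n + 1 : ℕ) : WithTop ℕ∞) = n + 1 from rfl, contDiff_succ_iff_hasFDerivAt]
    refine ⟨_, ?_, hd⟩
    exact (ContinuousMap.pointwiseBilin X (.id ℝ (E →L[ℝ] F))).contDiff.comp (ih f' hf')

theorem ContinuousMap.contDiff_postcomp {E F : Type u} [NormedAddCommGroup E]
    [NormedSpace ℝ E] [NormedAddCommGroup F] [NormedSpace ℝ F] (f : C(E, F))
    (hf : ContDiff ℝ ∞ f) : ContDiff ℝ ∞ (fun β : C(X, E) => f.comp β) :=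
  contDiff_infty.2 fun n => ContinuousMap.contDiff_nat_postcomp n f (contDiff_infty.1 hf n)

end Nemytskii

/-! ### Smooth dependence of solutions of ordinary differential equations on time and initial value.
-/

section LocalFlow

variable {E : Type u} [NormedAddCommGroup E] [NormedSpace ℝ E] [CompleteSpace E]

/-- The primitive vanishing at `0`, as an operator on continuous functions on `[-2, 2]`. -/
noncomputable def primitiveCLM (E : Type u) [NormedAddCommGroup E] [NormedSpace ℝ E]
    [CompleteSpace E] : C(Icc (-2 : ℝ) 2, E) →L[ℝ] C(Icc (-2 : ℝ) 2, E) :=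
  have hint (u : C(Icc (-2 : ℝ) 2, E)) : Continuous fun r => u (projIcc (-2) 2 (by norm_num) r) :=
    u.continuous.comp continuous_projIcc
  LinearMap.mkContinuous
    { toFun := fun u => ⟨fun s => ∫ r in (0 : ℝ)..s, u (projIcc (-2) 2 (by norm_num) r),
        (intervalIntegral.continuous_primitive
          (fun _ _ => (hint u).intervalIntegrable _ _) _).comp continuous_subtype_val⟩
      map_add' := fun u w => by
        ext s
        exact intervalIntegral.integral_add ((hint u).intervalIntegrable _ _)
          ((hint w).intervalIntegrable _ _)
      map_smul' := fun c u => by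
        ext s
        exact intervalIntegral.integral_smul c _ } 2
    (fun u => by
      rw [ContinuousMap.norm_le _ (by positivity)]
      intro s
      refine (intervalIntegral.norm_integral_le_of_norm_le_const (C := ‖u‖)
        fun r _ => u.norm_coe_le_norm _).trans ?_
      rw [mul_comm, sub_zero]
      gcongr
      exact abs_le.2 s.2)

/-- The solutions on `[-2, 2]` of the rescaled equations `α' = τ f(α)`, `α 0 = x`, depend smoothly
on `(τ, x)` near `τ = 0`. -/
theorem exists_smooth_rescaled_solution {f : E → E} (hf : ContDiff ℝ ∞ f) (x₀ : E) :
    ∃ A : ℝ × E → C(Icc (-2 : ℝ) 2, E), A (0, x₀) = ContinuousMap.const _ x₀ ∧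
      ∀ᶠ p in 𝓝 ((0, x₀) : ℝ × E), ContDiffAt ℝ ∞ A p ∧ ∀ s : Icc (-2 : ℝ) 2,
        A p s = p.2 + p.1 • ∫ r in (0 : ℝ)..s, f (A p (projIcc (-2) 2 (by norm_num) r)) := by
  let I := Icc (-2 : ℝ) 2
  let fc : C(E, E) := ⟨f, hf.continuous⟩
  let N : C(I, E) → C(I, E) := fun α => fc.comp α
  have hN : ContDiff ℝ ∞ N := ContinuousMap.contDiff_postcomp fc hf
  let cst : E →L[ℝ] C(I, E) := ContinuousLinearMap.const ℝ I
  -- The zeros of `R` are the solutions of the integral equation. At `τ = 0` the integral term drops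
  -- out, so the partial derivative of `R` in the unknown function is the identity, and the inverse
  -- function theorem applied to `P = (parameters, R)` solves the equation smoothly.
  let R : (ℝ × E) × C(I, E) → C(I, E) := fun q => q.2 - (cst q.1.2 + q.1.1 • primitiveCLM E (N q.2))
  have hR : ContDiff ℝ ∞ R := by
    have h1 : ContDiff ℝ ∞ fun q : (ℝ × E) × C(I, E) => primitiveCLM E (N q.2) :=
      (primitiveCLM E).contDiff.comp (hN.comp contDiff_snd)
    have h2 : ContDiff ℝ ∞ fun q : (ℝ × E) × C(I, E) => cst q.1.2 :=
      cst.contDiff.comp (contDiff_snd.comp contDiff_fst)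
    exact contDiff_snd.sub (h2.add ((contDiff_fst.comp contDiff_fst).smul h1))
  let P : (ℝ × E) × C(I, E) → (ℝ × E) × C(I, E) := fun q => (q.1, R q)
  have hP : ContDiff ℝ ∞ P := contDiff_fst.prodMk hR
  let a : (ℝ × E) × C(I, E) := ((0, x₀), cst x₀)
  -- The derivative of `R` at `a` is the second projection plus some operator `w` in the parameters.
  -- The value of `w` is irrelevant: the derivative of `P` is a shear, inverted by changing the sign
  -- of `w`.
  obtain ⟨w, hw⟩ : ∃ w : (ℝ × E) →L[ℝ] C(I, E), HasFDerivAt R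
      (ContinuousLinearMap.snd ℝ (ℝ × E) C(I, E) + w.comp (.fst ℝ (ℝ × E) C(I, E))) a := by
    let D := fderiv ℝ R a
    have hD : HasFDerivAt R D a := (hR.differentiable (by simp) a).hasFDerivAt
    refine ⟨D.comp (.inl ℝ _ _), ?_⟩
    convert! hD using 1
    have h2 : ∀ k, D (0, k) = k := by
      intro k
      have e1 : HasFDerivAt (fun α : C(I, E) => R ((0, x₀), α))
          (D.comp (.inr ℝ (ℝ × E) C(I, E))) (cst x₀) :=
        HasFDerivAt.comp (g := R) (cst x₀) hD (hasFDerivAt_prodMk_right _ _)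
      have e2 : HasFDerivAt (fun α : C(I, E) => R ((0, x₀), α)) (.id ℝ _) (cst x₀) := by
        simp only [R, zero_smul, add_zero]
        exact (hasFDerivAt_id _).sub_const _
      have := e1.unique e2
      exact DFunLike.congr_fun this k
    ext1
    · ext1 <;> ext <;> simp
    · ext k : 1
      simp [h2]
  let e : ((ℝ × E) × C(I, E)) ≃L[ℝ] ((ℝ × E) × C(I, E)) :=
    ContinuousLinearEquiv.equivOfInverse
      ((ContinuousLinearMap.fst ℝ (ℝ × E) C(I, E)).prod
        (ContinuousLinearMap.snd ℝ (ℝ × E) C(I, E) + w.comp (.fst ℝ (ℝ × E) C(I, E))))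
      ((ContinuousLinearMap.fst ℝ (ℝ × E) C(I, E)).prod
        (ContinuousLinearMap.snd ℝ (ℝ × E) C(I, E) - w.comp (.fst ℝ (ℝ × E) C(I, E))))
      (fun q => by ext1 <;> simp) (fun q => by ext1 <;> simp)
  have hPe : HasFDerivAt P (e : ((ℝ × E) × C(I, E)) →L[ℝ] ((ℝ × E) × C(I, E))) a :=
    hasFDerivAt_fst.prodMk hw
  obtain ⟨g, hg0, hg⟩ := exists_smooth_localInverse
    (Eventually.of_forall fun x => hP.contDiffAt) hPe
  have hPa : P a = ((0, x₀), 0) := by simp [P, R, a]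
  rw [hPa] at hg hg0
  have hcont : Tendsto (fun p : ℝ × E => ((p, 0) : (ℝ × E) × C(I, E))) (𝓝 (0, x₀))
      (𝓝 ((0, x₀), 0)) := (Continuous.prodMk_left 0).tendsto _
  refine ⟨fun p => (g (p, 0)).2, by simp only [hg0]; rfl, ?_⟩
  filter_upwards [hcont.eventually hg] with p ⟨hp1, hp2⟩
  refine ⟨contDiffAt_snd.comp p (hp1.comp p (contDiffAt_id.prodMk contDiffAt_const)), fun s => ?_⟩
  have h1 : (g (p, 0)).1 = p := congrArg Prod.fst hp2
  have h2 : R (g (p, 0)) = 0 := congrArg Prod.snd hp2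
  simp only [R, h1] at h2
  exact DFunLike.congr_fun (sub_eq_zero.1 h2) s

/-- Smooth dependence of the solutions of an ordinary differential equation on time and on the
initial value. -/
theorem exists_smooth_local_flow_of_contDiff {f : E → E} (hf : ContDiff ℝ ∞ f) (x₀ : E) {U : Set E}
    (hU : U ∈ 𝓝 x₀) :
    ∃ Φ : ℝ × E → E, Φ (0, x₀) = x₀ ∧ ∀ᶠ p in 𝓝 ((0, x₀) : ℝ × E), ContDiffAt ℝ ∞ Φ p ∧
      ∃ (β : ℝ → E) (a b : ℝ), 0 ∈ Ioo a b ∧ p.1 ∈ Ioo a b ∧ β 0 = p.2 ∧ β p.1 = Φ p ∧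
        ∀ t ∈ Ioo a b, HasDerivAt β (f (β t)) t ∧ β t ∈ U := by
  obtain ⟨A, hA0, hA⟩ := exists_smooth_rescaled_solution hf x₀
  -- The flow at time `τ` is the rescaled solution at time `1`. The interval reaches to `2` so that
  -- `1` is an interior time.
  let one : Icc (-2 : ℝ) 2 := ⟨1, by norm_num, by norm_num⟩
  have hAc : ContinuousAt A (0, x₀) := hA.self_of_nhds.1.continuousAt
  have hAU : ∀ᶠ p in 𝓝 ((0, x₀) : ℝ × E), ∀ s, A p s ∈ U := by
    obtain ⟨δ, hδ, hδU⟩ := Metric.mem_nhds_iff.1 hU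
    filter_upwards [hAc (Metric.ball_mem_nhds _ hδ)] with p hp s
    apply hδU
    rw [mem_preimage, Metric.mem_ball, hA0, ContinuousMap.dist_lt_iff hδ] at hp
    simpa using hp s
  have hgood := hA.and hAU
  -- Undoing the rescaling: `t ↦ A p (t / τ)` solves the original equation for `|t| < 2 |τ|`, when
  -- `τ = p.1` is nonzero.
  have hsol : ∀ p : ℝ × E, (p.1 ≠ 0) → (∀ s : Icc (-2 : ℝ) 2,
        A p s = p.2 + p.1 • ∫ r in (0 : ℝ)..s, f (A p (projIcc (-2) 2 (by norm_num) r))) →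
      (∀ s, A p s ∈ U) →
      ∃ (β : ℝ → E), β 0 = p.2 ∧ β p.1 = A p one ∧
        ∀ t ∈ Ioo (-2 * |p.1|) (2 * |p.1|), HasDerivAt β (f (β t)) t ∧ β t ∈ U := by
    intro p hp hpA hpU
    have hc : Continuous fun r => f (A p (projIcc (-2) 2 (by norm_num) r)) :=
      hf.continuous.comp ((A p).continuous.comp continuous_projIcc)
    refine ⟨fun t => p.2 + p.1 • ∫ r in (0 : ℝ)..(t / p.1),
      f (A p (projIcc (-2) 2 (by norm_num) r)), by simp, ?_, fun t ht => ?_⟩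
    · rw [hpA]; simp [div_self hp, one]
    · have hs : t / p.1 ∈ Icc (-2 : ℝ) 2 := by
        rw [mem_Icc, ← abs_le, abs_div, div_le_iff₀ (abs_pos.2 hp)]
        exact (abs_lt.2 ⟨by linarith [ht.1], ht.2⟩).le
      have hβ : p.2 + p.1 • ∫ r in (0 : ℝ)..(t / p.1),
          f (A p (projIcc (-2) 2 (by norm_num) r)) = A p ⟨t / p.1, hs⟩ :=
        (hpA ⟨t / p.1, hs⟩).symm
      simp only [hβ]
      refine ⟨?_, hpU _⟩
      have h1 := (hc.integral_hasStrictDerivAt 0 (t / p.1)).hasDerivAt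
      have h2 := ((h1.scomp t ((hasDerivAt_id t).div_const p.1)).const_smul p.1).const_add p.2
      convert! h2 using 1
      rw [projIcc_of_mem _ hs, smul_smul, mul_one_div, div_self hp, one_smul]
  refine ⟨fun p => A p one, by simp only [hA0]; rfl, ?_⟩
  obtain ⟨ε, hε, hball⟩ := Metric.eventually_nhds_iff_ball.1 hgood
  filter_upwards [Metric.ball_mem_nhds _ hε] with p hp
  obtain ⟨⟨hp1, hp2⟩, hp3⟩ := hball p hp
  refine ⟨(ContinuousMap.evalCLM (R := ℝ) (M := E) one).contDiff.contDiffAt.comp p hp1, ?_⟩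
  -- At time zero the rescaling degenerates, so the solution curve is borrowed from the parameter `ε
  -- / 2` with the same initial value; only its value at `0` matters.
  by_cases h0 : p.1 = 0
  · have hq : (ε / 2, p.2) ∈ Metric.ball ((0, x₀) : ℝ × E) ε := by
      rw [Metric.mem_ball, Prod.dist_eq, max_lt_iff] at hp ⊢
      refine ⟨?_, hp.2⟩
      rw [dist_zero_right, Real.norm_of_nonneg (by positivity)]
      linarith
    obtain ⟨⟨-, hq2⟩, hq3⟩ := hball _ hq
    obtain ⟨β, hβ0, -, hβ⟩ := hsol (ε / 2, p.2) (by positivity) hq2 hq3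
    have hpos : 0 < |ε / 2| := by positivity
    refine ⟨β, _, _, ⟨?_, ?_⟩, ⟨?_, ?_⟩, hβ0, ?_, hβ⟩
    · simpa using hε.ne'
    · simpa using hε.ne'
    · simpa [h0] using hε.ne'
    · simpa [h0] using hε.ne'
    · rw [h0, hβ0, hp2, h0]; simp
  · obtain ⟨β, hβ0, hβ1, hβ⟩ := hsol p h0 hp2 hp3
    have hpos : 0 < |p.1| := abs_pos.2 h0
    refine ⟨β, _, _, ⟨by linarith, by linarith⟩, ⟨?_, ?_⟩, hβ0, hβ1, hβ⟩
    · linarith [neg_abs_le p.1]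
    · linarith [le_abs_self p.1]

/-- Local version of `exists_smooth_local_flow_of_contDiff`. -/
theorem exists_smooth_local_flow [FiniteDimensional ℝ E] {f : E → E} {x₀ : E}
    (hf : ∀ᶠ x in 𝓝 x₀, ContDiffAt ℝ ∞ f x) {U : Set E} (hU : U ∈ 𝓝 x₀) :
    ∃ Φ : ℝ × E → E, Φ (0, x₀) = x₀ ∧ ∀ᶠ p in 𝓝 ((0, x₀) : ℝ × E), ContDiffAt ℝ ∞ Φ p ∧
      ∃ (β : ℝ → E) (a b : ℝ), 0 ∈ Ioo a b ∧ p.1 ∈ Ioo a b ∧ β 0 = p.2 ∧ β p.1 = Φ p ∧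
        ∀ t ∈ Ioo a b, HasDerivAt β (f (β t)) t ∧ β t ∈ U := by
  obtain ⟨r, hr, hball⟩ := Metric.eventually_nhds_iff_ball.1 hf
  -- The cut-off equals one on the ball of radius `r / 3`, where the solutions are forced to stay,
  -- and vanishes outside the ball of radius `r / 2`, so they solve the original equation.
  let b : ContDiffBump x₀ := ⟨r / 3, r / 2, by positivity, by linarith⟩
  have hcd : ContDiff ℝ ∞ fun x => b x • f x := by
    rw [contDiff_iff_contDiffAt]
    intro x
    by_cases hx : x ∈ Metric.ball x₀ r
    · exact b.contDiffAt.smul (hball x hx)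
    · have hev : (fun x => b x • f x) =ᶠ[𝓝 x] fun _ => 0 := by
        have : (Metric.closedBall x₀ (r / 2))ᶜ ∈ 𝓝 x := by
          refine Metric.isClosed_closedBall.isOpen_compl.mem_nhds fun h => hx ?_
          exact Metric.closedBall_subset_ball (by linarith) h
        filter_upwards [this] with y hy
        rw [mem_compl_iff, Metric.mem_closedBall, not_le] at hy
        rw [b.zero_of_le_dist hy.le, zero_smul]
      exact contDiffAt_const.congr_of_eventuallyEq hev
  obtain ⟨Φ, h0, hΦ⟩ := exists_smooth_local_flow_of_contDiff hcd x₀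
    (inter_mem hU (Metric.ball_mem_nhds x₀ (show 0 < r / 3 by positivity)))
  refine ⟨Φ, h0, hΦ.mono fun p hp => ⟨hp.1, ?_⟩⟩
  obtain ⟨β, a', b', h1, h2, h3, h4, h5⟩ := hp.2
  refine ⟨β, a', b', h1, h2, h3, h4, fun t ht => ⟨?_, (h5 t ht).2.1⟩⟩
  have := (h5 t ht).1
  rwa [b.one_of_mem_closedBall (Metric.ball_subset_closedBall (h5 t ht).2.2), one_smul] at this

end LocalFlow

/-! ### Flows and maximal integral curves of a smooth vector field on a manifold. -/

section ManifoldFlow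

variable {E : Type u} [NormedAddCommGroup E] [NormedSpace ℝ E]
  {H : Type*} [TopologicalSpace H] {I : ModelWithCorners ℝ E H}
  {N : Type*} [TopologicalSpace N] [ChartedSpace H N]

/-- The integral curve of `v` through `z` at time `0` reaches `z'` at time `t`. -/
def FlowRel (v : ∀ z : N, TangentSpace I z) (z : N) (t : ℝ) (z' : N) : Prop :=
  ∃ (β : ℝ → N) (a b : ℝ), 0 ∈ Ioo a b ∧ t ∈ Ioo a b ∧ IsMIntegralCurveOn β v (Ioo a b) ∧
    β 0 = z ∧ β t = z'

theorem FlowRel.symm {v : ∀ z : N, TangentSpace I z} {z z' : N} {t : ℝ} (h : FlowRel v z t z') :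
    FlowRel v z' (-t) z := by
  obtain ⟨β, a, b, h0, ht, hβ, rfl, rfl⟩ := h
  refine ⟨β ∘ (· + t), a - t, b - t, ?_, ?_, ?_, by simp, by simp⟩
  · constructor <;> linarith [ht.1, ht.2]
  · constructor <;> linarith [h0.1, h0.2]
  · refine (hβ.comp_add t).mono fun s hs => ?_
    exact ⟨by linarith [hs.1], by linarith [hs.2]⟩

theorem FlowRel.of_isMIntegralCurveOn {v : ∀ z : N, TangentSpace I z} {γ : ℝ → N} {J : Set ℝ}
    (hJ : IsOpen J) (hJ' : J.OrdConnected) (hγ : IsMIntegralCurveOn γ v J) {s t : ℝ} (hs : s ∈ J)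
    (ht : t ∈ J) : FlowRel v (γ s) (t - s) (γ t) := by
  have key : ∀ r ∈ J, ∃ ε > 0, Ioo (r - ε) (r + ε) ⊆ J := fun r hr => by
    simpa [Real.ball_eq_Ioo] using Metric.isOpen_iff.1 hJ r hr
  obtain ⟨ε, hε, hεJ⟩ := key _ hs
  obtain ⟨δ, hδ, hδJ⟩ := key _ ht
  -- `FlowRel` needs an open interval around both times; since `J` is open and order connected, the
  -- segment between them can be lengthened slightly at both ends.
  have hsub : Ioo (min s t - min ε δ) (max s t + min ε δ) ⊆ J := by
    intro r hr
    have h1 := min_le_left ε δ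
    have h2 := min_le_right ε δ
    rcases le_total s t with hst | hst
    · rw [min_eq_left hst, max_eq_right hst] at hr
      rcases lt_or_ge r s with h | h
      · exact hεJ ⟨by linarith [hr.1], by linarith⟩
      rcases le_or_gt r t with h' | h'
      · exact hJ'.out hs ht ⟨h, h'⟩
      · exact hδJ ⟨by linarith, by linarith [hr.2]⟩
    · rw [min_eq_right hst, max_eq_left hst] at hr
      rcases lt_or_ge r t with h | h
      · exact hδJ ⟨by linarith [hr.1], by linarith⟩
      rcases le_or_gt r s with h' | h'
      · exact hJ'.out ht hs ⟨h, h'⟩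
      · exact hεJ ⟨by linarith, by linarith [hr.2]⟩
  have hpos : 0 < min ε δ := lt_min hε hδ
  have h1 := min_le_left s t
  have h2 := min_le_right s t
  have h3 := le_max_left s t
  have h4 := le_max_right s t
  refine ⟨γ ∘ (· + s), min s t - min ε δ - s, max s t + min ε δ - s, ?_, ?_, ?_, by simp, by simp⟩
  · constructor <;> linarith
  · constructor <;> linarith
  · refine (hγ.comp_add s).mono fun r hr => hsub ⟨by linarith [hr.1], by linarith [hr.2]⟩

variable [IsManifold I ∞ N]

/-- A vector field read in the preferred chart at `z₀`. -/
noncomputable def chartField (v : ∀ z : N, TangentSpace I z) (z₀ : N) (y : E) : E :=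
  tangentCoordChange I ((extChartAt I z₀).symm y) z₀ ((extChartAt I z₀).symm y)
    (v ((extChartAt I z₀).symm y))

theorem chartField_extChartAt (v : ∀ z : N, TangentSpace I z) {z₀ z : N}
    (hz : z ∈ (extChartAt I z₀).source) :
    chartField v z₀ (extChartAt I z₀ z) = tangentCoordChange I z z₀ z (v z) := by
  unfold chartField; rw [(extChartAt I z₀).left_inv hz]

theorem contDiffAt_chartField [I.Boundaryless] {v : ∀ z : N, TangentSpace I z}
    (hv : ContMDiff I I.tangent ∞ (fun z => (⟨z, v z⟩ : TangentBundle I N))) (z₀ : N) {y : E}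
    (hy : y ∈ (extChartAt I z₀).target) : ContDiffAt ℝ ∞ (chartField v z₀) y := by
  have h1 : ContMDiffAt 𝓘(ℝ, E) I.tangent ∞
      (fun y => (⟨(extChartAt I z₀).symm y, v ((extChartAt I z₀).symm y)⟩ : TangentBundle I N)) y :=
    (hv _).comp y ((contMDiffOn_extChartAt_symm z₀).contMDiffAt
      ((isOpen_extChartAt_target z₀).mem_nhds hy))
  have h2 := contMDiffAt_extChartAt' (I := I.tangent) (n := ∞)
    (x := (⟨z₀, v z₀⟩ : TangentBundle I N))
    (x' := ⟨(extChartAt I z₀).symm y, v ((extChartAt I z₀).symm y)⟩)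
    (by
      rw [TangentBundle.mem_chart_source_iff, ← extChartAt_source I]
      exact (extChartAt I z₀).map_target hy)
  have h3 := (h2.comp y h1).contDiffAt
  exact contDiffAt_snd.comp y h3

/-- The manifold derivative is read in the preferred chart at the running point, not in the one at
`z₀`. The coordinate change between the two carries `chartField v z₀` to the value of `v`. -/
theorem isMIntegralCurveOn_of_chart [I.Boundaryless] {v : ∀ z : N, TangentSpace I z} {z₀ : N}
    {β : ℝ → E} {s : Set ℝ}
    (hβ : ∀ t ∈ s, HasDerivAt β (chartField v z₀ (β t)) t ∧ β t ∈ (extChartAt I z₀).target) :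
    IsMIntegralCurveOn ((extChartAt I z₀).symm ∘ β) v s := by
  intro t ht
  obtain ⟨h, hf3'⟩ := hβ t ht
  let xₜ : N := (extChartAt I z₀).symm (β t)
  have hft1 : xₜ ∈ (extChartAt I z₀).source := (extChartAt I z₀).map_target hf3'
  have hft2 := mem_extChartAt_source (I := I) xₜ
  let w : E := v xₜ
  suffices hs : HasDerivAt ((extChartAt I xₜ ∘ (extChartAt I z₀).symm) ∘ β) w t by
    have hs' : HasFDerivWithinAt ((extChartAt I xₜ ∘ (extChartAt I z₀).symm) ∘ β)
        ((1 : ℝ →L[ℝ] ℝ).smulRight w) univ t := by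
      rw [hasFDerivWithinAt_univ]
      convert! hs.hasFDerivAt using 1
    apply HasMFDerivAt.hasMFDerivWithinAt
    refine ⟨(continuousAt_extChartAt_symm'' hf3').comp h.continuousAt, ?_⟩
    simp only [mfld_simps]
    exact hs'
  have hw : tangentCoordChange I z₀ xₜ xₜ (chartField v z₀ (β t)) = w := by
    refine (tangentCoordChange_comp (x := z₀) ⟨⟨hft2, hft1⟩, hft2⟩).trans ?_
    exact tangentCoordChange_self hft2
  rw [← hw]
  apply HasFDerivAt.comp_hasDerivAt _ _ h
  have hd := hasFDerivWithinAt_tangentCoordChange (I := I) (x := z₀) (y := xₜ) (z := xₜ)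
    ⟨hft1, hft2⟩
  rw [(extChartAt I z₀).right_inv hf3', I.range_eq_univ, hasFDerivWithinAt_univ] at hd
  exact hd

theorem HasMFDerivAt.hasDerivAt_extChartAt [I.Boundaryless] {v : ∀ z : N, TangentSpace I z} {γ : ℝ → N} {t : ℝ}
    (hγ : HasMFDerivAt 𝓘(ℝ, ℝ) I γ t ((1 : ℝ →L[ℝ] ℝ).smulRight (v (γ t)))) {z₀ : N}
    (hz : γ t ∈ (extChartAt I z₀).source) :
    HasDerivAt (extChartAt I z₀ ∘ γ) (chartField v z₀ (extChartAt I z₀ (γ t))) t := by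
  let w : E := v (γ t)
  have hft2 := mem_extChartAt_source (I := I) (γ t)
  have h1 : HasFDerivAt (extChartAt I (γ t) ∘ γ) ((1 : ℝ →L[ℝ] ℝ).smulRight w) t := by
    have h0 : HasFDerivWithinAt (extChartAt I (γ t) ∘ γ) ((1 : ℝ →L[ℝ] ℝ).smulRight w)
      (range 𝓘(ℝ, ℝ)) t := hγ.2
    rwa [ModelWithCorners.range_eq_univ, hasFDerivWithinAt_univ] at h0
  have h2 : HasDerivAt (extChartAt I (γ t) ∘ γ) w t := by
    rw [hasDerivAt_iff_hasFDerivAt]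
    convert! h1 using 1
  have h3 := hasFDerivWithinAt_tangentCoordChange (I := I) (x := γ t) (y := z₀) (z := γ t)
    ⟨hft2, hz⟩
  rw [I.range_eq_univ, hasFDerivWithinAt_univ] at h3
  have h4 := h3.comp_hasDerivAt t h2
  rw [show chartField v z₀ (extChartAt I z₀ (γ t)) = tangentCoordChange I (γ t) z₀ (γ t) w from
    chartField_extChartAt v hz]
  refine h4.congr_of_eventuallyEq ?_
  filter_upwards [hγ.1.preimage_mem_nhds (extChartAt_source_mem_nhds (I := I) (γ t))] with s hs
  simp only [Function.comp_apply, (extChartAt I (γ t)).left_inv hs]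

variable [I.Boundaryless] {v : ∀ z : N, TangentSpace I z}

/-- Local flows depend smoothly on time and on the initial point. -/
theorem exists_local_flow [FiniteDimensional ℝ E]
    (hv : ContMDiff I I.tangent ∞ (fun z => (⟨z, v z⟩ : TangentBundle I N))) (z₀ : N) :
    ∃ Φ : ℝ × N → N, Φ (0, z₀) = z₀ ∧ ∀ᶠ p in 𝓝 ((0, z₀) : ℝ × N),
      ContMDiffAt (𝓘(ℝ, ℝ).prod I) I ∞ Φ p ∧ FlowRel v p.2 p.1 (Φ p) := by
  have := FiniteDimensional.complete ℝ E
  let φ := extChartAt I z₀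
  have htarget : φ.target ∈ 𝓝 (φ z₀) := extChartAt_target_mem_nhds z₀
  obtain ⟨Ψ, hΨ0, hΨ⟩ := exists_smooth_local_flow (f := chartField v z₀) (x₀ := φ z₀)
    (by filter_upwards [htarget] with y hy using contDiffAt_chartField hv z₀ hy) htarget
  have hτ : Tendsto (fun p : ℝ × N => (p.1, φ p.2)) (𝓝 (0, z₀)) (𝓝 (0, φ z₀)) :=
    continuousAt_fst.prodMk (ContinuousAt.comp (f := Prod.snd) (x := ((0, z₀) : ℝ × N))
      (continuousAt_extChartAt (I := I) z₀) continuousAt_snd)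
  refine ⟨fun p => φ.symm (Ψ (p.1, φ p.2)), (congrArg φ.symm hΨ0).trans (extChartAt_to_inv z₀), ?_⟩
  filter_upwards [hτ.eventually hΨ,
    (continuousAt_snd (p := ((0, z₀) : ℝ × N))).eventually (extChartAt_source_mem_nhds (I := I) z₀)]
    with p hp hps
  obtain ⟨hp1, β, a, b, h0, h1, hβ0, hβ1, hβ⟩ := hp
  have ht : Ψ (p.1, φ p.2) ∈ φ.target := hβ1 ▸ (hβ _ h1).2
  constructor
  · have e1 : ContMDiffAt 𝓘(ℝ, E) I ∞ φ.symm (Ψ (p.1, φ p.2)) :=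
      (contMDiffOn_extChartAt_symm z₀).contMDiffAt ((isOpen_extChartAt_target z₀).mem_nhds ht)
    have e2 : ContMDiffAt 𝓘(ℝ, ℝ × E) 𝓘(ℝ, E) ∞ Ψ (p.1, φ p.2) := hp1.contMDiffAt
    have e3 : ContMDiffAt (𝓘(ℝ, ℝ).prod I) 𝓘(ℝ, ℝ × E) ∞ (fun p : ℝ × N => (p.1, φ p.2)) p :=
      contMDiffAt_fst.prodMk_space ((contMDiffAt_extChartAt' (by rwa [← extChartAt_source I])).comp p
        contMDiffAt_snd)
    exact e1.comp p (e2.comp p e3)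
  · refine ⟨φ.symm ∘ β, a, b, h0, h1, isMIntegralCurveOn_of_chart hβ, ?_, ?_⟩
    · exact (congrArg φ.symm hβ0).trans ((extChartAt I z₀).left_inv hps)
    · simp [hβ1]

variable [T2Space N]

theorem FlowRel.unique (hv : ContMDiff I I.tangent ∞ (fun z => (⟨z, v z⟩ : TangentBundle I N)))
    {z z' z'' : N} {t : ℝ} (h : FlowRel v z t z') (h' : FlowRel v z t z'') : z' = z'' := by
  obtain ⟨β, a, b, h0, ht, hβ, hβ0, rfl⟩ := h
  obtain ⟨β', a', b', h0', ht', hβ', hβ0', rfl⟩ := h'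
  refine isMIntegralCurveOn_Ioo_eqOn_of_contMDiff_boundaryless (t₀ := 0)
    (a := max a a') (b := min b b') ?_ (hv.of_le (by simp))
    (hβ.mono (Ioo_subset_Ioo (le_max_left ..) (min_le_left ..)))
    (hβ'.mono (Ioo_subset_Ioo (le_max_right ..) (min_le_right ..))) (hβ0.trans hβ0'.symm) ?_
  · exact ⟨max_lt h0.1 h0'.1, lt_min h0.2 h0'.2⟩
  · exact ⟨max_lt ht.1 ht'.1, lt_min ht.2 ht'.2⟩

/-- The second curve, delayed by `s`, agrees with the first at time `s`; the two glue to an integral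
curve on the union of the overlapping intervals. -/
theorem FlowRel.trans (hv : ContMDiff I I.tangent ∞ (fun z => (⟨z, v z⟩ : TangentBundle I N)))
    {z z' z'' : N} {s t : ℝ} (h : FlowRel v z s z') (h' : FlowRel v z' t z'') :
    FlowRel v z (s + t) z'' := by
  obtain ⟨β, a, b, h0, hs, hβ, rfl, rfl⟩ := h
  obtain ⟨β', a', b', h0', ht', hβ', hβ0', rfl⟩ := h'
  have hγ' : IsMIntegralCurveOn (β' ∘ (· + -s)) v (Ioo (a' + s) (b' + s)) :=
    (hβ'.comp_add (-s)).mono fun r hr => ⟨by linarith [hr.1], by linarith [hr.2]⟩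
  have hs' : s ∈ Ioo a b ∩ Ioo (a' + s) (b' + s) :=
    ⟨hs, by linarith [h0'.1], by linarith [h0'.2]⟩
  have heq : β s = (β' ∘ (· + -s)) s := by simp [hβ0']
  have hv1 := hv.of_le (m := 1) (by simp)
  have hmem : s + t ∈ Ioo (a' + s) (b' + s) := ⟨by linarith [ht'.1], by linarith [ht'.2]⟩
  have hU := isMIntegralCurveOn_piecewise hv1 hβ hγ' hs' heq
  have hval := eqOn_piecewise_of_isMIntegralCurveOn_Ioo hv1 hβ hγ' hs' heq hmem
  have huo : Ioo a b ∪ Ioo (a' + s) (b' + s) = Ioo (min a (a' + s)) (max b (b' + s)) :=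
    Ioo_union_Ioo' (hs'.2.1.trans hs.2) (hs.1.trans hs'.2.2)
  have := FlowRel.of_isMIntegralCurveOn (isOpen_Ioo.union isOpen_Ioo)
    (huo ▸ ordConnected_Ioo) hU (Or.inl h0) (Or.inr hmem)
  rw [hval] at this
  simpa [piecewise_eq_of_mem _ _ _ h0, add_comm s t] using this

/-- Time-`t` flow maps are smooth near a point where they are defined. -/
theorem FlowRel.exists_smooth [FiniteDimensional ℝ E]
    (hv : ContMDiff I I.tangent ∞ (fun z => (⟨z, v z⟩ : TangentBundle I N))) {z₀ z₁ : N} {t : ℝ}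
    (h : FlowRel v z₀ t z₁) :
    ∃ Ψ : N → N, Ψ z₀ = z₁ ∧ ∀ᶠ z in 𝓝 z₀, ContMDiffAt I I ∞ Ψ z ∧ FlowRel v z t (Ψ z) := by
  obtain ⟨β, a, b, h0, ht, hβ, rfl, rfl⟩ := h
  -- The property `P` is spread along the connected time interval. Near each time `r` it passes from
  -- `r` to nearby `s` and back, by composing with the local flow around `β r`.
  let P : ℝ → Prop := fun s => ∃ Ψ : N → N, Ψ (β 0) = β s ∧
    ∀ᶠ z in 𝓝 (β 0), ContMDiffAt I I ∞ Ψ z ∧ FlowRel v z s (Ψ z)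
  have hP0 : P 0 := by
    refine ⟨id, rfl, ?_⟩
    obtain ⟨Φ, hΦ0, hΦ⟩ := exists_local_flow hv (β 0)
    have : Tendsto (fun z : N => ((0, z) : ℝ × N)) (𝓝 (β 0)) (𝓝 (0, β 0)) :=
      (Continuous.prodMk_right 0).tendsto _
    filter_upwards [this.eventually hΦ] with z hz
    obtain ⟨β', a', b', h0', -, hβ', hz0, -⟩ := hz.2
    exact ⟨contMDiffAt_id, β', a', b', h0', h0', hβ', hz0, hz0⟩
  refine isPreconnected_Ioo.induction₂' (fun r s => P r → P s) (fun r hr => ?_)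
    (fun _ _ _ _ _ _ h1 h2 h => h2 (h1 h)) h0 ht hP0
  obtain ⟨Φ, hΦ0, hΦ⟩ := exists_local_flow hv (β r)
  have hβc : ContinuousAt β r := (hβ.continuousWithinAt hr).continuousAt (Ioo_mem_nhds hr.1 hr.2)
  -- The flow up to time `s` followed by the local flow for time `s' - s`. Uniqueness of integral
  -- curves identifies the image of `β 0` with `β s'`.
  have step : ∀ s s', s ∈ Ioo a b → s' ∈ Ioo a b →
      (∀ᶠ p in 𝓝 ((s' - s, β s) : ℝ × N),
        ContMDiffAt (𝓘(ℝ, ℝ).prod I) I ∞ Φ p ∧ FlowRel v p.2 p.1 (Φ p)) → P s → P s' := by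
    rintro s s' hs hs' hev ⟨Ψ, hΨ0, hΨ⟩
    have hΨc : Tendsto (fun z => ((s' - s, Ψ z) : ℝ × N)) (𝓝 (β 0)) (𝓝 (s' - s, β s)) := by
      have := hΨ.self_of_nhds.1.continuousAt
      rw [ContinuousAt, hΨ0] at this
      exact tendsto_const_nhds.prodMk_nhds this
    refine ⟨fun z => Φ (s' - s, Ψ z), ?_, ?_⟩
    · simp only [hΨ0]
      exact FlowRel.unique hv hev.self_of_nhds.2
        (FlowRel.of_isMIntegralCurveOn isOpen_Ioo ordConnected_Ioo hβ hs hs')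
    · filter_upwards [hΨ, hΨc.eventually hev] with z h1 h2
      refine ⟨h2.1.comp z (contMDiffAt_const.prodMk h1.1), ?_⟩
      simpa using h1.2.trans hv h2.2
  have hΦ' := eventually_eventually_nhds.2 hΦ
  have t1 : Tendsto (fun s => ((s - r, β r) : ℝ × N)) (𝓝 r) (𝓝 (0, β r)) := by
    have : Continuous fun s => ((s - r, β r) : ℝ × N) := by fun_prop
    simpa using this.tendsto r
  have t2 : Tendsto (fun s => ((r - s, β s) : ℝ × N)) (𝓝 r) (𝓝 (0, β r)) := by
    have : ContinuousAt (fun s => ((r - s, β s) : ℝ × N)) r :=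
      (continuousAt_const.sub continuousAt_id).prodMk hβc
    simpa [ContinuousAt] using this
  filter_upwards [self_mem_nhdsWithin, mem_nhdsWithin_of_mem_nhds (t1.eventually hΦ'),
    mem_nhdsWithin_of_mem_nhds (t2.eventually hΦ')] with s hs h1 h2
  exact ⟨step r s hr hs h1, step s r hs hr h2⟩

/-- The domain of the maximal integral curve of `v` through `z`. -/
def maximalTimes (v : ∀ z : N, TangentSpace I z) (z : N) : Set ℝ :=
  {t | ∃ z', FlowRel v z t z'}

open Classical in
/-- The maximal integral curve of `v` through `z`. -/
noncomputable def maximalCurve (v : ∀ z : N, TangentSpace I z) (z : N) (t : ℝ) : N :=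
  if h : ∃ z', FlowRel v z t z' then h.choose else z

omit [IsManifold I ∞ N] [I.Boundaryless] [T2Space N] in
theorem flowRel_maximalCurve {z : N} {t : ℝ} (ht : t ∈ maximalTimes v z) :
    FlowRel v z t (maximalCurve v z t) := by
  have h : ∃ z', FlowRel v z t z' := ht
  rw [maximalCurve, dif_pos h]
  exact h.choose_spec

omit [IsManifold I ∞ N] [I.Boundaryless] [T2Space N] in
theorem FlowRel.of_mem_Ioo {β : ℝ → N} {a b : ℝ} (h0 : 0 ∈ Ioo a b)
    (hβ : IsMIntegralCurveOn β v (Ioo a b)) {s : ℝ} (hs : s ∈ Ioo a b) :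
    FlowRel v (β 0) s (β s) := ⟨β, a, b, h0, hs, hβ, rfl, rfl⟩

omit [IsManifold I ∞ N] [I.Boundaryless] [T2Space N] in
theorem isOpen_maximalTimes (z : N) : IsOpen (maximalTimes v z) := by
  rw [isOpen_iff_mem_nhds]
  rintro t ⟨-, β, a, b, h0, ht, hβ, rfl, rfl⟩
  filter_upwards [Ioo_mem_nhds ht.1 ht.2] with s hs using ⟨_, FlowRel.of_mem_Ioo h0 hβ hs⟩

omit [IsManifold I ∞ N] [I.Boundaryless] [T2Space N] in
theorem ordConnected_maximalTimes (z : N) : (maximalTimes v z).OrdConnected := by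
  refine ⟨?_⟩
  rintro s ⟨-, β, a, b, h0, hs, hβ, rfl, rfl⟩ t ⟨-, β', a', b', h0', ht, hβ', h, rfl⟩ r hr
  rcases le_total r 0 with h' | h'
  · exact ⟨_, FlowRel.of_mem_Ioo h0 hβ ⟨hs.1.trans_le hr.1, h'.trans_lt h0.2⟩⟩
  · rw [← h]
    exact ⟨_, FlowRel.of_mem_Ioo h0' hβ' ⟨h0'.1.trans_le h', hr.2.trans_lt ht.2⟩⟩

section

variable (hv : ContMDiff I I.tangent ∞ (fun z => (⟨z, v z⟩ : TangentBundle I N)))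
include hv

theorem FlowRel.eq_maximalCurve {z z' : N} {t : ℝ} (h : FlowRel v z t z') :
    maximalCurve v z t = z' :=
  (flowRel_maximalCurve ⟨z', h⟩).unique hv h

theorem isMIntegralCurveOn_maximalCurve (z : N) :
    IsMIntegralCurveOn (maximalCurve v z) v (maximalTimes v z) := by
  rintro t ⟨-, β, a, b, h0, ht, hβ, rfl, rfl⟩
  apply HasMFDerivAt.hasMFDerivWithinAt
  have h1 : maximalCurve v (β 0) =ᶠ[𝓝 t] β := by
    filter_upwards [Ioo_mem_nhds ht.1 ht.2] with s hs
    exact (FlowRel.of_mem_Ioo h0 hβ hs).eq_maximalCurve hv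
  have h2 := (hβ t ht).hasMFDerivAt (Ioo_mem_nhds ht.1 ht.2)
  rw [← h1.self_of_nhds] at h2
  exact h2.congr_of_eventuallyEq h1

variable [FiniteDimensional ℝ E]

-- Each point has a neighbourhood with a common positive lifetime, and compactness reduces to
-- finitely many of these.
omit [T2Space N] in
theorem exists_uniform_time {K : Set N} (hK : IsCompact K) :
    ∃ ε > 0, ∀ z ∈ K, Ioo (-ε) ε ⊆ maximalTimes v z := by
  refine hK.induction_on (p := fun K => ∃ ε > 0, ∀ z ∈ K, Ioo (-ε) ε ⊆ maximalTimes v z)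
    ⟨1, one_pos, by simp⟩ ?_ ?_ ?_
  · rintro s t hst ⟨ε, hε, h⟩
    exact ⟨ε, hε, fun z hz => h z (hst hz)⟩
  · rintro s t ⟨ε, hε, h⟩ ⟨δ, hδ, h'⟩
    refine ⟨min ε δ, lt_min hε hδ, fun z hz r hr => ?_⟩
    rcases hz with hz | hz
    · exact h z hz ⟨by linarith [hr.1, min_le_left ε δ], hr.2.trans_le (min_le_left _ _)⟩
    · exact h' z hz ⟨by linarith [hr.1, min_le_right ε δ], hr.2.trans_le (min_le_right _ _)⟩
  · intro z₀ _
    obtain ⟨Φ, -, hΦ⟩ := exists_local_flow hv z₀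
    rw [nhds_prod_eq] at hΦ
    obtain ⟨P, hP, Q, hQ, hPQ⟩ := eventually_prod_iff.1 hΦ
    obtain ⟨ε, hε, hεP⟩ := Metric.eventually_nhds_iff_ball.1 hP
    refine ⟨{z | Q z}, mem_nhdsWithin_of_mem_nhds hQ, ε, hε, fun z hz r hr => ?_⟩
    exact ⟨_, (hPQ (hεP r (by simpa [Real.ball_eq_Ioo] using hr)) hz).2⟩

/-- Near `t` the curve is `s ↦ Φ (s - t, ·)` for a local flow `Φ`, which is smooth in time. -/
theorem contMDiffOn_maximalCurve (z : N) :
    ContMDiffOn 𝓘(ℝ, ℝ) I ∞ (maximalCurve v z) (maximalTimes v z) := by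
  intro t ht
  apply ContMDiffAt.contMDiffWithinAt
  obtain ⟨Φ, -, hΦ⟩ := exists_local_flow hv (maximalCurve v z t)
  have hτ : Tendsto (fun s => ((s - t, maximalCurve v z t) : ℝ × N)) (𝓝 t)
      (𝓝 (0, maximalCurve v z t)) := by
    have : Continuous fun s => ((s - t, maximalCurve v z t) : ℝ × N) := by fun_prop
    simpa using this.tendsto t
  have h1 : maximalCurve v z =ᶠ[𝓝 t] fun s => Φ (s - t, maximalCurve v z t) := by
    filter_upwards [hτ.eventually hΦ] with s hs
    have := (flowRel_maximalCurve ht).trans hv hs.2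
    simpa using this.eq_maximalCurve hv
  refine ContMDiffAt.congr_of_eventuallyEq ?_ h1
  have h2 := (hτ.eventually hΦ).self_of_nhds.1
  refine ContMDiffAt.comp t h2 (ContMDiffAt.prodMk ?_ contMDiffAt_const)
  exact (contDiff_id.sub contDiff_const).contMDiff.contMDiffAt

end

end ManifoldFlow

/-! ### Linear algebra of Lorentzian forms and spacelike hyperplanes. -/

section LorentzAlgebra

variable {V : Type*} [AddCommGroup V] [Module ℝ V] [TopologicalSpace V]
  {W : Type*} [AddCommGroup W] [Module ℝ W] [TopologicalSpace W]

/-- A symmetric bilinear form of signature `(-,+,+,+)`. -/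
structure IsLorentzForm (G : V →L[ℝ] V →L[ℝ] ℝ) : Prop where
  symm : ∀ v w, G v w = G w v
  signature : ∃ b : Module.Basis (Fin 4) ℝ V,
    ∀ i j, G (b i) (b j) = if i = j then (if i = 0 then -1 else 1) else 0

/-- A linear map into a Lorentzian vector space whose induced form is positive definite. -/
def IsSpacelikeMap (G : V →L[ℝ] V →L[ℝ] ℝ) (D : W →L[ℝ] V) : Prop :=
  ∀ u, u ≠ 0 → 0 < G (D u) (D u)

namespace IsLorentzForm

variable {G : V →L[ℝ] V →L[ℝ] ℝ} (hG : IsLorentzForm G)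
include hG

theorem exists_coordinates : ∃ b : Module.Basis (Fin 4) ℝ V, ∀ v w, G v w =
    -(b.repr v 0 * b.repr w 0) + b.repr v 1 * b.repr w 1 + b.repr v 2 * b.repr w 2 +
      b.repr v 3 * b.repr w 3 := by
  obtain ⟨b, hb⟩ := hG.signature
  refine ⟨b, fun v w => ?_⟩
  have key : ∀ i, G v (b i) = b.repr v i * G (b i) (b i) := fun i => by
    conv_lhs => rw [← b.sum_repr v]
    rw [map_sum, _root_.sum_apply, Finset.sum_eq_single i]
    · simp
    · intro j _ hj
      simp [hb j i, hj]
    · simp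
  conv_lhs => rw [← b.sum_repr w]
  rw [map_sum, Fin.sum_univ_four]
  simp only [map_smul, key, hb, smul_eq_mul, if_true, one_ne_zero, if_false, Fin.reduceEq]
  ring

/-- In orthonormal coordinates orthogonality equates the product of the time components with the
Euclidean product of the space components. Cauchy–Schwarz, with `T` having the larger time
component, then makes the space part of `v` dominate. -/
theorem pos_of_orthogonal {T v : V} (hT : G T T < 0) (hv : v ≠ 0) (h : G v T = 0) :
    0 < G v v := by
  obtain ⟨b, hb⟩ := hG.exists_coordinates
  rw [hb] at hT h ⊢
  set t0 := b.repr T 0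
  set t1 := b.repr T 1
  set t2 := b.repr T 2
  set t3 := b.repr T 3
  have hne : ¬ (b.repr v 0 = 0 ∧ b.repr v 1 = 0 ∧ b.repr v 2 = 0 ∧ b.repr v 3 = 0) := by
    rintro ⟨h0, h1, h2, h3⟩
    refine hv (b.repr.map_eq_zero_iff.1 (Finsupp.ext fun i => ?_))
    fin_cases i <;> simpa
  set x0 := b.repr v 0
  set x1 := b.repr v 1
  set x2 := b.repr v 2
  set x3 := b.repr v 3
  have ht0 : 0 < t0 ^ 2 := by nlinarith [sq_nonneg t1, sq_nonneg t2, sq_nonneg t3]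
  have hx : 0 < x1 ^ 2 + x2 ^ 2 + x3 ^ 2 := by
    by_contra hle
    have h1 : x1 = 0 := by nlinarith [sq_nonneg x1, sq_nonneg x2, sq_nonneg x3]
    have h2 : x2 = 0 := by nlinarith [sq_nonneg x1, sq_nonneg x2, sq_nonneg x3]
    have h3 : x3 = 0 := by nlinarith [sq_nonneg x1, sq_nonneg x2, sq_nonneg x3]
    have h4 : x0 * t0 = 0 := by rw [h1, h2, h3] at h; linarith
    rcases mul_eq_zero.1 h4 with h0 | h0
    · exact hne ⟨h0, h1, h2, h3⟩
    · rw [h0] at ht0; simp at ht0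
  have hcs : (x1 * t1 + x2 * t2 + x3 * t3) ^ 2 ≤
      (x1 ^ 2 + x2 ^ 2 + x3 ^ 2) * (t1 ^ 2 + t2 ^ 2 + t3 ^ 2) := by
    nlinarith [sq_nonneg (x1 * t2 - x2 * t1), sq_nonneg (x1 * t3 - x3 * t1),
      sq_nonneg (x2 * t3 - x3 * t2)]
  have heq : (x0 * t0) ^ 2 = (x1 * t1 + x2 * t2 + x3 * t3) ^ 2 := by
    rw [show x0 * t0 = x1 * t1 + x2 * t2 + x3 * t3 by linarith]
  have hlt : (x1 ^ 2 + x2 ^ 2 + x3 ^ 2) * (t1 ^ 2 + t2 ^ 2 + t3 ^ 2) <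
      (x1 ^ 2 + x2 ^ 2 + x3 ^ 2) * t0 ^ 2 :=
    mul_lt_mul_of_pos_left (by nlinarith) hx
  have : x0 ^ 2 * t0 ^ 2 < (x1 ^ 2 + x2 ^ 2 + x3 ^ 2) * t0 ^ 2 := by nlinarith
  nlinarith [lt_of_mul_lt_mul_right this ht0.le]

/-- A causal vector orthogonal to a timelike one vanishes. -/
theorem eq_zero_of_causal {T v : V} (hT : G T T < 0) (hv : G v v ≤ 0) (h : G v T = 0) : v = 0 := by
  by_contra hne
  exact hv.not_gt (hG.pos_of_orthogonal hT hne h)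

/-- Timelike vectors in the same half cone pair negatively with the causal vectors in that cone. -/
theorem neg_of_same_cone {T N v : V} (hT : G T T < 0) (hN : G N N < 0) (hNT : G N T < 0)
    (hv : G v v ≤ 0) (hvT : G v T < 0) : G v N < 0 := by
  -- This combination is orthogonal to `T`, so its square is nonnegative. In the expansion the two
  -- square terms are nonpositive and negative respectively, so the cross term must be positive,
  -- which determines the sign of `G v N`.
  have h1 : 0 ≤ G (G N T • v - G v T • N) (G N T • v - G v T • N) := by
    by_cases h0 : G N T • v - G v T • N = 0
    · simp [h0]
    · refine (hG.pos_of_orthogonal hT h0 ?_).le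
      simp only [map_sub, map_smul, _root_.sub_apply, _root_.smul_apply, smul_eq_mul]
      ring
  simp only [map_sub, map_smul, _root_.sub_apply, _root_.smul_apply, smul_eq_mul,
    hG.symm N v] at h1
  have h2 : 0 < G N T * G v T := mul_pos_of_neg_of_neg hNT hvT
  have h3 : G N T * G N T * G v v ≤ 0 := mul_nonpos_of_nonneg_of_nonpos (mul_self_nonneg _) hv
  have h4 : G v T * G v T * G N N < 0 := mul_neg_of_pos_of_neg (mul_pos_of_neg_of_neg hvT hvT) hN
  by_contra hle
  rw [not_lt] at hle
  nlinarith [mul_nonneg h2.le hle]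

theorem finrank_eq : Module.finrank ℝ V = 4 := by
  obtain ⟨b, -⟩ := hG.signature
  simp [Module.finrank_eq_card_basis b]

theorem eq_of_forall {v w : V} (h : ∀ x, G v x = G w x) : v = w := by
  obtain ⟨b, hb⟩ := hG.exists_coordinates
  refine b.repr.injective (Finsupp.ext fun i => ?_)
  have := h (b i)
  rw [hb, hb] at this
  fin_cases i <;> simpa [Finsupp.single_apply, Fin.ext_iff] using this

variable {D : W →L[ℝ] V} (hD : IsSpacelikeMap G D) (hW : Module.finrank ℝ W = 3)
include hD

omit hG in
theorem eq_of_forall_induced {u u' : W} (h : ∀ w, G (D u) (D w) = G (D u') (D w)) : u = u' := by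
  by_contra hne
  have := hD _ (sub_ne_zero.2 hne)
  simp [map_sub, h] at this

include hW

omit hG in
/-- Representation of linear forms by the induced metric. -/
theorem exists_induced_eq (l : W →ₗ[ℝ] ℝ) : ∃ u, ∀ w, G (D u) (D w) = l w := by
  have : FiniteDimensional ℝ W := Module.finite_of_finrank_pos (by omega)
  let B : W →ₗ[ℝ] (W →ₗ[ℝ] ℝ) := LinearMap.mk₂ ℝ (fun u w => G (D u) (D w))
    (by simp) (by simp) (by simp) (by simp)
  have hB : Function.Injective B := fun u u' h =>
    eq_of_forall_induced hD fun w => DFunLike.congr_fun h w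
  have hs : Function.Surjective B :=
    (LinearMap.injective_iff_surjective_of_finrank_eq_finrank
      (Subspace.dual_finrank_eq (K := ℝ) (V := W)).symm).1 hB
  obtain ⟨u, hu⟩ := hs l
  exact ⟨u, fun w => DFunLike.congr_fun hu w⟩

/-- Existence of the unit future normal of a spacelike hyperplane. -/
theorem exists_normal {T : V} (hT : G T T < 0) :
    ∃ N, G N N = -1 ∧ G N T < 0 ∧ ∀ u, G N (D u) = 0 := by
  -- `D u` is the tangential part of `T`. Removing it leaves a normal vector that is still timelike,
  -- because the square of the removed part is nonnegative; it remains to normalise.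
  obtain ⟨u, hu⟩ := exists_induced_eq hD hW ((G T).toLinearMap ∘ₗ D.toLinearMap)
  have hu' : ∀ w, G (T - D u) (D w) = 0 := fun w => by simpa [sub_eq_zero] using (hu w).symm
  have h1 : G (T - D u) (T - D u) = G (T - D u) T := by
    rw [map_sub (G (T - D u)), hu', sub_zero]
  have h2 : G (T - D u) (T - D u) < 0 := by
    have h3 : 0 ≤ G (D u) (D u) := by
      by_cases h : u = 0
      · simp [h]
      · exact (hD u h).le
    have h4 : G (T - D u) T = G T T - G (D u) (D u) := by
      have h5 := hu u
      simp only [LinearMap.comp_apply, ContinuousLinearMap.coe_coe] at h5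
      simp [hG.symm (D u) T, h5]
    rw [h1, h4]
    linarith
  set X := T - D u
  have hs : 0 < Real.sqrt (-G X X) := Real.sqrt_pos.2 (by linarith)
  have hsq : Real.sqrt (-G X X) ^ 2 = -G X X := Real.sq_sqrt (by linarith)
  refine ⟨(Real.sqrt (-G X X))⁻¹ • X, ?_, ?_, fun w => by simp [hu' w]⟩
  · simp only [map_smul, _root_.smul_apply, smul_eq_mul]
    field_simp
    linarith
  · simp only [map_smul, _root_.smul_apply, smul_eq_mul]
    exact mul_neg_of_pos_of_neg (inv_pos.2 hs) (h1 ▸ h2)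

/-- The hyperplane and its normal are independent, and their dimensions `3` and `1` add up to `4`.
-/
theorem exists_decomposition {N : V} (hN : G N N = -1) (hND : ∀ u, G N (D u) = 0) (X : V) :
    ∃ (u : W) (s : ℝ), X = D u + s • N := by
  have : FiniteDimensional ℝ W := Module.finite_of_finrank_pos (by omega)
  have : FiniteDimensional ℝ V := Module.finite_of_finrank_pos (by rw [hG.finrank_eq]; omega)
  let B : (W × ℝ) →ₗ[ℝ] V := D.toLinearMap.coprod (LinearMap.toSpanSingleton ℝ V N)
  have hB : Function.Injective B := by
    rw [injective_iff_map_eq_zero]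
    rintro ⟨u, s⟩ h
    have h' : D u + s • N = 0 := h
    have hs : s = 0 := by
      have := congrArg (G N) h'
      simpa [hND, hN] using this
    have hu : u = 0 := by
      by_contra hne
      have h1 : D u = 0 := by simpa [hs] using h'
      have := hD u hne
      simp [h1] at this
    simp [hs, hu]
  have hs : Function.Surjective B :=
    (LinearMap.injective_iff_surjective_of_finrank_eq_finrank (by
      rw [Module.finrank_prod, hW, hG.finrank_eq, Module.finrank_self])).1 hB
  obtain ⟨⟨u, s⟩, h⟩ := hs X
  exact ⟨u, s, h.symm⟩

/-- Future null vectors in terms of their tangential and normal parts. -/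
theorem exists_null_decomposition {T N X : V} (hT : G T T < 0) (hN : G N N = -1) (hNT : G N T < 0)
    (hND : ∀ u, G N (D u) = 0) (hX : G X X = 0) (hXT : G X T < 0) :
    ∃ (u : W) (s : ℝ), X = D u + s • N ∧ 0 < s ∧ G (D u) (D u) = s ^ 2 := by
  obtain ⟨u, s, rfl⟩ := hG.exists_decomposition hD hW hN hND X
  refine ⟨u, s, rfl, ?_, ?_⟩
  · have := hG.neg_of_same_cone hT (by linarith) hNT hX.le hXT
    simp only [map_add, map_smul, _root_.add_apply, _root_.smul_apply, smul_eq_mul,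
      hG.symm (D u) N, hND, hN] at this
    linarith
  · simp only [map_add, map_smul, _root_.add_apply, _root_.smul_apply, smul_eq_mul,
      hG.symm (D u) N, hND, hN] at hX
    linarith

omit hW hD in
theorem null_of_decomposition {T N : V} (hT : G T T < 0) (hN : G N N = -1) (hNT : G N T < 0)
    (hND : ∀ u, G N (D u) = 0) {u : W} {s : ℝ} (hs : 0 < s) (hu : G (D u) (D u) = s ^ 2) :
    G (D u + s • N) (D u + s • N) = 0 ∧ G (D u + s • N) T < 0 := by
  have h0 : G (D u + s • N) (D u + s • N) = 0 := by
    simp only [map_add, map_smul, _root_.add_apply, _root_.smul_apply, smul_eq_mul,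
      hG.symm (D u) N, hND, hN, hu]
    ring
  refine ⟨h0, hG.neg_of_same_cone (T := N) (by linarith) hT (by rwa [hG.symm]) h0.le ?_⟩
  simp only [map_add, map_smul, _root_.add_apply, _root_.smul_apply, smul_eq_mul,
    hG.symm (D u) N, hND, hN]
  linarith

/-- A future null vector is determined by its restriction to a spacelike hyperplane. -/
theorem eq_of_null_of_restrict_eq {T X Y : V} (hT : G T T < 0) (hX : G X X = 0) (hXT : G X T < 0)
    (hY : G Y Y = 0) (hYT : G Y T < 0) (h : ∀ u, G X (D u) = G Y (D u)) : X = Y := by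
  obtain ⟨N, hN, hNT, hND⟩ := hG.exists_normal hD hW hT
  obtain ⟨u, s, rfl, hs, hu⟩ := hG.exists_null_decomposition hD hW hT hN hNT hND hX hXT
  obtain ⟨u', s', rfl, hs', hu'⟩ := hG.exists_null_decomposition hD hW hT hN hNT hND hY hYT
  have : u = u' := eq_of_forall_induced hD fun w => by simpa [hND] using h w
  subst this
  have : s = s' := by
    rw [hu] at hu'
    exact (sq_eq_sq₀ hs.le hs'.le).1 hu'
  rw [this]

end IsLorentzForm

end LorentzAlgebra

/-! ### Canonical charts of the cotangent bundle and invariance of the symplectic form. -/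

section CotangentCharts

variable {n : ℕ} {X : Type*} [TopologicalSpace X] [ChartedSpace (EuclideanSpace ℝ (Fin n)) X]
  [IsManifold (𝓡 n) ∞ X]

/-- The derivative at `x` of the preferred chart at `x₀`. -/
noncomputable def chartDeriv (x₀ x : X) : TangentSpace (𝓡 n) x →L[ℝ] EuclideanSpace ℝ (Fin n) :=
  (trivializationAt (EuclideanSpace ℝ (Fin n)) (TangentSpace (𝓡 n)) x₀).continuousLinearMapAt ℝ x

/-- The inverse of `chartDeriv`. -/
noncomputable def chartDerivSymm (x₀ x : X) :
    EuclideanSpace ℝ (Fin n) →L[ℝ] TangentSpace (𝓡 n) x :=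
  (trivializationAt (EuclideanSpace ℝ (Fin n)) (TangentSpace (𝓡 n)) x₀).symmL ℝ x

theorem chartDerivSymm_chartDeriv {x₀ x : X} (hx : x ∈ (extChartAt (𝓡 n) x₀).source)
    (v : TangentSpace (𝓡 n) x) : chartDerivSymm x₀ x (chartDeriv x₀ x v) = v :=
  Trivialization.symmL_continuousLinearMapAt _ (by simpa using hx) v

theorem chartDeriv_chartDerivSymm {x₀ x : X} (hx : x ∈ (extChartAt (𝓡 n) x₀).source)
    (v : EuclideanSpace ℝ (Fin n)) : chartDeriv x₀ x (chartDerivSymm x₀ x v) = v :=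
  Trivialization.continuousLinearMapAt_symmL _ (by simpa using hx) v

theorem chartDeriv_eq {x₀ x : X} (hx : x ∈ (extChartAt (𝓡 n) x₀).source)
    (v : EuclideanSpace ℝ (Fin n)) :
    chartDeriv x₀ x (show TangentSpace (𝓡 n) x from v) = tangentCoordChange (𝓡 n) x x₀ x v := by
  have := TangentBundle.continuousLinearMapAt_trivializationAt_eq_core (I := 𝓡 n) (b₀ := x₀) (b := x)
    (by simpa using hx)
  exact DFunLike.congr_fun this v

theorem chartDerivSymm_eq {x₀ x : X} (hx : x ∈ (extChartAt (𝓡 n) x₀).source)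
    (v : EuclideanSpace ℝ (Fin n)) :
    chartDerivSymm x₀ x v =
      (show TangentSpace (𝓡 n) x from tangentCoordChange (𝓡 n) x₀ x x v) := by
  have := TangentBundle.symmL_trivializationAt_eq_core (I := 𝓡 n) (b₀ := x₀) (b := x)
    (by simpa using hx)
  exact DFunLike.congr_fun this v

theorem chartDeriv_chartDerivSymm_eq {x₀ x₁ x : X} (h₀ : x ∈ (extChartAt (𝓡 n) x₀).source)
    (h₁ : x ∈ (extChartAt (𝓡 n) x₁).source) (a : EuclideanSpace ℝ (Fin n)) :
    chartDeriv x₁ x (chartDerivSymm x₀ x a) = tangentCoordChange (𝓡 n) x₀ x₁ x a := by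
  rw [chartDerivSymm_eq h₀]
  refine (chartDeriv_eq h₁ _).trans ?_
  exact tangentCoordChange_comp ⟨⟨h₀, mem_extChartAt_source x⟩, h₁⟩

/-- The covector with coordinates `ζ` in the preferred chart at `x₀`. -/
noncomputable def covectorOfCoords (x₀ : X)
    (ζ : EuclideanSpace ℝ (Fin n) × (EuclideanSpace ℝ (Fin n) →L[ℝ] ℝ)) : CotangentBundle n X :=
  ⟨(extChartAt (𝓡 n) x₀).symm ζ.1, ζ.2.comp (chartDeriv x₀ ((extChartAt (𝓡 n) x₀).symm ζ.1))⟩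

theorem cotangent_source (z₀ : CotangentBundle n X) :
    (extChartAt (cotangentModel n) z₀).source = {z | z.proj ∈ (extChartAt (𝓡 n) z₀.proj).source} := by
  rw [FiberBundle.extChartAt]
  ext z
  simp only [PartialEquiv.trans_source, hom_trivializationAt_source, PartialEquiv.prod_source,
    PartialEquiv.refl_source, mem_inter_iff, mem_preimage, mem_prod, mem_univ, and_true]
  constructor
  · intro h
    simpa using h.1
  · intro h
    refine ⟨by simpa using h, ?_⟩
    exact h

theorem mem_cotangent_source {z₀ z : CotangentBundle n X} :
    z ∈ (extChartAt (cotangentModel n) z₀).source ↔ z.proj ∈ (extChartAt (𝓡 n) z₀.proj).source := by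
  rw [cotangent_source]; rfl

theorem cotangent_target (z₀ : CotangentBundle n X) :
    (extChartAt (cotangentModel n) z₀).target = (extChartAt (𝓡 n) z₀.proj).target ×ˢ univ := by
  rw [FiberBundle.extChartAt_target]
  congr 1
  refine inter_eq_left.2 fun y hy => ?_
  have := (extChartAt (𝓡 n) z₀.proj).map_target hy
  simpa using this

theorem cotangent_extChartAt (z₀ z : CotangentBundle n X) :
    extChartAt (cotangentModel n) z₀ z =
      (extChartAt (𝓡 n) z₀.proj z.proj, z.2.comp (chartDerivSymm z₀.proj z.proj)) :=
  cotangent_chart_apply z₀ z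

theorem cotangent_extChartAt_symm (z₀ : CotangentBundle n X)
    {ζ : EuclideanSpace ℝ (Fin n) × (EuclideanSpace ℝ (Fin n) →L[ℝ] ℝ)}
    (hζ : ζ.1 ∈ (extChartAt (𝓡 n) z₀.proj).target) :
    (extChartAt (cotangentModel n) z₀).symm ζ = covectorOfCoords z₀.proj ζ := by
  have hx := (extChartAt (𝓡 n) z₀.proj).map_target hζ
  have h1 : covectorOfCoords z₀.proj ζ ∈ (extChartAt (cotangentModel n) z₀).source :=
    mem_cotangent_source.2 hx
  have h2 : extChartAt (cotangentModel n) z₀ (covectorOfCoords z₀.proj ζ) = ζ := by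
    rw [cotangent_extChartAt]
    refine Prod.ext ((extChartAt (𝓡 n) z₀.proj).right_inv hζ) ?_
    ext a
    exact congrArg ζ.2 (chartDeriv_chartDerivSymm hx a)
  rw [← (extChartAt (cotangentModel n) z₀).left_inv h1, h2]

/-- The canonical symplectic form of the model space. -/
def modelSymplectic {E : Type*} [NormedAddCommGroup E] [NormedSpace ℝ E]
    (V W : E × (E →L[ℝ] ℝ)) : ℝ := V.2 W.1 - W.2 V.1

/-- Nondegeneracy: pure covectors as test vectors separate the base components, pure base vectors
separate the covector components. -/
theorem eq_of_modelSymplectic_eq {E : Type*} [NormedAddCommGroup E] [NormedSpace ℝ E]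
    {V V' : E × (E →L[ℝ] ℝ)} (h : ∀ W, modelSymplectic V W = modelSymplectic V' W) : V = V' := by
  simp only [modelSymplectic] at h
  refine Prod.ext ?_ ?_
  · by_contra hne
    obtain ⟨f, hf⟩ := SeparatingDual.exists_ne_zero (R := ℝ) (sub_ne_zero.2 hne)
    have := h (0, f)
    simp [sub_eq_zero] at this hf
    exact hf this
  · ext a
    simpa using h (a, 0)

/-- Changes of canonical charts of the cotangent bundle are symplectic. -/
theorem modelSymplectic_tangentCoordChange {z₀ z : CotangentBundle n X}
    (hz : z ∈ (extChartAt (cotangentModel n) z₀).source)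
    (V W : EuclideanSpace ℝ (Fin n) × (EuclideanSpace ℝ (Fin n) →L[ℝ] ℝ)) :
    modelSymplectic (tangentCoordChange (cotangentModel n) z z₀ z V)
      (tangentCoordChange (cotangentModel n) z z₀ z W) = modelSymplectic V W := by
  let E := EuclideanSpace ℝ (Fin n)
  let D : (E × (E →L[ℝ] ℝ)) →L[ℝ] (E × (E →L[ℝ] ℝ)) :=
    tangentCoordChange (cotangentModel n) z z₀ z
  let F : E × (E →L[ℝ] ℝ) → E × (E →L[ℝ] ℝ) :=
    extChartAt (cotangentModel n) z₀ ∘ (extChartAt (cotangentModel n) z).symm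
  let ζ : E × (E →L[ℝ] ℝ) := extChartAt (cotangentModel n) z z
  let θ : E → E := extChartAt (𝓡 n) z₀.proj ∘ (extChartAt (𝓡 n) z.proj).symm
  have hF : HasFDerivAt F D ζ := by
    have := hasFDerivWithinAt_tangentCoordChange (I := cotangentModel n) (x := z) (y := z₀) (z := z)
      ⟨mem_extChartAt_source z, hz⟩
    rwa [ModelWithCorners.range_eq_univ, hasFDerivWithinAt_univ] at this
  have hx := mem_cotangent_source.1 hz
  have hζ : ζ = (extChartAt (𝓡 n) z.proj z.proj, z.2.comp (chartDerivSymm z.proj z.proj)) :=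
    cotangent_extChartAt z z
  have htar : ∀ᶠ y in 𝓝 ζ.1, y ∈ (extChartAt (𝓡 n) z.proj).target ∧
      (extChartAt (𝓡 n) z.proj).symm y ∈ (extChartAt (𝓡 n) z₀.proj).source := by
    rw [hζ]
    refine Filter.Eventually.and (extChartAt_target_mem_nhds (I := 𝓡 n) z.proj) ?_
    refine (continuousAt_extChartAt_symm (I := 𝓡 n) z.proj).eventually ?_
    rw [extChartAt_to_inv]
    exact extChartAt_source_mem_nhds' hx
  have hθ : ∀ᶠ y in 𝓝 ζ.1, HasFDerivAt θ
      (tangentCoordChange (𝓡 n) z.proj z₀.proj ((extChartAt (𝓡 n) z.proj).symm y)) y := by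
    filter_upwards [htar] with y hy
    have := hasFDerivWithinAt_tangentCoordChange (I := 𝓡 n) (x := z.proj) (y := z₀.proj)
      ⟨(extChartAt (𝓡 n) z.proj).map_target hy.1, hy.2⟩
    rwa [ModelWithCorners.range_eq_univ, hasFDerivWithinAt_univ,
      (extChartAt (𝓡 n) z.proj).right_inv hy.1] at this
  have hθ2 : ContDiffAt ℝ ∞ θ ζ.1 := by
    have hy := htar.self_of_nhds
    have := contDiffWithinAt_ext_coord_change (I := 𝓡 n) (n := ∞) z₀.proj z.proj (y := ζ.1) hy
    rwa [ModelWithCorners.range_eq_univ, contDiffWithinAt_univ] at this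
  -- A change of canonical charts is the cotangent lift of the base change `θ`. The transformation
  -- of covectors is written without inverting the derivative of `θ`, so that it can be
  -- differentiated directly.
  have hFeq : ∀ᶠ p in 𝓝 ζ, (F p).1 = θ p.1 ∧ ∀ a, (F p).2 (fderiv ℝ θ p.1 a) = p.2 a := by
    have := continuousAt_fst (p := ζ)
    filter_upwards [this.eventually htar, this.eventually hθ] with p hp1 hp2
    have hF' : F p = extChartAt (cotangentModel n) z₀ (covectorOfCoords z.proj p) := by
      change extChartAt (cotangentModel n) z₀ ((extChartAt (cotangentModel n) z).symm p) = _
      rw [cotangent_extChartAt_symm z hp1.1]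
    rw [hF', cotangent_extChartAt]
    refine ⟨rfl, fun a => ?_⟩
    have hsrc := (extChartAt (𝓡 n) z.proj).map_target hp1.1
    rw [hp2.fderiv, ← chartDeriv_chartDerivSymm_eq hsrc hp1.2]
    change p.2 (chartDeriv z.proj _ (chartDerivSymm z₀.proj _ (chartDeriv z₀.proj _
      (chartDerivSymm z.proj _ a)))) = _
    rw [chartDerivSymm_chartDeriv hp1.2, chartDeriv_chartDerivSymm hsrc]
  have hθ' : HasFDerivAt θ (fderiv ℝ θ ζ.1) ζ.1 := (hθ2.differentiableAt (by simp)).hasFDerivAt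
  have hD1 : ∀ U, (D U).1 = fderiv ℝ θ ζ.1 U.1 := by
    have h1 : HasFDerivAt (fun p => (F p).1) ((ContinuousLinearMap.fst ℝ E (E →L[ℝ] ℝ)).comp D) ζ :=
      hF.fst
    have h2 : HasFDerivAt (fun p : E × (E →L[ℝ] ℝ) => θ p.1)
        ((fderiv ℝ θ ζ.1).comp (.fst ℝ E (E →L[ℝ] ℝ))) ζ := hθ'.comp ζ hasFDerivAt_fst
    have h3 := h1.unique (h2.congr_of_eventuallyEq (hFeq.mono fun p hp => hp.1))
    exact fun U => DFunLike.congr_fun h3 U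
  -- Differentiating the transformation rule produces a term in the second derivative of `θ`. In the
  -- antisymmetric pairing of `V` and `W` these terms cancel, since second derivatives are
  -- symmetric.
  have hD2 : ∀ U a, (D U).2 (fderiv ℝ θ ζ.1 a) + (F ζ).2 (fderiv ℝ (fderiv ℝ θ) ζ.1 U.1 a) =
      U.2 a := by
    intro U a
    have h0 : HasFDerivAt (fderiv ℝ θ) (fderiv ℝ (fderiv ℝ θ) ζ.1) ζ.1 :=
      ((hθ2.fderiv_right (m := 1) (by norm_cast)).differentiableAt (by simp)).hasFDerivAt
    have h1 : HasFDerivAt (fun p : E × (E →L[ℝ] ℝ) => fderiv ℝ θ p.1)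
        ((fderiv ℝ (fderiv ℝ θ) ζ.1).comp (.fst ℝ E (E →L[ℝ] ℝ))) ζ := h0.comp ζ hasFDerivAt_fst
    have h2 := hF.snd.clm_apply (h1.clm_apply (hasFDerivAt_const a ζ))
    have h3 : HasFDerivAt (fun p : E × (E →L[ℝ] ℝ) => p.2 a) _ ζ :=
      hasFDerivAt_snd.clm_apply (hasFDerivAt_const a ζ)
    have h4 := h2.unique (h3.congr_of_eventuallyEq (hFeq.mono fun p hp => hp.2 a))
    have h5 := DFunLike.congr_fun h4 U
    simp only [_root_.add_apply, ContinuousLinearMap.comp_apply, ContinuousLinearMap.flip_apply,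
      _root_.zero_apply, map_zero, zero_add, ContinuousLinearMap.coe_fst',
      ContinuousLinearMap.coe_snd'] at h5
    rw [add_comm]
    exact h5
  have hsymm := hθ2.isSymmSndFDerivAt
    (by rw [minSmoothness_of_isRCLikeNormedField]; exact mod_cast ENat.LEInfty.out) V.1 W.1
  change (D V).2 (D W).1 - (D W).2 (D V).1 = V.2 W.1 - W.2 V.1
  rw [hD1, hD1, ← hD2 V W.1, ← hD2 W V.1, hsymm]
  ring

end CotangentCharts

/-- The total space of a fiber bundle with Hausdorff base and fiber is Hausdorff. -/
theorem FiberBundle.t2Space_totalSpace {B F : Type*} [TopologicalSpace B] [TopologicalSpace F]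
    [T2Space B] [T2Space F] (E : B → Type*) [TopologicalSpace (TotalSpace F E)]
    [∀ b, TopologicalSpace (E b)] [FiberBundle F E] : T2Space (TotalSpace F E) := by
  refine ⟨fun z w hzw => ?_⟩
  by_cases h : z.proj = w.proj
  · let e := trivializationAt F E z.proj
    have hz : z ∈ e.source := mem_trivializationAt_proj_source
    have hw : w ∈ e.source := by
      rw [e.mem_source, ← h]
      exact mem_baseSet_trivializationAt F E z.proj
    have hne : e z ≠ e w := fun h' => hzw (e.injOn hz hw h')
    obtain ⟨U, V, hU, hV, hzU, hwV, hUV⟩ := t2_separation hne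
    refine ⟨e.source ∩ e ⁻¹' U, e.source ∩ e ⁻¹' V,
      e.continuousOn_toFun.isOpen_inter_preimage e.open_source hU,
      e.continuousOn_toFun.isOpen_inter_preimage e.open_source hV, ⟨hz, hzU⟩, ⟨hw, hwV⟩, ?_⟩
    exact (hUV.preimage e).mono inter_subset_right inter_subset_right
  · obtain ⟨U, V, hU, hV, hzU, hwV, hUV⟩ := t2_separation h
    exact ⟨TotalSpace.proj ⁻¹' U, TotalSpace.proj ⁻¹' V, hU.preimage (FiberBundle.continuous_proj F E),
      hV.preimage (FiberBundle.continuous_proj F E), hzU, hwV, hUV.preimage _⟩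

instance CotangentBundle.instT2Space {n : ℕ} {X : Type*} [TopologicalSpace X] [T2Space X]
    [ChartedSpace (EuclideanSpace ℝ (Fin n)) X] [IsManifold (𝓡 n) ∞ X] :
    T2Space (CotangentBundle n X) :=
  FiberBundle.t2Space_totalSpace _

/-! ### The metric, the Hamiltonian and the geodesic spray in coordinates. -/

namespace SpacetimeMetric

variable {M : Type*} [TopologicalSpace M] [ChartedSpace (EuclideanSpace ℝ (Fin 4)) M]
  [IsManifold (𝓡 4) ∞ M] (g : SpacetimeMetric M)

theorem isLorentzForm (x : M) : IsLorentzForm (g.val x) := ⟨g.symm x, g.signature x⟩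

/-- The metric in the preferred chart at `x₀`. -/
noncomputable def metricCoords (x₀ : M) (y : EuclideanSpace ℝ (Fin 4)) :
    EuclideanSpace ℝ (Fin 4) →L[ℝ] EuclideanSpace ℝ (Fin 4) →L[ℝ] ℝ :=
  ContinuousLinearMap.inCoordinates (EuclideanSpace ℝ (Fin 4)) (TangentSpace (𝓡 4))
    (EuclideanSpace ℝ (Fin 4) →L[ℝ] ℝ) (fun x : M => TangentSpace (𝓡 4) x →L[ℝ] ℝ)
    x₀ ((extChartAt (𝓡 4) x₀).symm y) x₀ ((extChartAt (𝓡 4) x₀).symm y)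
    (g.val ((extChartAt (𝓡 4) x₀).symm y))

theorem metricCoords_apply {x₀ : M} {y : EuclideanSpace ℝ (Fin 4)}
    (hy : y ∈ (extChartAt (𝓡 4) x₀).target) (a b : EuclideanSpace ℝ (Fin 4)) :
    g.metricCoords x₀ y a b = g.val ((extChartAt (𝓡 4) x₀).symm y)
      (chartDerivSymm x₀ ((extChartAt (𝓡 4) x₀).symm y) a)
      (chartDerivSymm x₀ ((extChartAt (𝓡 4) x₀).symm y) b) := by
  have hx : (extChartAt (𝓡 4) x₀).symm y ∈ (chartAt (EuclideanSpace ℝ (Fin 4)) x₀).source := by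
    simpa using (extChartAt (𝓡 4) x₀).map_target hy
  rw [metricCoords, inCoordinates_apply_eq₂ (E₃ := fun _ : M => ℝ) (F₃ := ℝ) (by simpa using hx)
    (by simpa using hx) (mem_univ _)]
  have hb : (extChartAt (𝓡 4) x₀).symm y ∈
      (trivializationAt (EuclideanSpace ℝ (Fin 4)) (TangentSpace (𝓡 4) : M → Type) x₀).baseSet := hx
  rw [chartDerivSymm, Trivialization.symmL_apply _ hb, Trivialization.symmL_apply _ hb]
  simp

set_option synthInstance.maxHeartbeats 200000 in
theorem contDiffAt_metricCoords (x₀ : M) {y : EuclideanSpace ℝ (Fin 4)}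
    (hy : y ∈ (extChartAt (𝓡 4) x₀).target) : ContDiffAt ℝ ∞ (g.metricCoords x₀) y := by
  have hx := (extChartAt (𝓡 4) x₀).map_target hy
  have hxe : (extChartAt (𝓡 4) x₀).symm y ∈ (trivializationAt
      (EuclideanSpace ℝ (Fin 4) →L[ℝ] EuclideanSpace ℝ (Fin 4) →L[ℝ] ℝ)
      (fun x : M => TangentSpace (𝓡 4) x →L[ℝ] TangentSpace (𝓡 4) x →L[ℝ] ℝ) x₀).baseSet := by
    rw [hom_trivializationAt_baseSet, hom_trivializationAt_baseSet]
    rw [extChartAt_source] at hx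
    exact ⟨hx, hx, mem_univ _⟩
  have h1 := (Trivialization.contMDiffAt_section_iff
    (F := EuclideanSpace ℝ (Fin 4) →L[ℝ] EuclideanSpace ℝ (Fin 4) →L[ℝ] ℝ)
    (E := fun x : M => TangentSpace (𝓡 4) x →L[ℝ] TangentSpace (𝓡 4) x →L[ℝ] ℝ)
    (n := ∞) (IB := 𝓡 4) (trivializationAt
      (EuclideanSpace ℝ (Fin 4) →L[ℝ] EuclideanSpace ℝ (Fin 4) →L[ℝ] ℝ)
      (fun x : M => TangentSpace (𝓡 4) x →L[ℝ] TangentSpace (𝓡 4) x →L[ℝ] ℝ) x₀) hxe).1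
    (g.contMDiff.contMDiffAt)
  exact (h1.comp y ((contMDiffOn_extChartAt_symm x₀).contMDiffAt
    ((isOpen_extChartAt_target x₀).mem_nhds hy))).contDiffAt

/-- The vector field defining the time orientation in the preferred chart at `x₀`. -/
noncomputable def futureCoords (x₀ : M) (y : EuclideanSpace ℝ (Fin 4)) : EuclideanSpace ℝ (Fin 4) :=
  chartDeriv x₀ ((extChartAt (𝓡 4) x₀).symm y) (g.future ((extChartAt (𝓡 4) x₀).symm y))

theorem contDiffAt_futureCoords (x₀ : M) {y : EuclideanSpace ℝ (Fin 4)}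
    (hy : y ∈ (extChartAt (𝓡 4) x₀).target) : ContDiffAt ℝ ∞ (g.futureCoords x₀) y := by
  have hxe : ∀ {y}, y ∈ (extChartAt (𝓡 4) x₀).target → (extChartAt (𝓡 4) x₀).symm y ∈
      (trivializationAt (EuclideanSpace ℝ (Fin 4)) (TangentSpace (𝓡 4) : M → Type) x₀).baseSet := by
    intro y hy
    have hx := (extChartAt (𝓡 4) x₀).map_target hy
    rwa [extChartAt_source] at hx
  have h1 := (Trivialization.contMDiffAt_section_iff (n := ∞) (IB := 𝓡 4) _ (hxe hy)).1
    (g.future_contMDiff.contMDiffAt)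
  refine (h1.comp y ((contMDiffOn_extChartAt_symm x₀).contMDiffAt
    ((isOpen_extChartAt_target x₀).mem_nhds hy))).contDiffAt.congr_of_eventuallyEq ?_
  filter_upwards [(isOpen_extChartAt_target x₀).mem_nhds hy] with y' hy'
  exact Trivialization.continuousLinearMapAt_apply_of_mem (R := ℝ) _ (hxe hy') _

theorem isLorentzForm_metricCoords {x₀ : M} {y : EuclideanSpace ℝ (Fin 4)}
    (hy : y ∈ (extChartAt (𝓡 4) x₀).target) : IsLorentzForm (g.metricCoords x₀ y) := by
  have hx := (extChartAt (𝓡 4) x₀).map_target hy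
  obtain ⟨b, hb⟩ := g.signature ((extChartAt (𝓡 4) x₀).symm y)
  refine ⟨fun v w => by simp only [metricCoords_apply g hy, g.symm], ?_⟩
  let e : TangentSpace (𝓡 4) ((extChartAt (𝓡 4) x₀).symm y) ≃ₗ[ℝ] EuclideanSpace ℝ (Fin 4) :=
    { (chartDeriv x₀ ((extChartAt (𝓡 4) x₀).symm y)).toLinearMap with
      invFun := chartDerivSymm x₀ ((extChartAt (𝓡 4) x₀).symm y)
      left_inv := chartDerivSymm_chartDeriv hx
      right_inv := chartDeriv_chartDerivSymm hx }
  refine ⟨b.map e, fun i j => ?_⟩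
  rw [metricCoords_apply g hy, ← hb]
  have he : ∀ i, chartDerivSymm x₀ ((extChartAt (𝓡 4) x₀).symm y) (b.map e i) = b i := fun i => by
    rw [Module.Basis.map_apply]
    exact chartDerivSymm_chartDeriv hx _
  rw [he, he]

end SpacetimeMetric

theorem IsLorentzForm.isInvertible {V : Type*} [NormedAddCommGroup V] [NormedSpace ℝ V]
    {G : V →L[ℝ] V →L[ℝ] ℝ} (hG : IsLorentzForm G) : G.IsInvertible := by
  have : FiniteDimensional ℝ V := Module.finite_of_finrank_pos (by rw [hG.finrank_eq]; omega)
  have hrank : Module.finrank ℝ V = Module.finrank ℝ (V →L[ℝ] ℝ) := by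
    rw [← (LinearMap.toContinuousLinearMap (𝕜 := ℝ) (E := V) (F' := ℝ)).finrank_eq]
    exact (Subspace.dual_finrank_eq).symm
  have hinj : Function.Injective G.toLinearMap := fun v w h =>
    hG.eq_of_forall fun x => DFunLike.congr_fun (show G v = G w from h) x
  exact ⟨(LinearEquiv.ofInjectiveOfFinrankEq _ hinj hrank).toContinuousLinearEquiv,
    by ext1 v; rfl⟩

namespace SpacetimeMetric

variable {M : Type*} [TopologicalSpace M] [ChartedSpace (EuclideanSpace ℝ (Fin 4)) M]
  [IsManifold (𝓡 4) ∞ M] (g : SpacetimeMetric M)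

/-- The inverse metric in the preferred chart at `x₀`. -/
noncomputable def cometricCoords (x₀ : M) (y : EuclideanSpace ℝ (Fin 4)) :
    (EuclideanSpace ℝ (Fin 4) →L[ℝ] ℝ) →L[ℝ] EuclideanSpace ℝ (Fin 4) :=
  (g.metricCoords x₀ y).inverse

section

variable {g} {x₀ : M} {y : EuclideanSpace ℝ (Fin 4)} (hy : y ∈ (extChartAt (𝓡 4) x₀).target)
include hy

theorem metricCoords_cometricCoords (q : EuclideanSpace ℝ (Fin 4) →L[ℝ] ℝ) :
    g.metricCoords x₀ y (g.cometricCoords x₀ y q) = q :=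
  (g.isLorentzForm_metricCoords hy).isInvertible.self_apply_inverse q

theorem cometricCoords_metricCoords (a : EuclideanSpace ℝ (Fin 4)) :
    g.cometricCoords x₀ y (g.metricCoords x₀ y a) = a :=
  (g.isLorentzForm_metricCoords hy).isInvertible.inverse_apply_self a

theorem cometricCoords_symm (q q' : EuclideanSpace ℝ (Fin 4) →L[ℝ] ℝ) :
    q (g.cometricCoords x₀ y q') = q' (g.cometricCoords x₀ y q) := by
  conv_lhs => rw [← metricCoords_cometricCoords (g := g) hy q]
  rw [(g.isLorentzForm_metricCoords hy).symm, metricCoords_cometricCoords hy]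

theorem contDiffAt_cometricCoords : ContDiffAt ℝ ∞ (g.cometricCoords x₀) y :=
  ((g.isLorentzForm_metricCoords hy).isInvertible.contDiffAt_map_inverse).comp y
    (g.contDiffAt_metricCoords x₀ hy)

end

theorem sharp_eq {x₀ x : M} (hx : x ∈ (extChartAt (𝓡 4) x₀).source) (p : CotangentSpace 4 x) :
    g.sharp x p = chartDerivSymm x₀ x
      (g.cometricCoords x₀ (extChartAt (𝓡 4) x₀ x) (p.comp (chartDerivSymm x₀ x))) := by
  refine (g.isLorentzForm x).eq_of_forall fun v => ?_
  have hy := (extChartAt (𝓡 4) x₀).map_source hx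
  have h1 := DFunLike.congr_fun (metricCoords_cometricCoords (g := g) hy
    (p.comp (chartDerivSymm x₀ x))) (chartDeriv x₀ x v)
  have hx' := (extChartAt (𝓡 4) x₀).left_inv hx
  rw [metricCoords_apply g hy] at h1
  rw [flat_sharp]
  have h2 : (p.comp (chartDerivSymm x₀ x)) (chartDeriv x₀ x v) = p v :=
    congrArg p (chartDerivSymm_chartDeriv hx v)
  rw [h2] at h1
  rw [← h1]
  -- The base point occurs in the types, so the equality of points is used after generalising over
  -- `x'` instead of rewriting.
  have key : ∀ x', x' = x → ∀ a, g.val x' (chartDerivSymm x₀ x' a) (chartDerivSymm x₀ x'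
      (chartDeriv x₀ x v)) = g.val x (chartDerivSymm x₀ x a) v := by
    rintro _ rfl a
    rw [chartDerivSymm_chartDeriv hx]
  exact key _ hx' _

/-- The Hamiltonian in the canonical coordinates given by the preferred chart at `x₀`. -/
noncomputable def hamiltonianCoords (x₀ : M)
    (ζ : EuclideanSpace ℝ (Fin 4) × (EuclideanSpace ℝ (Fin 4) →L[ℝ] ℝ)) : ℝ :=
  (1 / 2) * ζ.2 (g.cometricCoords x₀ ζ.1 ζ.2)

theorem hamiltonian_eq {z₀ z : CotangentBundle 4 M}
    (hz : z ∈ (extChartAt (cotangentModel 4) z₀).source) :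
    g.hamiltonian z = g.hamiltonianCoords z₀.proj (extChartAt (cotangentModel 4) z₀ z) := by
  rw [hamiltonian, sharp_eq g (mem_cotangent_source.1 hz), cotangent_extChartAt]
  rfl

theorem contDiffAt_hamiltonianCoords (x₀ : M)
    {ζ : EuclideanSpace ℝ (Fin 4) × (EuclideanSpace ℝ (Fin 4) →L[ℝ] ℝ)}
    (hζ : ζ.1 ∈ (extChartAt (𝓡 4) x₀).target) : ContDiffAt ℝ ∞ (g.hamiltonianCoords x₀) ζ := by
  have h1 : ContDiffAt ℝ ∞ (fun ζ : EuclideanSpace ℝ (Fin 4) × (EuclideanSpace ℝ (Fin 4) →L[ℝ] ℝ) =>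
      g.cometricCoords x₀ ζ.1) ζ := (contDiffAt_cometricCoords hζ).comp ζ contDiffAt_fst
  exact contDiffAt_const.mul (contDiffAt_snd.clm_apply (h1.clm_apply contDiffAt_snd))

/-- The geodesic spray in the canonical coordinates given by the preferred chart at `x₀`. -/
noncomputable def sprayCoords (x₀ : M)
    (ζ : EuclideanSpace ℝ (Fin 4) × (EuclideanSpace ℝ (Fin 4) →L[ℝ] ℝ)) :
    EuclideanSpace ℝ (Fin 4) × (EuclideanSpace ℝ (Fin 4) →L[ℝ] ℝ) :=
  (g.cometricCoords x₀ ζ.1 ζ.2,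
    -(fderiv ℝ (g.hamiltonianCoords x₀) ζ).comp (ContinuousLinearMap.inl ℝ _ _))

theorem contDiffAt_sprayCoords (x₀ : M)
    {ζ : EuclideanSpace ℝ (Fin 4) × (EuclideanSpace ℝ (Fin 4) →L[ℝ] ℝ)}
    (hζ : ζ.1 ∈ (extChartAt (𝓡 4) x₀).target) : ContDiffAt ℝ ∞ (g.sprayCoords x₀) ζ := by
  have h1 : ContDiffAt ℝ ∞ (fun ζ : EuclideanSpace ℝ (Fin 4) × (EuclideanSpace ℝ (Fin 4) →L[ℝ] ℝ) =>
      g.cometricCoords x₀ ζ.1) ζ := (contDiffAt_cometricCoords hζ).comp ζ contDiffAt_fst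
  have h2 := (contDiffAt_hamiltonianCoords g x₀ hζ).fderiv_right (m := ∞) (by simp)
  exact (h1.clm_apply contDiffAt_snd).prodMk (h2.clm_comp contDiffAt_const).neg

/-- The Hamiltonian is quadratic in the covector, so its restriction to a vertical line is an
explicit polynomial in `t`; symmetry of the inverse metric gives the linear coefficient. -/
theorem fderiv_hamiltonianCoords_snd (x₀ : M)
    {ζ : EuclideanSpace ℝ (Fin 4) × (EuclideanSpace ℝ (Fin 4) →L[ℝ] ℝ)}
    (hζ : ζ.1 ∈ (extChartAt (𝓡 4) x₀).target) (l : EuclideanSpace ℝ (Fin 4) →L[ℝ] ℝ) :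
    fderiv ℝ (g.hamiltonianCoords x₀) ζ (0, l) = l (g.cometricCoords x₀ ζ.1 ζ.2) := by
  have h1 := ((contDiffAt_hamiltonianCoords g x₀ hζ).differentiableAt (by simp)).hasFDerivAt
  have h2 : HasDerivAt (fun t : ℝ => ζ + t • ((0, l) : EuclideanSpace ℝ (Fin 4) × _)) (0, l) 0 := by
    simpa using ((hasDerivAt_id (0 : ℝ)).smul_const
      ((0, l) : EuclideanSpace ℝ (Fin 4) × (EuclideanSpace ℝ (Fin 4) →L[ℝ] ℝ))).const_add ζ
  have h3 := h1.comp_hasDerivAt_of_eq (0 : ℝ) h2 (by simp)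
  have h4 : HasDerivAt (fun t : ℝ => g.hamiltonianCoords x₀ ζ + t * l (g.cometricCoords x₀ ζ.1 ζ.2) +
      t ^ 2 * (1 / 2 * l (g.cometricCoords x₀ ζ.1 l))) (l (g.cometricCoords x₀ ζ.1 ζ.2)) 0 := by
    have := (((hasDerivAt_id (0 : ℝ)).mul_const (l (g.cometricCoords x₀ ζ.1 ζ.2))).const_add
      (g.hamiltonianCoords x₀ ζ)).add
      (((hasDerivAt_id (0 : ℝ)).pow 2).mul_const (1 / 2 * l (g.cometricCoords x₀ ζ.1 l)))
    exact this.congr_deriv (by simp)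
  refine h3.unique (h4.congr_of_eventuallyEq (Eventually.of_forall fun t => ?_))
  simp only [Function.comp, hamiltonianCoords, Prod.fst_add, Prod.snd_add, Prod.smul_fst,
    Prod.smul_snd, smul_zero, add_zero, map_add, map_smul, _root_.add_apply, _root_.smul_apply,
    smul_eq_mul, cometricCoords_symm hζ ζ.2 l]
  ring

/-- Hamilton's equations: the horizontal part of the derivative is the second component of the spray
by definition, and the vertical part is `fderiv_hamiltonianCoords_snd`. -/
theorem modelSymplectic_sprayCoords (x₀ : M)
    {ζ : EuclideanSpace ℝ (Fin 4) × (EuclideanSpace ℝ (Fin 4) →L[ℝ] ℝ)}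
    (hζ : ζ.1 ∈ (extChartAt (𝓡 4) x₀).target)
    (W : EuclideanSpace ℝ (Fin 4) × (EuclideanSpace ℝ (Fin 4) →L[ℝ] ℝ)) :
    modelSymplectic (g.sprayCoords x₀ ζ) W = -fderiv ℝ (g.hamiltonianCoords x₀) ζ W := by
  have : W = (W.1, 0) + (0, W.2) := by simp
  conv_rhs => rw [this, map_add, fderiv_hamiltonianCoords_snd g x₀ hζ]
  simp only [modelSymplectic, sprayCoords, _root_.neg_apply, ContinuousLinearMap.comp_apply,
    ContinuousLinearMap.inl_apply]
  ring

/-- The geodesic spray. -/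
noncomputable def spray (z : CotangentBundle 4 M) : TangentSpace (cotangentModel 4) z :=
  g.sprayCoords z.proj (extChartAt (cotangentModel 4) z z)

theorem contMDiffAt_hamiltonian (z : CotangentBundle 4 M) :
    ContMDiffAt (cotangentModel 4) 𝓘(ℝ, ℝ) ∞ g.hamiltonian z := by
  have h0 := mem_extChartAt_target (I := cotangentModel 4) z
  rw [cotangent_target] at h0
  have h1 := (contDiffAt_hamiltonianCoords g z.proj h0.1).contMDiffAt.comp z
    (contMDiffAt_extChartAt (I := cotangentModel 4) (n := ∞) (x := z))
  refine h1.congr_of_eventuallyEq ?_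
  filter_upwards [extChartAt_source_mem_nhds (I := cotangentModel 4) z] with z' hz'
  exact hamiltonian_eq g hz'

theorem mfderiv_hamiltonian (z : CotangentBundle 4 M)
    (W : EuclideanSpace ℝ (Fin 4) × (EuclideanSpace ℝ (Fin 4) →L[ℝ] ℝ)) :
    (show ℝ from mfderiv (cotangentModel 4) 𝓘(ℝ, ℝ) g.hamiltonian z W) =
      fderiv ℝ (g.hamiltonianCoords z.proj) (extChartAt (cotangentModel 4) z z) W := by
  have h1 := ((contMDiffAt_hamiltonian g z).mdifferentiableAt (by simp)).mfderiv
  have h2 : fderivWithin ℝ (writtenInExtChartAt (cotangentModel 4) 𝓘(ℝ, ℝ) z g.hamiltonian)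
      (range (cotangentModel 4)) (extChartAt (cotangentModel 4) z z) =
      fderiv ℝ (g.hamiltonianCoords z.proj) (extChartAt (cotangentModel 4) z z) := by
    rw [ModelWithCorners.range_eq_univ, fderivWithin_univ]
    refine Filter.EventuallyEq.fderiv_eq ?_
    filter_upwards [extChartAt_target_mem_nhds (I := cotangentModel 4) z] with ζ hζ
    have := hamiltonian_eq g ((extChartAt (cotangentModel 4) z).map_target hζ)
    rw [(extChartAt (cotangentModel 4) z).right_inv hζ] at this
    exact this
  rw [h1]
  exact DFunLike.congr_fun h2 W

/-- The symplectic form is nondegenerate, so the equation defining the spray has one solution; null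
geodesics thereby become integral curves of the vector field `spray`. -/
theorem isGeodesicSpray_iff (z : CotangentBundle 4 M) (X : TangentSpace (cotangentModel 4) z) :
    g.IsGeodesicSpray z X ↔ X = g.spray z := by
  have h0 := mem_extChartAt_target (I := cotangentModel 4) z
  rw [cotangent_target] at h0
  have key : g.IsGeodesicSpray z X ↔ ∀ W, modelSymplectic X W = modelSymplectic (g.spray z) W := by
    refine forall_congr' fun W => ?_
    refine Iff.trans (iff_of_eq (congrArg (fun r : ℝ => modelSymplectic X W + r = 0)
      (mfderiv_hamiltonian g z W))) ?_
    rw [show modelSymplectic (g.spray z) W = _ from modelSymplectic_sprayCoords g z.proj h0.1 W,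
      add_eq_zero_iff_eq_neg]
  rw [key]
  exact ⟨eq_of_modelSymplectic_eq, fun h W => by rw [h]⟩

/-- The geodesic spray has the expected expression in each canonical chart. -/
theorem tangentCoordChange_spray {z₀ z : CotangentBundle 4 M}
    (hz : z ∈ (extChartAt (cotangentModel 4) z₀).source) :
    tangentCoordChange (cotangentModel 4) z z₀ z (g.spray z) =
      g.sprayCoords z₀.proj (extChartAt (cotangentModel 4) z₀ z) := by
  have hzz := mem_extChartAt_source (I := cotangentModel 4) z
  have h0 := mem_extChartAt_target (I := cotangentModel 4) z
  have h0' := (extChartAt (cotangentModel 4) z₀).map_source hz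
  rw [cotangent_target] at h0 h0'
  refine eq_of_modelSymplectic_eq fun W => ?_
  -- `W'` is `W` moved to the chart at `z`. The pairing with the spray there is `-dH`, and both the
  -- symplectic form and `dH` are compatible with the change of charts.
  let W' : EuclideanSpace ℝ (Fin 4) × (EuclideanSpace ℝ (Fin 4) →L[ℝ] ℝ) :=
    tangentCoordChange (cotangentModel 4) z₀ z z W
  have hW : tangentCoordChange (cotangentModel 4) z z₀ z W' = W :=
    (tangentCoordChange_comp ⟨⟨hz, hzz⟩, hz⟩).trans (tangentCoordChange_self hz)
  have h1 := modelSymplectic_tangentCoordChange hz (g.spray z) W'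
  rw [hW] at h1
  rw [h1, modelSymplectic_sprayCoords g _ h0'.1]
  refine (modelSymplectic_sprayCoords g z.proj h0.1 W').trans (congrArg _ ?_)
  have hF := hasFDerivWithinAt_tangentCoordChange (I := cotangentModel 4) (x := z) (y := z₀) (z := z)
      ⟨hzz, hz⟩
  rw [ModelWithCorners.range_eq_univ, hasFDerivWithinAt_univ] at hF
  have hd := ((contDiffAt_hamiltonianCoords g z₀.proj h0'.1).differentiableAt (by simp)).hasFDerivAt
  have hpt : (extChartAt (cotangentModel 4) z₀ ∘ (extChartAt (cotangentModel 4) z).symm)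
      (extChartAt (cotangentModel 4) z z) = extChartAt (cotangentModel 4) z₀ z := by
    rw [Function.comp_apply, (extChartAt (cotangentModel 4) z).left_inv hzz]
  rw [← hpt] at hd
  have h2 := hd.comp _ hF
  rw [hpt] at h2
  have h3 : g.hamiltonianCoords z.proj =ᶠ[𝓝 (extChartAt (cotangentModel 4) z z)]
      g.hamiltonianCoords z₀.proj ∘ (extChartAt (cotangentModel 4) z₀ ∘
        (extChartAt (cotangentModel 4) z).symm) := by
    have h4 := (continuousAt_extChartAt_symm (I := cotangentModel 4) z).eventually_mem
      (s := (extChartAt (cotangentModel 4) z₀).source)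
      (by rw [extChartAt_to_inv]; exact extChartAt_source_mem_nhds' hz)
    filter_upwards [extChartAt_target_mem_nhds (I := cotangentModel 4) z, h4] with ζ hζ hζ'
    have h5 := hamiltonian_eq g ((extChartAt (cotangentModel 4) z).map_target hζ)
    rw [(extChartAt (cotangentModel 4) z).right_inv hζ] at h5
    rw [← h5, hamiltonian_eq g hζ']
    rfl
  rw [(h2.congr_of_eventuallyEq h3).fderiv]
  change fderiv ℝ (g.hamiltonianCoords z₀.proj) _
    (tangentCoordChange (cotangentModel 4) z z₀ z W') = _
  rw [hW]

/-- The definition of `spray` uses a different chart at each point. Smoothness is visible only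
because its expression in one fixed chart is again `sprayCoords`. -/
theorem contMDiff_spray : ContMDiff (cotangentModel 4) (cotangentModel 4).tangent ∞
    (fun z => (⟨z, g.spray z⟩ : TangentBundle (cotangentModel 4) (CotangentBundle 4 M))) := by
  intro z
  have h0 := mem_extChartAt_target (I := cotangentModel 4) z
  rw [cotangent_target] at h0
  refine (contMDiffAt_section z).2 ?_
  have h1 := (contDiffAt_sprayCoords g z.proj h0.1).contMDiffAt.comp z
    (contMDiffAt_extChartAt (I := cotangentModel 4) (n := ∞) (x := z))
  refine h1.congr_of_eventuallyEq ?_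
  filter_upwards [extChartAt_source_mem_nhds (I := cotangentModel 4) z] with z' hz'
  exact tangentCoordChange_spray g hz'

theorem chartField_spray {z₀ : CotangentBundle 4 M}
    {ζ : EuclideanSpace ℝ (Fin 4) × (EuclideanSpace ℝ (Fin 4) →L[ℝ] ℝ)}
    (hζ : ζ.1 ∈ (extChartAt (𝓡 4) z₀.proj).target) :
    chartField g.spray z₀ ζ = g.sprayCoords z₀.proj ζ := by
  have hζ' : ζ ∈ (extChartAt (cotangentModel 4) z₀).target := by
    rw [cotangent_target]; exact ⟨hζ, mem_univ _⟩
  have h := tangentCoordChange_spray g ((extChartAt (cotangentModel 4) z₀).map_target hζ')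
  rwa [(extChartAt (cotangentModel 4) z₀).right_inv hζ'] at h

theorem isNullGeodesicOn_iff {η : ℝ → CotangentBundle 4 M} {J : Set ℝ} (hJ : IsOpen J) :
    g.IsNullGeodesicOn η J ↔ (∀ t ∈ J, η t ∈ g.nullBundle) ∧ IsMIntegralCurveOn η g.spray J := by
  simp only [IsNullGeodesicOn, isGeodesicSpray_iff, exists_eq_left, IsMIntegralCurveOn,
    ← forall_and]
  refine forall₂_congr fun t ht => and_congr_right fun _ => ?_
  exact ⟨fun h => h.hasMFDerivWithinAt, fun h => h.hasMFDerivAt (hJ.mem_nhds ht)⟩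

end SpacetimeMetric

/-! ### Invariance of the null bundle under the spray flow. -/

namespace SpacetimeMetric

variable {M : Type*} [TopologicalSpace M] [ChartedSpace (EuclideanSpace ℝ (Fin 4)) M]
  [IsManifold (𝓡 4) ∞ M] (g : SpacetimeMetric M)

theorem sharp_smul (x : M) (c : ℝ) (p : CotangentSpace 4 x) :
    g.sharp x (c • p) = c • g.sharp x p :=
  (g.isLorentzForm x).eq_of_forall fun v => by
    rw [flat_sharp, map_smul, flat_sharp]

theorem sharp_flat (x : M) (v : TangentSpace (𝓡 4) x) : g.sharp x (g.val x v) = v :=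
  (g.isLorentzForm x).eq_of_forall fun w => by rw [flat_sharp]

theorem mem_nullBundle_iff {z : CotangentBundle 4 M} :
    z ∈ g.nullBundle ↔ z.2 (g.sharp z.proj z.2) = 0 ∧ z.2 (g.future z.proj) < 0 := by
  have h1 : g.hamiltonian z = 0 ↔ z.2 (g.sharp z.proj z.2) = 0 := by simp [hamiltonian]
  simp only [nullBundle, mem_ofPred_eq, h1, IsFutureCausal, flat_sharp]
  refine and_congr_right fun h => ⟨fun h' => h'.2.2, fun h' => ⟨fun h0 => ?_, h.le, h'⟩⟩
  have : g.val z.proj (g.sharp z.proj z.2) (g.future z.proj) < 0 := by rwa [flat_sharp]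
  rw [h0] at this
  simp at this

theorem smul_mem_nullBundle {z : CotangentBundle 4 M} (hz : z ∈ g.nullBundle) {c : ℝ} (hc : 0 < c) :
    (⟨z.proj, c • z.2⟩ : CotangentBundle 4 M) ∈ g.nullBundle := by
  rw [mem_nullBundle_iff] at hz ⊢
  refine ⟨?_, ?_⟩
  · rw [sharp_smul, map_smul, _root_.smul_apply, hz.1]; simp
  · exact mul_neg_of_pos_of_neg hc hz.2

variable {g} in
theorem hasDerivAt_chart_of_spray {η : ℝ → CotangentBundle 4 M} {t : ℝ}
    (hη : HasMFDerivAt 𝓘(ℝ, ℝ) (cotangentModel 4) η t ((1 : ℝ →L[ℝ] ℝ).smulRight (g.spray (η t))))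
    {z₀ : CotangentBundle 4 M} (hz : η t ∈ (extChartAt (cotangentModel 4) z₀).source) :
    HasDerivAt (extChartAt (cotangentModel 4) z₀ ∘ η)
      (g.sprayCoords z₀.proj (extChartAt (cotangentModel 4) z₀ (η t))) t := by
  have h := hη.hasDerivAt_extChartAt hz
  rwa [chartField_spray] at h
  have h0' := (extChartAt (cotangentModel 4) z₀).map_source hz
  rw [cotangent_target] at h0'
  exact h0'.1

variable {g} in
-- Conservation of energy: `dH` of the spray is minus the symplectic pairing of the spray with
-- itself.
theorem hasDerivAt_hamiltonian {η : ℝ → CotangentBundle 4 M} {t : ℝ}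
    (hη : HasMFDerivAt 𝓘(ℝ, ℝ) (cotangentModel 4) η t ((1 : ℝ →L[ℝ] ℝ).smulRight (g.spray (η t)))) :
    HasDerivAt (g.hamiltonian ∘ η) 0 t := by
  have hz := mem_extChartAt_source (I := cotangentModel 4) (η t)
  have h0 := mem_extChartAt_target (I := cotangentModel 4) (η t)
  rw [cotangent_target] at h0
  have h1 := hasDerivAt_chart_of_spray hη hz
  have h2 := ((contDiffAt_hamiltonianCoords g (η t).proj h0.1).differentiableAt
    (by simp)).hasFDerivAt.comp_hasDerivAt_of_eq t h1 rfl
  have h3 := modelSymplectic_sprayCoords g (η t).proj h0.1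
    (g.sprayCoords (η t).proj (extChartAt (cotangentModel 4) (η t) (η t)))
  rw [modelSymplectic, sub_self, zero_eq_neg] at h3
  refine (h2.congr_deriv h3).congr_of_eventuallyEq ?_
  filter_upwards [hη.continuousAt.eventually_mem
    (extChartAt_source_mem_nhds (I := cotangentModel 4) (η t))] with s hs
  exact hamiltonian_eq g hs

variable {g} in
theorem apply_futureCoords {z₀ z : CotangentBundle 4 M}
    (hz : z ∈ (extChartAt (cotangentModel 4) z₀).source) :
    (extChartAt (cotangentModel 4) z₀ z).2
      (g.futureCoords z₀.proj (extChartAt (cotangentModel 4) z₀ z).1) = z.2 (g.future z.proj) := by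
  have hx := mem_cotangent_source.1 hz
  rw [cotangent_extChartAt]
  have key : ∀ x', x' = z.proj → z.2 (chartDerivSymm z₀.proj z.proj (chartDeriv z₀.proj x'
      (g.future x'))) = z.2 (g.future z.proj) := by
    rintro _ rfl
    rw [chartDerivSymm_chartDeriv hx]
  exact key _ ((extChartAt (𝓡 4) z₀.proj).left_inv hx)

theorem continuous_apply_future :
    Continuous fun z : CotangentBundle 4 M => z.2 (g.future z.proj) := by
  refine continuous_iff_continuousAt.2 fun z => ?_
  have h0 := mem_extChartAt_target (I := cotangentModel 4) z
  rw [cotangent_target] at h0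
  have h1 := continuousAt_extChartAt (I := cotangentModel 4) z
  have h2 : ContinuousAt (fun z' => (extChartAt (cotangentModel 4) z z').2
      (g.futureCoords z.proj (extChartAt (cotangentModel 4) z z').1)) z :=
    h1.snd.clm_apply ((contDiffAt_futureCoords g z.proj h0.1).continuousAt.comp
      (f := fun z' => (extChartAt (cotangentModel 4) z z').1) h1.fst)
  refine h2.congr ?_
  filter_upwards [extChartAt_source_mem_nhds (I := cotangentModel 4) z] with z' hz'
  exact apply_futureCoords hz'

/-- The derivative of `H` vanishes on the zero section: vertically because `H` is quadratic,
horizontally because `H` is identically zero there. Zero covectors are therefore stationary, which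
is used to keep null geodesics off the zero section. -/
theorem spray_zero (x : M) : g.spray ⟨x, 0⟩ = 0 := by
  symm
  rw [← isGeodesicSpray_iff]
  intro Y
  have h := mfderiv_hamiltonian g ⟨x, 0⟩ Y
  let Y' : EuclideanSpace ℝ (Fin 4) × (EuclideanSpace ℝ (Fin 4) →L[ℝ] ℝ) := Y
  have h0 := mem_extChartAt_target (I := cotangentModel 4) (⟨x, 0⟩ : CotangentBundle 4 M)
  rw [cotangent_target] at h0
  have hc : extChartAt (cotangentModel 4) (⟨x, 0⟩ : CotangentBundle 4 M) ⟨x, 0⟩ =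
      (extChartAt (𝓡 4) x x, 0) := by
    rw [cotangent_extChartAt]
    exact Prod.ext rfl (ContinuousLinearMap.zero_comp _)
  have hz : fderiv ℝ (g.hamiltonianCoords x) (extChartAt (𝓡 4) x x, 0) Y' = 0 := by
    have : Y' = (Y'.1, 0) + (0, Y'.2) := by simp
    rw [this, map_add, fderiv_hamiltonianCoords_snd g x (mem_extChartAt_target x)]
    have h1 := ((contDiffAt_hamiltonianCoords g x (ζ := (extChartAt (𝓡 4) x x, 0))
      (mem_extChartAt_target x)).differentiableAt (by simp)).hasFDerivAt
    have h2 : HasFDerivAt (fun y : EuclideanSpace ℝ (Fin 4) =>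
      (y, (0 : EuclideanSpace ℝ (Fin 4) →L[ℝ] ℝ))) (ContinuousLinearMap.inl ℝ _ _)
      (extChartAt (𝓡 4) x x) := hasFDerivAt_prodMk_left _ _
    let j : EuclideanSpace ℝ (Fin 4) →
      EuclideanSpace ℝ (Fin 4) × (EuclideanSpace ℝ (Fin 4) →L[ℝ] ℝ) := fun y => (y, 0)
    have h3 : HasFDerivAt (g.hamiltonianCoords x ∘ j) _ (extChartAt (𝓡 4) x x) :=
      HasFDerivAt.comp (f := j) _ h1 h2
    have h4 : HasFDerivAt (g.hamiltonianCoords x ∘ j) (0 : EuclideanSpace ℝ (Fin 4) →L[ℝ] ℝ)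
        (extChartAt (𝓡 4) x x) := by
      refine (hasFDerivAt_const (0 : ℝ) _).congr_of_eventuallyEq (Eventually.of_forall fun y => ?_)
      simp [hamiltonianCoords, j]
    have h5 := DFunLike.congr_fun (h3.unique h4) Y'.1
    simp only [ContinuousLinearMap.comp_apply, ContinuousLinearMap.inl_apply,
      _root_.zero_apply] at h5
    rw [h5]
    simp
  rw [hc] at h
  refine (congrArg₂ (· + ·) (?_ : _ = (0 : ℝ)) (h.trans hz)).trans (add_zero 0)
  change (0 : EuclideanSpace ℝ (Fin 4) →L[ℝ] ℝ) Y'.1 - Y'.2 0 = 0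
  simp

theorem flowRel_zero_section (x : M) (t : ℝ) :
    FlowRel g.spray (⟨x, 0⟩ : CotangentBundle 4 M) t ⟨x, 0⟩ := by
  refine ⟨fun _ => ⟨x, 0⟩, -(|t| + 1), |t| + 1, ?_, ?_, fun s _ => ?_, rfl, rfl⟩
  · constructor <;> linarith [abs_nonneg t]
  · constructor <;> linarith [le_abs_self t, neg_abs_le t]
  · have h : HasMFDerivAt 𝓘(ℝ, ℝ) (cotangentModel 4)
      (fun _ : ℝ => (⟨x, 0⟩ : CotangentBundle 4 M)) s
        ((1 : ℝ →L[ℝ] ℝ).smulRight (0 : TangentSpace (cotangentModel 4) (⟨x, 0⟩ : CotangentBundle 4 M))) := by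
      rw [ContinuousLinearMap.smulRight_zero]
      exact hasMFDerivAt_const _ _
    rw [← spray_zero g x] at h
    exact h.hasMFDerivWithinAt

theorem eq_zero_of_null {x : M} {p : CotangentSpace 4 x} (h : p (g.sharp x p) = 0)
    (h' : p (g.future x) = 0) : p = 0 := by
  have h1 := (g.isLorentzForm x).eq_zero_of_causal (g.future_timelike x) (v := g.sharp x p)
    (by rw [flat_sharp, h]) (by rw [flat_sharp, h'])
  rw [← g.flat_sharp x p, h1, map_zero]

variable {g} in
-- `H` is conserved. To stop being future pointing, the pairing with the time orientation would have
-- to vanish at some time; a null covector with this pairing zero is zero, and zero covectors do not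
-- move, contradicting uniqueness of integral curves.
theorem mem_nullBundle_of_flowRel [T2Space M] {z z' : CotangentBundle 4 M} {t : ℝ}
    (h : FlowRel g.spray z t z') (hz : z ∈ g.nullBundle) : z' ∈ g.nullBundle := by
  have h' := h
  obtain ⟨β, a, b, h0, ht, hβ, rfl, rfl⟩ := h
  have hβ' : ∀ s ∈ Ioo a b, HasMFDerivAt 𝓘(ℝ, ℝ) (cotangentModel 4) β s
      ((1 : ℝ →L[ℝ] ℝ).smulRight (g.spray (β s))) := fun s hs =>
    (hβ s hs).hasMFDerivAt (isOpen_Ioo.mem_nhds hs)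
  have hH : ∀ s ∈ Ioo a b, g.hamiltonian (β s) = 0 := fun s hs => by
    have h1 := isOpen_Ioo.is_const_of_deriv_eq_zero (isPreconnected_Ioo (a := a) (b := b))
      (f := g.hamiltonian ∘ β) (𝕜 := ℝ)
      (fun s hs => (hasDerivAt_hamiltonian (hβ' s hs)).differentiableAt.differentiableWithinAt)
      (fun s hs => (hasDerivAt_hamiltonian (hβ' s hs)).deriv) hs h0
    exact h1.trans hz.1
  have hH' : ∀ s ∈ Ioo a b, (β s).2 (g.sharp _ (β s).2) = 0 := fun s hs => by
    simpa [hamiltonian] using hH s hs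
  rw [mem_nullBundle_iff] at hz ⊢
  refine ⟨hH' t ht, ?_⟩
  by_contra! hcon
  have hc : ContinuousOn (fun s => (β s).2 (g.future (β s).proj)) (Ioo a b) :=
    g.continuous_apply_future.comp_continuousOn fun s hs =>
      (hβ' s hs).continuousAt.continuousWithinAt
  obtain ⟨s, hs, hs0⟩ := isPreconnected_Ioo.intermediate_value h0 ht hc ⟨hz.2.le, hcon⟩
  have hp := g.eq_zero_of_null (hH' s hs) hs0
  have hβs : β s = ⟨(β s).proj, 0⟩ := congrArg (TotalSpace.mk (β s).proj) hp
  have h1 : FlowRel g.spray (β s) (0 - s) (β 0) :=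
    FlowRel.of_isMIntegralCurveOn isOpen_Ioo ordConnected_Ioo hβ hs h0
  have h2 : FlowRel g.spray (β s) (0 - s) (β s) := by
    rw [hβs]; exact g.flowRel_zero_section _ _
  have h3 := h1.unique g.contMDiff_spray h2
  have h4 := hz.2
  rw [h3] at h4
  exact h4.ne hs0

variable {g} in
/-- The base curve of an integral curve of the geodesic spray has velocity `pᵃ`. -/
theorem hasMFDerivAt_proj {η : ℝ → CotangentBundle 4 M} {t : ℝ}
    (hη : HasMFDerivAt 𝓘(ℝ, ℝ) (cotangentModel 4) η t ((1 : ℝ →L[ℝ] ℝ).smulRight (g.spray (η t)))) :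
    HasMFDerivAt 𝓘(ℝ, ℝ) (𝓡 4) (fun s => (η s).proj) t
      ((1 : ℝ →L[ℝ] ℝ).smulRight (g.sharp _ (η t).2)) := by
  have hz := mem_extChartAt_source (I := cotangentModel 4) (η t)
  have hx := mem_extChartAt_source (I := 𝓡 4) (η t).proj
  have h1 := hasDerivAt_chart_of_spray hη hz
  have h2 : HasDerivAt (fun s => extChartAt (𝓡 4) (η t).proj (η s).proj)
      (g.cometricCoords (η t).proj (extChartAt (𝓡 4) (η t).proj (η t).proj)
        ((η t).2.comp (chartDerivSymm (η t).proj (η t).proj))) t := by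
    have := (ContinuousLinearMap.fst ℝ (EuclideanSpace ℝ (Fin 4))
      (EuclideanSpace ℝ (Fin 4) →L[ℝ] ℝ)).hasFDerivAt.comp_hasDerivAt t h1
    rw [cotangent_extChartAt] at this
    convert! this using 1
  have h3 := sharp_eq g hx (η t).2
  rw [chartDerivSymm_eq hx] at h3
  obtain ⟨w, hw⟩ : ∃ w : EuclideanSpace ℝ (Fin 4),
    w = (show EuclideanSpace ℝ (Fin 4) from g.sharp _ (η t).2) := ⟨_, rfl⟩
  have h3' : ∀ a : EuclideanSpace ℝ (Fin 4),
    tangentCoordChange (𝓡 4) (η t).proj (η t).proj (η t).proj a = a :=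
      fun a => tangentCoordChange_self hx
  have h4 := hw.trans (h3.trans (h3' _))
  rw [← h4] at h2
  refine ⟨(FiberBundle.continuous_proj _ _).continuousAt.comp hη.continuousAt, ?_⟩
  have h5 : HasFDerivWithinAt (fun s => extChartAt (𝓡 4) (η t).proj (η s).proj)
    ((1 : ℝ →L[ℝ] ℝ).smulRight w) (range 𝓘(ℝ, ℝ)) t := h2.hasFDerivAt.hasFDerivWithinAt
  rw [hw] at h5
  exact h5

end SpacetimeMetric

/-- If `|u'| ≤ w'` on an open interval, then increments of `u` are bounded by those of `w`. -/
theorem abs_sub_le_of_abs_deriv_le {D : Set ℝ} (hD' : D.OrdConnected)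
    {u w u' w' : ℝ → ℝ} (hu : ∀ t ∈ D, HasDerivAt u (u' t) t) (hw : ∀ t ∈ D, HasDerivAt w (w' t) t)
    (h : ∀ t ∈ D, |u' t| ≤ w' t) {s t : ℝ} (hs : s ∈ D) (ht : t ∈ D) :
    |u t - u s| ≤ |w t - w s| := by
  have hmono : ∀ v v' : ℝ → ℝ, (∀ t ∈ D, HasDerivAt v (v' t) t) → (∀ t ∈ D, 0 ≤ v' t) →
      MonotoneOn v D := fun v v' hv hv' =>
    monotoneOn_of_hasDerivWithinAt_nonneg hD'.convex
      (fun t ht => (hv t ht).continuousAt.continuousWithinAt)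
      (fun t ht => (hv t (interior_subset ht)).hasDerivWithinAt)
      (fun t ht => hv' t (interior_subset ht))
  have h1 := hmono (fun t => w t - u t) _ (fun t ht => (hw t ht).sub (hu t ht))
    (fun t ht => by linarith [(abs_le.1 (h t ht)).2])
  have h2 := hmono (fun t => w t + u t) _ (fun t ht => (hw t ht).add (hu t ht))
    (fun t ht => by linarith [(abs_le.1 (h t ht)).1])
  rcases le_total s t with hst | hst
  · have a1 := h1 hs ht hst
    have a2 := h2 hs ht hst
    simp only at a1 a2
    exact le_trans (abs_le.2 ⟨by linarith, by linarith⟩) (le_abs_self _)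
  · have a1 := h1 ht hs hst
    have a2 := h2 ht hs hst
    simp only at a1 a2
    exact le_trans (abs_le.2 ⟨by linarith, by linarith⟩) (neg_le_abs _)

/-! ### Rescaling of covectors and uniform estimates on the null cone. -/

namespace SpacetimeMetric

variable {M : Type*} [TopologicalSpace M] [ChartedSpace (EuclideanSpace ℝ (Fin 4)) M]
  [IsManifold (𝓡 4) ∞ M] (g : SpacetimeMetric M)

/-- The base component is linear in the covector, whereas the covector component comes from the
position derivative of `H` and is quadratic. -/
theorem sprayCoords_smul (x₀ : M) {y : EuclideanSpace ℝ (Fin 4)}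
    (hy : y ∈ (extChartAt (𝓡 4) x₀).target) (q : EuclideanSpace ℝ (Fin 4) →L[ℝ] ℝ) (c : ℝ) :
    g.sprayCoords x₀ (y, c • q) =
      (c • (g.sprayCoords x₀ (y, q)).1, c • c • (g.sprayCoords x₀ (y, q)).2) := by
  have key : ∀ q : EuclideanSpace ℝ (Fin 4) →L[ℝ] ℝ,
      (fderiv ℝ (g.hamiltonianCoords x₀) (y, q)).comp (ContinuousLinearMap.inl ℝ _ _) =
        fderiv ℝ (fun y' => g.hamiltonianCoords x₀ (y', q)) y := fun q => by
    have h1 := ((contDiffAt_hamiltonianCoords g x₀ (ζ := (y, q)) hy).differentiableAt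
      (by simp)).hasFDerivAt
    exact (HasFDerivAt.comp (f := fun y' : EuclideanSpace ℝ (Fin 4) => (y', q)) y h1
      (hasFDerivAt_prodMk_left _ _)).fderiv.symm
  refine Prod.ext (map_smul _ _ _) ?_
  change -(fderiv ℝ (g.hamiltonianCoords x₀) (y, c • q)).comp (ContinuousLinearMap.inl ℝ _ _) =
    c • c • -(fderiv ℝ (g.hamiltonianCoords x₀) (y, q)).comp (ContinuousLinearMap.inl ℝ _ _)
  have h2 : (fun y' => g.hamiltonianCoords x₀ (y', c • q)) =
      (c * c) • fun y' => g.hamiltonianCoords x₀ (y', q) := by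
    ext y'
    simp only [hamiltonianCoords, map_smul, _root_.smul_apply, Pi.smul_apply, smul_eq_mul]
    ring
  rw [key, key, h2, fderiv_const_smul_field, smul_smul, smul_neg]
  rfl

theorem cotangent_extChartAt_smul (z₀ z : CotangentBundle 4 M) (c : ℝ) :
    extChartAt (cotangentModel 4) z₀ ⟨z.proj, c • z.2⟩ =
      ((extChartAt (cotangentModel 4) z₀ z).1, c • (extChartAt (cotangentModel 4) z₀ z).2) := by
  rw [cotangent_extChartAt, cotangent_extChartAt]
  exact Prod.ext rfl (ContinuousLinearMap.smul_comp _ _ _)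

theorem smul_eq_extChartAt_symm {z₀ z : CotangentBundle 4 M}
    (hz : z ∈ (extChartAt (cotangentModel 4) z₀).source) (c : ℝ) :
    (⟨z.proj, c • z.2⟩ : CotangentBundle 4 M) = (extChartAt (cotangentModel 4) z₀).symm
      ((extChartAt (cotangentModel 4) z₀ z).1, c • (extChartAt (cotangentModel 4) z₀ z).2) := by
  have h : (⟨z.proj, c • z.2⟩ : CotangentBundle 4 M) ∈ (extChartAt (cotangentModel 4) z₀).source :=
    by rw [mem_cotangent_source] at hz ⊢; exact hz
  rw [← cotangent_extChartAt_smul, (extChartAt (cotangentModel 4) z₀).left_inv h]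

variable {g}

/-- The scaling of covectors maps integral curves of the geodesic spray to reparametrised ones. -/
theorem flowRel_smul {z z' : CotangentBundle 4 M} {t c : ℝ} (hc : 0 < c)
    (h : FlowRel g.spray z t z') :
    FlowRel g.spray (⟨z.proj, c • z.2⟩ : CotangentBundle 4 M) (t / c) ⟨z'.proj, c • z'.2⟩ := by
  obtain ⟨β, a, b, h0, ht, hβ, rfl, rfl⟩ := h
  have hmem : ∀ r, r ∈ Ioo (a / c) (b / c) ↔ c * r ∈ Ioo a b := fun r => by
    rw [mem_Ioo, mem_Ioo, div_lt_iff₀' hc, lt_div_iff₀' hc]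
  have hβ' : ∀ s ∈ Ioo a b, HasMFDerivAt 𝓘(ℝ, ℝ) (cotangentModel 4) β s
      ((1 : ℝ →L[ℝ] ℝ).smulRight (g.spray (β s))) := fun s hs =>
    (hβ s hs).hasMFDerivAt (isOpen_Ioo.mem_nhds hs)
  refine ⟨fun r => ⟨(β (c * r)).proj, c • (β (c * r)).2⟩, a / c, b / c, (hmem 0).2 (by simpa using h0),
    (hmem _).2 (by rwa [mul_div_cancel₀ _ hc.ne']), fun s hs => ?_, ?_, ?_⟩
  · obtain ⟨z₀, hz₀⟩ : ∃ z₀, z₀ = β (c * s) := ⟨_, rfl⟩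
    let U : Set ℝ := Ioo (a / c) (b / c) ∩ {r | β (c * r) ∈ (extChartAt (cotangentModel 4) z₀).source}
    let ρ : ℝ → EuclideanSpace ℝ (Fin 4) × (EuclideanSpace ℝ (Fin 4) →L[ℝ] ℝ) := fun r =>
      ((extChartAt (cotangentModel 4) z₀ (β (c * r))).1,
        c • (extChartAt (cotangentModel 4) z₀ (β (c * r))).2)
    have hU : U ∈ 𝓝 s := by
      refine inter_mem (isOpen_Ioo.mem_nhds hs) ?_
      have : ContinuousAt (fun r => β (c * r)) s :=
        (hβ' _ ((hmem s).1 hs)).continuousAt.comp (f := fun r => c * r)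
          (continuous_const_mul c).continuousAt
      refine this.eventually_mem ?_
      rw [← hz₀]
      exact (extChartAt_source_mem_nhds (I := cotangentModel 4) z₀)
    have htar : ∀ r ∈ U, (ρ r).1 ∈ (extChartAt (𝓡 4) z₀.proj).target := fun r hr => by
      have := (extChartAt (cotangentModel 4) z₀).map_source hr.2
      rw [cotangent_target] at this
      exact this.1
    have hρ : IsMIntegralCurveOn ((extChartAt (cotangentModel 4) z₀).symm ∘ ρ) g.spray U := by
      refine isMIntegralCurveOn_of_chart fun r hr => ⟨?_, ?_⟩
      -- The chain rule for `r ↦ c * r` contributes one factor `c`, and scaling the covector part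
      -- contributes another. These match the homogeneity degrees one and two of the spray.
      · rw [chartField_spray g (htar r hr), sprayCoords_smul g _ (htar r hr)]
        have h1 := hasDerivAt_chart_of_spray (hβ' _ ((hmem r).1 hr.1)) hr.2
        have h2 := h1.scomp r (hasDerivAt_const_mul (x := r) c)
        exact ((ContinuousLinearMap.fst ℝ (EuclideanSpace ℝ (Fin 4))
          (EuclideanSpace ℝ (Fin 4) →L[ℝ] ℝ)).prod
          (c • ContinuousLinearMap.snd ℝ _ _)).hasFDerivAt.comp_hasDerivAt r h2
      · rw [cotangent_target]
        exact ⟨htar r hr, mem_univ _⟩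
    have h3 := (hρ s (mem_of_mem_nhds hU)).hasMFDerivAt hU
    have h4 : (fun r => (⟨(β (c * r)).proj, c • (β (c * r)).2⟩ : CotangentBundle 4 M)) =ᶠ[𝓝 s]
        (extChartAt (cotangentModel 4) z₀).symm ∘ ρ := by
      filter_upwards [hU] with r hr
      exact smul_eq_extChartAt_symm hr.2 c
    rw [← h4.self_of_nhds] at h3
    exact (h3.congr_of_eventuallyEq h4).hasMFDerivWithinAt
  · exact congrArg (fun r => (⟨(β r).proj, c • (β r).2⟩ : CotangentBundle 4 M)) (mul_zero c)
  · exact congrArg (fun r => (⟨(β r).proj, c • (β r).2⟩ : CotangentBundle 4 M))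
      (mul_div_cancel₀ _ hc.ne')

/-- Near a point, the coordinate components of future null covectors and their derivatives along
null geodesics are controlled by a time coordinate. -/
theorem exists_cone_estimate (x : M) :
    ∃ m > 0, ∃ C, ∀ᶠ y in 𝓝 (extChartAt (𝓡 4) x x), ∀ q : EuclideanSpace ℝ (Fin 4) →L[ℝ] ℝ,
      q (g.cometricCoords x y q) = 0 → q (g.futureCoords x y) ≤ 0 →
      m * ‖q‖ ≤ -q (g.futureCoords x (extChartAt (𝓡 4) x x)) ∧
      m * ‖q‖ ≤ -g.metricCoords x (extChartAt (𝓡 4) x x)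
        (g.futureCoords x (extChartAt (𝓡 4) x x)) (g.cometricCoords x y q) ∧
      |(g.sprayCoords x (y, q)).2 (g.futureCoords x (extChartAt (𝓡 4) x x))| ≤ C * ‖q‖ ^ 2 := by
  set y₀ : EuclideanSpace ℝ (Fin 4) := extChartAt (𝓡 4) x x with hy₀
  have hy : y₀ ∈ (extChartAt (𝓡 4) x).target := mem_extChartAt_target x
  set T₀ : EuclideanSpace ℝ (Fin 4) := g.futureCoords x y₀ with hT₀
  have hG := g.isLorentzForm_metricCoords hy
  have hT : g.metricCoords x y₀ T₀ T₀ < 0 := by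
    rw [metricCoords_apply g hy, hT₀, futureCoords,
      chartDerivSymm_chartDeriv ((extChartAt (𝓡 4) x).map_target hy)]
    exact g.future_timelike _
  have hKy : ContinuousAt (g.cometricCoords x) y₀ := (contDiffAt_cometricCoords hy).continuousAt
  have hTy : ContinuousAt (g.futureCoords x) y₀ := (g.contDiffAt_futureCoords x hy).continuousAt
  have hK : ∀ q, ContinuousAt (fun p : EuclideanSpace ℝ (Fin 4) × (EuclideanSpace ℝ (Fin 4) →L[ℝ] ℝ) => g.cometricCoords x p.1 p.2) (y₀, q) :=
    fun q => (hKy.comp (x := (y₀, q)) (f := Prod.fst) continuousAt_fst).clm_apply continuousAt_snd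
  have hT' : ∀ q, ContinuousAt (fun p : EuclideanSpace ℝ (Fin 4) × (EuclideanSpace ℝ (Fin 4) →L[ℝ] ℝ) => g.futureCoords x p.1) (y₀, q) :=
    fun q => hTy.comp (x := (y₀, q)) (f := Prod.fst) continuousAt_fst
  have hS : ∀ q, ContinuousAt (g.sprayCoords x) (y₀, q) := fun q =>
    (g.contDiffAt_sprayCoords x (ζ := (y₀, q)) hy).continuousAt
  have hsph : IsCompact (Metric.sphere (0 : EuclideanSpace ℝ (Fin 4) →L[ℝ] ℝ) 1) := isCompact_sphere 0 1
  -- A nonzero null covector cannot annihilate the timelike vector `T₀`, so on the compact set of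
  -- unit null covectors of this sign at `y₀` the pairing `-q T₀` has a positive lower bound.
  have hpos : ∀ q : EuclideanSpace ℝ (Fin 4) →L[ℝ] ℝ, q ≠ 0 → q (g.cometricCoords x y₀ q) = 0 → q T₀ ≤ 0 → 0 < -q T₀ := by
    intro q hq h1 h2
    have h3 := metricCoords_cometricCoords (g := g) hy q
    refine neg_pos.2 (lt_of_le_of_ne h2 fun h4 => hq ?_)
    have h5 := hG.eq_zero_of_causal hT (v := g.cometricCoords x y₀ q) (by rw [h3, h1]) (by rw [h3, h4])
    rw [← h3, h5, map_zero]
  obtain ⟨m, hm, hm'⟩ : ∃ m > 0, ∀ q ∈ Metric.sphere (0 : EuclideanSpace ℝ (Fin 4) →L[ℝ] ℝ) 1,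
      q (g.cometricCoords x y₀ q) = 0 → q T₀ ≤ 0 → m < -q T₀ := by
    have hA : IsCompact (Metric.sphere (0 : EuclideanSpace ℝ (Fin 4) →L[ℝ] ℝ) 1 ∩
        {q | q (g.cometricCoords x y₀ q) = 0 ∧ q T₀ ≤ 0}) := by
      refine hsph.inter_right (IsClosed.inter ?_ ?_)
      · exact isClosed_eq (continuous_id.clm_apply (g.cometricCoords x y₀).continuous) continuous_const
      · exact isClosed_le (continuous_id.clm_apply continuous_const) continuous_const
    obtain ⟨m, hm, h⟩ := hA.exists_forall_le' (f := fun q : EuclideanSpace ℝ (Fin 4) →L[ℝ] ℝ => -q T₀) (a := 0)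
      (by fun_prop) (fun q hq => hpos q (by rintro rfl; simpa using hq.1) hq.2.1 hq.2.2)
    -- Halving makes the bound strict, hence stable under small changes of the point and the
    -- covector.
    exact ⟨m / 2, by positivity, fun q hq h1 h2 => (half_lt_self hm).trans_le (h q ⟨hq, h1, h2⟩)⟩
  obtain ⟨C, hC⟩ := hsph.exists_bound_of_continuousOn (f := fun q => (g.sprayCoords x (y₀, q)).2 T₀)
    fun q _ => (((hS q).comp (f := fun q => (y₀, q)) (by fun_prop)).snd.clm_apply
      continuousAt_const).continuousWithinAt
  refine ⟨m, hm, C + 1, ?_⟩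
  -- The estimates are proved for unit covectors, uniformly in nearby points by compactness of the
  -- sphere; homogeneity then gives them for all covectors.
  have key := hsph.eventually_forall_of_forall_eventually (x₀ := y₀)
    (P := fun y q => q (g.cometricCoords x y q) = 0 → q (g.futureCoords x y) ≤ 0 →
      m < -q T₀ ∧ m < -g.metricCoords x y₀ T₀ (g.cometricCoords x y q) ∧
        |(g.sprayCoords x (y, q)).2 T₀| < C + 1) ?_
  · filter_upwards [key, (isOpen_extChartAt_target x).mem_nhds hy] with y hy1 hy2 q hq1 hq2
    rcases eq_or_ne q 0 with rfl | hq
    · have := g.sprayCoords_smul x hy2 0 0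
      simp only [smul_zero, zero_smul] at this
      simp [this]
    · have hn : 0 < ‖q‖ := norm_pos_iff.2 hq
      obtain ⟨h1, h2, h3⟩ := hy1 (‖q‖⁻¹ • q) (by simp [norm_smul, hn.ne'])
        (by simp [hq1]) (by simpa using mul_nonpos_of_nonneg_of_nonpos (inv_nonneg.2 hn.le) hq2)
      rw [sprayCoords_smul g x hy2] at h3
      simp only [map_smul, _root_.smul_apply, smul_eq_mul] at h1 h2 h3
      rw [abs_mul, abs_mul, abs_of_pos (inv_pos.2 hn)] at h3
      refine ⟨?_, ?_, ?_⟩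
      · rw [← mul_neg, lt_inv_mul_iff₀ hn] at h1; linarith
      · rw [← mul_neg, lt_inv_mul_iff₀ hn] at h2; linarith
      · rw [inv_mul_lt_iff₀ hn, inv_mul_lt_iff₀ hn] at h3; nlinarith
  · intro q hq
    have c1 : ContinuousAt (fun p : EuclideanSpace ℝ (Fin 4) × (EuclideanSpace ℝ (Fin 4) →L[ℝ] ℝ) => p.2 (g.cometricCoords x p.1 p.2)) (y₀, q) :=
      continuousAt_snd.clm_apply (hK q)
    have c2 : ContinuousAt (fun p : EuclideanSpace ℝ (Fin 4) × (EuclideanSpace ℝ (Fin 4) →L[ℝ] ℝ) => p.2 (g.futureCoords x p.1)) (y₀, q) :=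
      continuousAt_snd.clm_apply (hT' q)
    have c3 : ContinuousAt (fun p : EuclideanSpace ℝ (Fin 4) × (EuclideanSpace ℝ (Fin 4) →L[ℝ] ℝ) => -p.2 T₀) (y₀, q) := by fun_prop
    have c4 : ContinuousAt (fun p : EuclideanSpace ℝ (Fin 4) × (EuclideanSpace ℝ (Fin 4) →L[ℝ] ℝ) =>
        -g.metricCoords x y₀ T₀ (g.cometricCoords x p.1 p.2)) (y₀, q) :=
      (continuousAt_const.clm_apply (hK q)).neg
    have c5 : ContinuousAt (fun p : EuclideanSpace ℝ (Fin 4) × (EuclideanSpace ℝ (Fin 4) →L[ℝ] ℝ) => |(g.sprayCoords x p).2 T₀|) (y₀, q) :=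
      ((hS q).snd.clm_apply continuousAt_const).abs
    -- If a unit covector violates one of the cone conditions at `y₀`, so do all nearby pairs, for
    -- which the claim is then vacuous.
    by_cases hq1 : q (g.cometricCoords x y₀ q) = 0
    · by_cases hq2 : q T₀ ≤ 0
      · have h1 := hm' q hq hq1 hq2
        have h2 : m < -g.metricCoords x y₀ T₀ (g.cometricCoords x y₀ q) := by
          rwa [hG.symm, metricCoords_cometricCoords hy]
        have h3 : |(g.sprayCoords x (y₀, q)).2 T₀| < C + 1 :=
          lt_of_le_of_lt (hC q hq) (by linarith)
        filter_upwards [c3.eventually_const_lt h1, c4.eventually_const_lt h2,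
          c5.eventually_lt_const h3] with p h1 h2 h3 _ _
        exact ⟨h1, h2, h3⟩
      · filter_upwards [c2.eventually_const_lt (not_le.1 hq2)] with p hp _ h
        exact absurd h hp.not_ge
    · filter_upwards [c1.eventually_ne hq1] with p hp h
      exact absurd h hp

end SpacetimeMetric

/-! ### Maximal null geodesics are inextendible causal curves. -/

namespace SpacetimeMetric

variable {M : Type*} [TopologicalSpace M] [ChartedSpace (EuclideanSpace ℝ (Fin 4)) M]
  [IsManifold (𝓡 4) ∞ M] {g : SpacetimeMetric M}

variable (g) in
/-- Null geodesics over `U` are bounded in parameter and stay in a compact set. -/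
def IsTrapping (U : Set M) : Prop :=
  ∀ (η : ℝ → CotangentBundle 4 M) (J : Set ℝ), IsOpen J → J.OrdConnected →
    g.IsNullGeodesicOn η J → (∀ t ∈ J, (η t).proj ∈ U) →
    (∃ B, ∀ s ∈ J, ∀ t ∈ J, |t - s| ≤ B) ∧ ∃ K, IsCompact K ∧ ∀ t ∈ J, η t ∈ K

/-- With `q` the covector component, let `f = -q T₀` and let `τ` be the linear time coordinate. The
cone estimates give `f ≥ m ‖q‖`, `τ' ≥ m ‖q‖` and `|f'| ≤ C ‖q‖ ^ 2`, so `|(log f)'|` is at most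
`|C| / m ^ 2` times `τ'`. As `τ` is bounded over the neighbourhood, `log f` varies by a bounded
amount. So `‖q‖` is bounded above, which gives compactness, and away from zero, which bounds the
parameter range because `τ` then grows at a definite rate. -/
theorem exists_isTrapping (x : M) : ∃ U ∈ 𝓝 x, g.IsTrapping U := by
  obtain ⟨m, hm, C, hC⟩ := exists_cone_estimate (g := g) x
  set y₀ : EuclideanSpace ℝ (Fin 4) := extChartAt (𝓡 4) x x with hy₀
  have hy : y₀ ∈ (extChartAt (𝓡 4) x).target := mem_extChartAt_target x
  set T₀ : EuclideanSpace ℝ (Fin 4) := g.futureCoords x y₀ with hT₀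
  let ℓ := g.metricCoords x y₀ T₀
  obtain ⟨r, hr, hball⟩ : ∃ r > 0, ∀ y ∈ Metric.closedBall y₀ r, y ∈ (extChartAt (𝓡 4) x).target ∧
      ∀ q : EuclideanSpace ℝ (Fin 4) →L[ℝ] ℝ,
      q (g.cometricCoords x y q) = 0 → q (g.futureCoords x y) ≤ 0 →
      m * ‖q‖ ≤ -q T₀ ∧ m * ‖q‖ ≤ -ℓ (g.cometricCoords x y q) ∧
      |(g.sprayCoords x (y, q)).2 T₀| ≤ C * ‖q‖ ^ 2 :=
    Metric.nhds_basis_closedBall.eventually_iff.1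
      (Filter.Eventually.and ((isOpen_extChartAt_target x).eventually_mem hy) hC)
  refine ⟨(extChartAt (𝓡 4) x).source ∩ extChartAt (𝓡 4) x ⁻¹' Metric.closedBall y₀ r,
    inter_mem (extChartAt_source_mem_nhds x)
      ((continuousAt_extChartAt x).preimage_mem_nhds (Metric.closedBall_mem_nhds _ hr)),
    fun η J hJ hJ' hη hU => ?_⟩
  rcases J.eq_empty_or_nonempty with rfl | ⟨t₁, ht₁⟩
  · exact ⟨⟨0, by simp⟩, ∅, isCompact_empty, by simp⟩
  rw [isNullGeodesicOn_iff g hJ] at hη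
  let z₀ : CotangentBundle 4 M := ⟨x, 0⟩
  let ζ := fun t => extChartAt (cotangentModel 4) z₀ (η t)
  have hsrc : ∀ t ∈ J, η t ∈ (extChartAt (cotangentModel 4) z₀).source := fun t ht =>
    mem_cotangent_source.2 (hU t ht).1
  have hζ1 : ∀ t ∈ J, (ζ t).1 ∈ Metric.closedBall y₀ r := fun t ht => (hU t ht).2
  have hder : ∀ t ∈ J, HasDerivAt ζ (g.sprayCoords x (ζ t)) t := fun t ht =>
    hasDerivAt_chart_of_spray ((hη.2 t ht).hasMFDerivAt (hJ.mem_nhds ht)) (hsrc t ht)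
  have hnull : ∀ t ∈ J, (ζ t).2 (g.cometricCoords x (ζ t).1 (ζ t).2) = 0 := fun t ht => by
    have h1 := hamiltonian_eq g (hsrc t ht)
    rw [(hη.1 t ht).1] at h1
    have h2 : (1 / 2 : ℝ) * (ζ t).2 (g.cometricCoords x (ζ t).1 (ζ t).2) = 0 := h1.symm
    linarith
  have hfut : ∀ t ∈ J, (ζ t).2 (g.futureCoords x (ζ t).1) < 0 := fun t ht => by
    have h1 := ((mem_nullBundle_iff g).1 (hη.1 t ht)).2
    rwa [← apply_futureCoords (hsrc t ht)] at h1
  have hest := fun t ht => (hball _ (hζ1 t ht)).2 _ (hnull t ht) (hfut t ht).le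
  have hζ0 : ∀ t ∈ J, 0 < ‖(ζ t).2‖ := fun t ht => norm_pos_iff.2 fun h => by
    have := hfut t ht
    rw [h] at this
    simp at this
  let f := fun t => -(ζ t).2 T₀
  let τ := fun t => -ℓ (ζ t).1
  have hf0 : ∀ t ∈ J, 0 < f t := fun t ht => (mul_pos hm (hζ0 t ht)).trans_le (hest t ht).1
  have hτ : ∀ t ∈ J, HasDerivAt τ (-ℓ (g.cometricCoords x (ζ t).1 (ζ t).2)) t := fun t ht => by
    have := (-ℓ.comp (ContinuousLinearMap.fst ℝ (EuclideanSpace ℝ (Fin 4))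
      (EuclideanSpace ℝ (Fin 4) →L[ℝ] ℝ))).hasFDerivAt.comp_hasDerivAt t (hder t ht)
    exact this
  have hf : ∀ t ∈ J, HasDerivAt f (-(g.sprayCoords x (ζ t)).2 T₀) t := fun t ht => by
    have := (-(ContinuousLinearMap.apply ℝ ℝ T₀).comp (ContinuousLinearMap.snd ℝ
      (EuclideanSpace ℝ (Fin 4))
      (EuclideanSpace ℝ (Fin 4) →L[ℝ] ℝ))).hasFDerivAt.comp_hasDerivAt t (hder t ht)
    exact this
  have hτB : ∀ s ∈ J, ∀ t ∈ J, |τ t - τ s| ≤ ‖ℓ‖ * (2 * r) := fun s hs t ht => by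
    have h1 : τ t - τ s = ℓ ((ζ s).1 - (ζ t).1) := by simp only [τ, map_sub]; ring
    rw [h1]
    refine (ℓ.le_opNorm _).trans (mul_le_mul_of_nonneg_left ?_ (norm_nonneg _))
    rw [← dist_eq_norm]
    have h2 := dist_triangle_right (ζ s).1 (ζ t).1 y₀
    have h3 := hζ1 s hs
    have h4 := hζ1 t ht
    rw [Metric.mem_closedBall] at h3 h4
    linarith
  -- The derivative of `log f` is `f' / f`, and `‖q‖ ^ 2` is split into two factors, one bounded by
  -- `f` and the other by `τ'`.
  have hlog : ∀ s ∈ J, ∀ t ∈ J, |Real.log (f t) - Real.log (f s)| ≤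
      |C| / m ^ 2 * (‖ℓ‖ * (2 * r)) := fun s hs t ht => by
    refine (abs_sub_le_of_abs_deriv_le hJ' (u := fun t => Real.log (f t))
      (w := fun t => |C| / m ^ 2 * τ t)
      (fun t ht => (hf t ht).log (hf0 t ht).ne') (fun t ht => (hτ t ht).const_mul _)
      (fun t ht => ?_) hs ht).trans ?_
    · obtain ⟨e1, e2, e3⟩ := hest t ht
      rw [abs_div, abs_neg, abs_of_pos (hf0 t ht), div_le_iff₀ (hf0 t ht)]
      have e4 : (m * ‖(ζ t).2‖) * (m * ‖(ζ t).2‖) ≤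
          -ℓ (g.cometricCoords x (ζ t).1 (ζ t).2) * f t :=
        mul_le_mul e2 e1 (by positivity) ((by positivity : 0 ≤ m * ‖(ζ t).2‖).trans e2)
      calc _ ≤ C * ‖(ζ t).2‖ ^ 2 := e3
        _ ≤ |C| * ‖(ζ t).2‖ ^ 2 := by gcongr; exact le_abs_self C
        _ = |C| / m ^ 2 * ((m * ‖(ζ t).2‖) * (m * ‖(ζ t).2‖)) := by field_simp
        _ ≤ |C| / m ^ 2 * (-ℓ (g.cometricCoords x (ζ t).1 (ζ t).2) * f t) := by gcongr
        _ = _ := by ring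
    · rw [← mul_sub, abs_mul, abs_of_nonneg (by positivity)]
      gcongr
      exact hτB s hs t ht
  set L := |C| / m ^ 2 * (‖ℓ‖ * (2 * r))
  have hT₀' : 0 < ‖T₀‖ := norm_pos_iff.2 fun h => by
    have := hf0 t₁ ht₁
    simp [f, h] at this
  -- `f` is at least `exp (log (f t₁) - L)` and at most `‖q‖ * ‖T₀‖`, which bounds `‖q‖`, and with
  -- it `τ'`, from below.
  obtain ⟨δ, hδ, hδJ⟩ : ∃ δ > 0, ∀ t ∈ J, δ ≤ -ℓ (g.cometricCoords x (ζ t).1 (ζ t).2) := by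
    refine ⟨m * (Real.exp (Real.log (f t₁) - L) / ‖T₀‖), by positivity, fun t ht =>
      le_trans ?_ (hest t ht).2.1⟩
    gcongr
    rw [div_le_iff₀ hT₀']
    have h1 : Real.exp (Real.log (f t₁) - L) ≤ f t := by
      rw [← Real.le_log_iff_exp_le (hf0 t ht)]
      linarith [(abs_le.1 (hlog t₁ ht₁ t ht)).1]
    refine h1.trans ((le_abs_self _).trans ?_)
    rw [show |f t| = ‖(ζ t).2 T₀‖ by rw [Real.norm_eq_abs, abs_neg]]
    exact (ζ t).2.le_opNorm T₀
  refine ⟨⟨‖ℓ‖ * (2 * r) / δ, fun s hs t ht => ?_⟩, ?_⟩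
  · have h1 := abs_sub_le_of_abs_deriv_le hJ' (u := fun t => δ * t) (w := τ)
      (fun t ht => (hasDerivAt_id t).const_mul δ) hτ
      (fun t ht => by rw [mul_one, abs_of_pos hδ]; exact hδJ t ht) hs ht
    rw [← mul_sub, abs_mul, abs_of_pos hδ] at h1
    rw [le_div_iff₀' hδ]
    exact h1.trans (hτB s hs t ht)
  · refine ⟨(extChartAt (cotangentModel 4) z₀).symm '' (Metric.closedBall y₀ r ×ˢ
      Metric.closedBall 0 (Real.exp (Real.log (f t₁) + L) / m)),
      ((isCompact_closedBall _ _).prod (isCompact_closedBall _ _)).image_of_continuousOn ?_,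
      fun t ht => ⟨ζ t, ⟨hζ1 t ht, ?_⟩, (extChartAt (cotangentModel 4) z₀).left_inv (hsrc t ht)⟩⟩
    · refine (continuousOn_extChartAt_symm (I := cotangentModel 4) z₀).mono ?_
      rw [cotangent_target]
      exact prod_mono (fun y hy => (hball y hy).1) (subset_univ _)
    · rw [mem_closedBall_zero_iff, le_div_iff₀' hm]
      refine (hest t ht).1.trans ?_
      rw [← Real.log_le_iff_le_exp (hf0 t ht)]
      linarith [(abs_le.1 (hlog t₁ ht₁ t ht)).2]

theorem zero_mem_maximalTimes (z : CotangentBundle 4 M) : 0 ∈ maximalTimes g.spray z := by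
  obtain ⟨ε, hε, h⟩ := exists_uniform_time g.contMDiff_spray (isCompact_singleton (x := z))
  exact h z rfl ⟨by linarith, hε⟩

variable [T2Space M]

theorem isNullGeodesicOn_maximalCurve {z : CotangentBundle 4 M} (hz : z ∈ g.nullBundle) :
    g.IsNullGeodesicOn (maximalCurve g.spray z) (maximalTimes g.spray z) := by
  rw [isNullGeodesicOn_iff g (isOpen_maximalTimes z)]
  exact ⟨fun t ht => mem_nullBundle_of_flowRel (flowRel_maximalCurve ht) hz,
    isMIntegralCurveOn_maximalCurve g.contMDiff_spray z⟩

theorem add_mem_maximalTimes {z : CotangentBundle 4 M} {s t : ℝ}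
    (hs : s ∈ maximalTimes g.spray z) (ht : t ∈ maximalTimes g.spray (maximalCurve g.spray z s)) :
    s + t ∈ maximalTimes g.spray z :=
  ⟨_, (flowRel_maximalCurve hs).trans g.contMDiff_spray (flowRel_maximalCurve ht)⟩

/-- Over a trapping set the curve stays in a compact set, so from every time in `J` it can be
continued by a fixed `ε / 2` in the direction `σ`. If such continuations never left `J`, repeating
them would exceed the bound on the parameter range. -/
theorem IsTrapping.exists_add_notMem {U : Set M} (hU : g.IsTrapping U) {z : CotangentBundle 4 M}
    (hz : z ∈ g.nullBundle) {J : Set ℝ} (hJ : IsOpen J) (hJ' : J.OrdConnected) (hne : J.Nonempty)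
    (hJm : J ⊆ maximalTimes g.spray z) (h : ∀ t ∈ J, (maximalCurve g.spray z t).proj ∈ U)
    {σ : ℝ} (hσ : |σ| = 1) : ∃ s ∈ J, ∃ r > 0, s + r * σ ∈ maximalTimes g.spray z ∧ s + r * σ ∉ J := by
  obtain ⟨⟨B, hB⟩, K, hK, hKJ⟩ := hU _ J hJ hJ'
    (fun t ht => isNullGeodesicOn_maximalCurve hz t (hJm ht)) h
  obtain ⟨ε, hε, hεK⟩ := exists_uniform_time g.contMDiff_spray hK
  by_contra! hcon
  have hstep : ∀ s ∈ J, s + ε / 2 * σ ∈ J := fun s hs =>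
    hcon s hs _ (half_pos hε) (add_mem_maximalTimes (hJm hs) (hεK _ (hKJ s hs) (abs_lt.1 (by
      rw [abs_mul, hσ, mul_one, abs_of_pos (half_pos hε)]; exact half_lt_self hε))))
  obtain ⟨s, hs⟩ := hne
  have hn : ∀ n : ℕ, s + n * (ε / 2 * σ) ∈ J := fun n => by
    induction n with
    | zero => simpa using hs
    | succ n ih =>
      have := hstep _ ih
      rw [show s + n * (ε / 2 * σ) + ε / 2 * σ = s + (n + 1 : ℕ) * (ε / 2 * σ) by
        push_cast; ring] at this
      exact this
  obtain ⟨n, hn'⟩ := exists_nat_gt (B / (ε / 2))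
  have h1 := hB s hs _ (hn n)
  rw [add_sub_cancel_left, abs_mul, abs_mul, hσ, mul_one, abs_of_pos (half_pos hε),
    abs_of_nonneg n.cast_nonneg] at h1
  rw [div_lt_iff₀ (half_pos hε)] at hn'
  linarith

/-- If the base curve converged at an end of its domain, a whole tail would lie over a trapping
neighbourhood of the limit. By `IsTrapping.exists_add_notMem` the curve would leave the tail while
moving towards that end, which is impossible. -/
theorem isInextendibleCausalCurve_maximalCurve {z : CotangentBundle 4 M} (hz : z ∈ g.nullBundle) :
    g.IsInextendibleCausalCurve (fun t => (maximalCurve g.spray z t).proj)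
      (maximalTimes g.spray z) := by
  have hopen := isOpen_maximalTimes (v := g.spray) z
  have hord := ordConnected_maximalTimes (v := g.spray) z
  have : Nonempty (maximalTimes g.spray z) := ⟨⟨0, zero_mem_maximalTimes z⟩⟩
  refine ⟨hopen, hord, ⟨0, zero_mem_maximalTimes z⟩, ⟨?_, fun t ht => ?_⟩, ?_, ?_⟩
  · exact (contMDiff_proj _).comp_contMDiffOn (contMDiffOn_maximalCurve g.contMDiff_spray z)
  · have h1 := hasMFDerivAt_proj (((isMIntegralCurveOn_maximalCurve g.contMDiff_spray z) t
      ht).hasMFDerivAt (hopen.mem_nhds ht))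
    rw [h1.hasMFDerivWithinAt.mfderivWithin (hopen.uniqueMDiffWithinAt ht)]
    have h2 := (mem_nullBundle_of_flowRel (flowRel_maximalCurve ht) hz).2
    have h3 : ((1 : ℝ →L[ℝ] ℝ).smulRight (g.sharp _ (maximalCurve g.spray z t).2)) (1 : ℝ) =
      g.sharp _ (maximalCurve g.spray z t).2 := by
      rw [ContinuousLinearMap.smulRight_apply]; exact one_smul _ _
    rw [← h3] at h2
    exact h2
  · rintro ⟨x, hx⟩
    obtain ⟨U, hU, hUt⟩ := exists_isTrapping (g := g) x
    obtain ⟨t₀, ht₀⟩ := eventually_atTop.1 (hx.eventually_mem hU)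
    have hne : (maximalTimes g.spray z ∩ Ioi t₀.1).Nonempty :=
      ((frequently_gt_nhds t₀.1).and_eventually (hopen.mem_nhds t₀.2)).exists.imp
        fun _ h => ⟨h.2, h.1⟩
    obtain ⟨s, hs, r, hr, h1, h2⟩ := hUt.exists_add_notMem hz (hopen.inter isOpen_Ioi)
      (hord.inter ordConnected_Ioi) hne inter_subset_left (fun t ht => ht₀ ⟨t, ht.1⟩ ht.2.le)
      (σ := 1) (by simp)
    exact h2 ⟨h1, by have := hs.2; simp only [mem_Ioi] at this ⊢; linarith⟩
  · rintro ⟨x, hx⟩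
    obtain ⟨U, hU, hUt⟩ := exists_isTrapping (g := g) x
    obtain ⟨t₀, ht₀⟩ := eventually_atBot.1 (hx.eventually_mem hU)
    have hne : (maximalTimes g.spray z ∩ Iio t₀.1).Nonempty :=
      ((frequently_lt_nhds t₀.1).and_eventually (hopen.mem_nhds t₀.2)).exists.imp
        fun _ h => ⟨h.2, h.1⟩
    obtain ⟨s, hs, r, hr, h1, h2⟩ := hUt.exists_add_notMem hz (hopen.inter isOpen_Iio)
      (hord.inter ordConnected_Iio) hne inter_subset_left (fun t ht => ht₀ ⟨t, ht.1⟩ ht.2.le)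
      (σ := -1) (by simp)
    exact h2 ⟨h1, by have := hs.2; simp only [mem_Iio] at this ⊢; linarith⟩

end SpacetimeMetric

theorem exists_equiv_of_existsUnique {A B : Type*} {R : A → B → Prop} (h : ∀ a, ∃! b, R a b)
    (h' : ∀ b, ∃! a, R a b) : ∃ f : A ≃ B, ∀ a b, f a = b ↔ R a b := by
  choose f hf hf' using h
  choose k hk hk' using h'
  exact ⟨⟨f, k, fun a => (hk' _ _ (hf a)).symm, fun b => (hf' _ _ (hk b)).symm⟩,
    fun a b => ⟨fun e => e ▸ hf a, fun e => (hf' _ _ e).symm⟩⟩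

/-! ### Codirections over a spacelike hypersurface, and the bijection. -/

namespace SpacetimeMetric

variable {M : Type*} [TopologicalSpace M] [ChartedSpace (EuclideanSpace ℝ (Fin 4)) M]
  [IsManifold (𝓡 4) ∞ M] {g : SpacetimeMetric M}
  {S : Type*} [TopologicalSpace S] [ChartedSpace (EuclideanSpace ℝ (Fin 3)) S]
  {ι : S → M}

/-- The covector `p` at `ι x` restricts to `c` times the covector `ξ` at `x`. -/
def RestrictsTo (ι : S → M) (x : S) (p : CotangentSpace 4 (ι x)) (c : ℝ) (ξ : CotangentSpace 3 x) :
    Prop := ∀ u, p (push ι x u) = c * ξ u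

theorem finrank_tangentSpace (x : S) : Module.finrank ℝ (TangentSpace (𝓡 3) x) = 3 :=
  finrank_euclideanSpace_fin

theorem HasCodirection.proj_eq {v : CotangentBundle 3 S} {z : CotangentBundle 4 M}
    (h : g.HasCodirection ι v z) : z.proj = ι v.proj := by
  obtain ⟨_, _, _, _, _, _, _, rfl⟩ := h
  rfl

variable (hι : ∀ (x : S) (u : TangentSpace (𝓡 3) x), u ≠ 0 → 0 < g.induced ι x u u)
include hι

theorem isSpacelikeMap (x : S) : IsSpacelikeMap (g.val (ι x))
    (show TangentSpace (𝓡 3) x →L[ℝ] TangentSpace (𝓡 4) (ι x) from mfderiv (𝓡 3) (𝓡 4) ι x) :=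
  hι x

/-- A future null vector is a tangential part plus a positive multiple of the unit normal, the
multiple being the length of the tangential part. For a unit covector the multiple therefore has to
be the factor `c`, and the conormal and the extension `v̂` need not be mentioned: the restriction to
the surface says everything. -/
theorem hasCodirection_iff {x : S} {ξ : CotangentSpace 3 x}
    (hξ : (⟨x, ξ⟩ : CotangentBundle 3 S) ∈ g.unitCotangent ι) (z : CotangentBundle 4 M) :
    g.HasCodirection ι ⟨x, ξ⟩ z ↔ z ∈ g.nullBundle ∧ ∃ (p : CotangentSpace 4 (ι x)) (c : ℝ), 0 < c ∧
      RestrictsTo ι x p c ξ ∧ z = ⟨ι x, p⟩ := by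
  have hG := g.isLorentzForm (ι x)
  have hD := isSpacelikeMap hι x
  have hW := finrank_tangentSpace x
  have hT := g.future_timelike (ι x)
  obtain ⟨u, hu, hu1⟩ := hξ
  constructor
  · rintro ⟨n, w, c, hc, ⟨hn1, hn2, hn3⟩, hw, hwn, rfl⟩
    have a1 : g.val (ι x) (g.sharp (ι x) n) (g.sharp (ι x) n) = -1 := by rw [flat_sharp]; exact hn2
    have a2 : ∀ u, g.val (ι x) (g.sharp (ι x) n) (push ι x u) = 0 := fun u => by
      rw [flat_sharp]; exact hn1 u
    obtain ⟨a, s, has⟩ := hG.exists_decomposition hD hW a1 a2 (g.sharp (ι x) w)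
    have e1 : g.val (ι x) (g.sharp (ι x) w) (g.sharp (ι x) n) = 0 := by
      rw [flat_sharp]; exact hwn
    have e2 : ∀ u', g.val (ι x) (g.sharp (ι x) w) (push ι x u') = ξ u' := fun u' => by
      rw [flat_sharp]; exact hw u'
    have hs : s = 0 := by
      rw [has] at e1
      have := a2 a
      rw [hG.symm] at this
      change g.val (ι x) (push ι x a + s • g.sharp (ι x) n) (g.sharp (ι x) n) = 0 at e1
      simp only [map_add, map_smul, _root_.add_apply, _root_.smul_apply, smul_eq_mul, this, a1] at e1
      linarith
    rw [hs, zero_smul, add_zero] at has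
    have hau : a = u := IsLorentzForm.eq_of_forall_induced hD fun u' => by
      have := (e2 u').trans (hu u')
      rw [has] at this
      exact this
    rw [hau] at has
    have hX : g.sharp (ι x) (c • (w + n)) = push ι x (c • u) + c • g.sharp (ι x) n := by
      refine hG.eq_of_forall fun y => ?_
      rw [flat_sharp]
      have e3 : g.val (ι x) (push ι x u) y = w y := by
        rw [← g.flat_sharp (ι x) w, has]; rfl
      rw [push, map_smul, map_add, map_smul, map_smul, flat_sharp]
      change c * (w y + n y) = c * g.val (ι x) (push ι x u) y + c * n y
      rw [e3]; ring
    obtain ⟨b1, b2⟩ := hG.null_of_decomposition hT a1 hn3.2.2 a2 hc (u := c • u) (by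
      rw [map_smul, map_smul, map_smul, _root_.smul_apply, smul_eq_mul, smul_eq_mul]
      refine (congrArg (fun r => c * (c * r)) hu1).trans ?_
      ring)
    refine ⟨(mem_nullBundle_iff g).2 ⟨?_, ?_⟩, _, c, hc, fun u' => ?_, rfl⟩
    · change (c • (w + n)) (g.sharp (ι x) (c • (w + n))) = 0
      have := b1
      rw [← g.flat_sharp (ι x) (c • (w + n)), sharp_flat, hX]
      exact this
    · change (c • (w + n)) (g.future (ι x)) < 0
      rw [← g.flat_sharp (ι x) (c • (w + n)), hX]
      exact b2
    · change c * (w _ + n _) = _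
      rw [hw, hn1, add_zero]
  · rintro ⟨hz, p, c, hc, hp, rfl⟩
    rw [mem_nullBundle_iff] at hz
    obtain ⟨N, hN, hNT, hND⟩ := hG.exists_normal hD hW hT
    obtain ⟨a, s, has, hs, hah⟩ := hG.exists_null_decomposition hD hW hT hN hNT hND
      (X := g.sharp (ι x) p) (by rw [flat_sharp]; exact hz.1) (by rw [flat_sharp]; exact hz.2)
    have hau : a = c • u := IsLorentzForm.eq_of_forall_induced hD fun u' => by
      have e1 := hp u'
      rw [← g.flat_sharp (ι x) p, has] at e1
      rw [map_smul, map_smul, _root_.smul_apply]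
      have e2 : g.val (ι x) (push ι x a + s • N) (push ι x u') = g.val (ι x) (push ι x a) (push ι x u') := by
        simp only [map_add, map_smul, _root_.add_apply, _root_.smul_apply, smul_eq_mul]
        rw [show g.val (ι x) N (push ι x u') = 0 from hND u']
        ring
      exact e2.symm.trans (e1.trans (congrArg (c * ·) (hu u')))
    have hsc : s = c := by
      rw [hau, map_smul, map_smul, map_smul, _root_.smul_apply, smul_eq_mul, smul_eq_mul] at hah
      have := (congrArg (fun r => c * (c * r)) hu1).symm.trans hah
      nlinarith
    subst hsc
    refine ⟨g.val (ι x) N, g.val (ι x) (push ι x u), s, hs, ⟨hND, ?_, ?_⟩, fun u' => (hu u').symm, ?_, ?_⟩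
    · rw [sharp_flat]; exact hN
    · rw [sharp_flat]
      exact ⟨fun h => by rw [h] at hN; simp at hN, by linarith, hNT⟩
    · rw [sharp_flat, hG.symm]; exact hND u
    · refine congrArg (TotalSpace.mk (ι x)) ?_
      rw [← g.flat_sharp (ι x) p, has, hau]
      refine ContinuousLinearMap.ext fun y => ?_
      rw [map_smul, map_add, map_smul, map_smul, smul_add]
      rfl

theorem exists_hasCodirection {v : CotangentBundle 3 S} (hv : v ∈ g.unitCotangent ι) :
    ∃ z, g.HasCodirection ι v z := by
  obtain ⟨x, ξ⟩ := v
  have hG := g.isLorentzForm (ι x)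
  have hD := isSpacelikeMap hι x
  obtain ⟨N, hN, hNT, hND⟩ := hG.exists_normal hD (finrank_tangentSpace x) (g.future_timelike (ι x))
  obtain ⟨u, hu, hu1⟩ := id hv
  obtain ⟨h1, h2⟩ := hG.null_of_decomposition (g.future_timelike (ι x)) hN hNT hND one_pos (u := u)
    (by rw [one_pow]; exact hu1)
  refine ⟨⟨ι x, g.val (ι x) (push ι x u + (1 : ℝ) • N)⟩, (hasCodirection_iff hι hv _).2
    ⟨(mem_nullBundle_iff g).2 ⟨?_, h2⟩, _, 1, one_pos, fun u' => ?_, rfl⟩⟩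
  · change g.val (ι x) _ (g.sharp (ι x) (g.val (ι x) _)) = 0
    rw [sharp_flat]
    exact h1
  · rw [one_smul, map_add, one_mul]
    refine (congrArg₂ (· + ·) rfl (hND u')).trans ((add_zero _).trans (hu u').symm)

/-- The unit covector is the restriction of the null covector to the surface, divided by its normal
component `s`, which is also the length of the restriction. -/
theorem exists_unitCotangent_hasCodirection {x : S} {z : CotangentBundle 4 M}
    (hz : z ∈ g.nullBundle) (hx : ι x = z.proj) :
    ∃ v ∈ g.unitCotangent ι, g.HasCodirection ι v z := by
  obtain ⟨y, p⟩ := z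
  obtain rfl : ι x = y := hx
  have hG := g.isLorentzForm (ι x)
  have hD := isSpacelikeMap hι x
  have hT := g.future_timelike (ι x)
  obtain ⟨N, hN, hNT, hND⟩ := hG.exists_normal hD (finrank_tangentSpace x) hT
  have hz' := (mem_nullBundle_iff g).1 hz
  obtain ⟨a, s, has, hs, hah⟩ := hG.exists_null_decomposition hD (finrank_tangentSpace x) hT hN hNT
    hND (X := g.sharp (ι x) p) (by rw [flat_sharp]; exact hz'.1) (by rw [flat_sharp]; exact hz'.2)
  have hp : ∀ u, p (push ι x u) = g.induced ι x a u := fun u => by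
    rw [← g.flat_sharp (ι x) p, has, map_add, map_smul]
    refine (congrArg₂ (fun r t : ℝ => r + s * t) rfl (hND u)).trans ?_
    rw [mul_zero, add_zero]
    rfl
  let ξ : CotangentSpace 3 x :=
    s⁻¹ • p.comp (show TangentSpace (𝓡 3) x →L[ℝ] TangentSpace (𝓡 4) (ι x) from mfderiv (𝓡 3) (𝓡 4) ι x)
  have hξ : ∀ u, ξ u = s⁻¹ * g.induced ι x a u := fun u => congrArg (s⁻¹ * ·) (hp u)
  have hind : ∀ u, g.induced ι x (s⁻¹ • a) u = s⁻¹ * g.induced ι x a u := fun u => by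
    simp only [induced, push, map_smul, _root_.smul_apply, smul_eq_mul]
  have hv : (⟨x, ξ⟩ : CotangentBundle 3 S) ∈ g.unitCotangent ι := by
    refine ⟨s⁻¹ • a, fun w => (hξ w).trans (hind w).symm, ?_⟩
    rw [hind]
    have : g.induced ι x a (s⁻¹ • a) = s⁻¹ * s ^ 2 := by
      rw [← hah]
      simp only [induced, push, map_smul, smul_eq_mul]
    rw [this]
    field_simp
  refine ⟨_, hv, (hasCodirection_iff hι hv _).2 ⟨hz, p, s, hs, fun u => ?_, rfl⟩⟩
  rw [hξ, hp]
  field_simp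

theorem HasCodirection.eq_of_unit (hinj : Function.Injective ι) {v v' : CotangentBundle 3 S}
    {z : CotangentBundle 4 M} (hv : v ∈ g.unitCotangent ι) (hv' : v' ∈ g.unitCotangent ι)
    (h : g.HasCodirection ι v z) (h' : g.HasCodirection ι v' z) : v = v' := by
  obtain ⟨x, ξ⟩ := v
  obtain ⟨x', ξ'⟩ := v'
  obtain ⟨-, p, c, hc, hp, rfl⟩ := (hasCodirection_iff hι hv z).1 h
  obtain ⟨-, p', c', hc', hp', heq⟩ := (hasCodirection_iff hι hv' _).1 h'
  obtain rfl : x = x' := hinj (congrArg TotalSpace.proj heq)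
  obtain rfl : p = p' := TotalSpace.mk_inj.1 heq
  obtain ⟨u, hu, hu1⟩ := hv
  obtain ⟨u', hu', hu1'⟩ := hv'
  simp only at hu hu1 hu' hu1'
  have h1 : ∀ w, c * ξ w = c' * ξ' w := fun w => (hp w).symm.trans (hp' w)
  have h2 : c • u = c' • u' := IsLorentzForm.eq_of_forall_induced (isSpacelikeMap hι x) fun w => by
    have := h1 w
    rw [hu, hu'] at this
    simp only [map_smul, _root_.smul_apply, smul_eq_mul]
    exact this
  -- Proportional unit covectors: both sides of `h2` have the same length, and these lengths are `c`
  -- and `c'`.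
  have h3 : c = c' := by
    have e1 : c * ξ u = c := by rw [hu, hu1, mul_one]
    have e2 : c' * ξ' u' = c' := by rw [hu', hu1', mul_one]
    have e3 : c * (c * ξ u) = c' * (c' * ξ' u') := by
      have h4 : ξ (c • u) = ξ (c' • u') := by rw [h2]
      rw [map_smul, map_smul, smul_eq_mul, smul_eq_mul] at h4
      rw [h4, mul_left_comm, h1]
    rw [e1, e2] at e3
    nlinarith
  subst h3
  refine congrArg (TotalSpace.mk x) (ContinuousLinearMap.ext fun w => ?_)
  exact mul_left_cancel₀ hc.ne' (h1 w)

/-- A codirection is a single ray, since a future null covector is determined by its restriction to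
the surface. -/
theorem HasCodirection.exists_smul {v : CotangentBundle 3 S} {z z' : CotangentBundle 4 M}
    (hv : v ∈ g.unitCotangent ι) (h : g.HasCodirection ι v z) (h' : g.HasCodirection ι v z') :
    ∃ k : ℝ, 0 < k ∧ z' = ⟨z.proj, k • z.2⟩ := by
  obtain ⟨x, ξ⟩ := v
  obtain ⟨hz, p, c, hc, hp, rfl⟩ := (hasCodirection_iff hι hv z).1 h
  obtain ⟨hz', p', c', hc', hp', rfl⟩ := (hasCodirection_iff hι hv z').1 h'
  refine ⟨c' / c, div_pos hc' hc, congrArg (TotalSpace.mk (ι x)) ?_⟩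
  have hz2 := (mem_nullBundle_iff g).1 (g.smul_mem_nullBundle hz (div_pos hc' hc))
  have hz3 := (mem_nullBundle_iff g).1 hz'
  have key := (g.isLorentzForm (ι x)).eq_of_null_of_restrict_eq (isSpacelikeMap hι x)
    (finrank_tangentSpace x) (g.future_timelike (ι x)) (X := g.sharp (ι x) p')
    (Y := g.sharp (ι x) ((c' / c) • p)) (by rw [flat_sharp]; exact hz3.1)
    (by rw [flat_sharp]; exact hz3.2) (by rw [flat_sharp]; exact hz2.1)
    (by rw [flat_sharp]; exact hz2.2) fun u => by
      rw [flat_sharp, flat_sharp]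
      refine (hp' u).trans (Eq.trans ?_ (congrArg (c' / c * ·) (hp u)).symm)
      field_simp
  rw [← g.flat_sharp (ι x) p', key, flat_sharp]

theorem HasCodirection.mem_nullBundle {v : CotangentBundle 3 S} {z : CotangentBundle 4 M}
    (hv : v ∈ g.unitCotangent ι) (h : g.HasCodirection ι v z) : z ∈ g.nullBundle :=
  ((hasCodirection_iff hι hv z).1 h).1

theorem HasCodirection.smul {v : CotangentBundle 3 S} {z : CotangentBundle 4 M}
    (hv : v ∈ g.unitCotangent ι) (h : g.HasCodirection ι v z) {k : ℝ} (hk : 0 < k) :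
    g.HasCodirection ι v ⟨z.proj, k • z.2⟩ := by
  obtain ⟨x, ξ⟩ := v
  obtain ⟨hz, p, c, hc, hp, rfl⟩ := (hasCodirection_iff hι hv z).1 h
  refine (hasCodirection_iff hι hv _).2 ⟨g.smul_mem_nullBundle hz hk, _, k * c, mul_pos hk hc,
    fun u => ?_, rfl⟩
  exact (congrArg (k * ·) (hp u)).trans (mul_assoc _ _ _).symm

omit hι

section Joins

variable {S₁ : Type*} [TopologicalSpace S₁] [ChartedSpace (EuclideanSpace ℝ (Fin 3)) S₁]
  [IsManifold (𝓡 3) ∞ S₁] {S₂ : Type*} [TopologicalSpace S₂]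
  [ChartedSpace (EuclideanSpace ℝ (Fin 3)) S₂] [IsManifold (𝓡 3) ∞ S₂] {ι₁ : S₁ → M} {ι₂ : S₂ → M}

theorem NullGeodesicJoins.symm {v₁ : CotangentBundle 3 S₁} {v₂ : CotangentBundle 3 S₂}
    (h : g.NullGeodesicJoins ι₁ ι₂ v₁ v₂) : g.NullGeodesicJoins ι₂ ι₁ v₂ v₁ := by
  obtain ⟨η, J, h1, h2, h3, a, ha, b, hb, h4, h5⟩ := h
  exact ⟨η, J, h1, h2, h3, b, hb, a, ha, h5, h4⟩

theorem NullGeodesicJoins.exists_flowRel {v₁ : CotangentBundle 3 S₁} {v₂ : CotangentBundle 3 S₂}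
    (h : g.NullGeodesicJoins ι₁ ι₂ v₁ v₂) : ∃ z₁ t z₂, FlowRel g.spray z₁ t z₂ ∧
      g.HasCodirection ι₁ v₁ z₁ ∧ g.HasCodirection ι₂ v₂ z₂ := by
  obtain ⟨η, J, h1, h2, h3, a, ha, b, hb, h4, h5⟩ := h
  exact ⟨η a, b - a, η b, FlowRel.of_isMIntegralCurveOn h1 h2 ((isNullGeodesicOn_iff g h1).1 h3).2
    ha hb, h4, h5⟩

variable [T2Space M]

theorem maximalCurve_zero (z : CotangentBundle 4 M) : maximalCurve g.spray z 0 = z := by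
  obtain ⟨z', h⟩ := zero_mem_maximalTimes (g := g) z
  have := h.trans g.contMDiff_spray h.symm
  rw [add_neg_cancel] at this
  exact this.eq_maximalCurve g.contMDiff_spray

theorem nullGeodesicJoins_of_flowRel {v₁ : CotangentBundle 3 S₁} {v₂ : CotangentBundle 3 S₂}
    {z₁ z₂ : CotangentBundle 4 M} {t : ℝ} (hz : z₁ ∈ g.nullBundle) (h : FlowRel g.spray z₁ t z₂)
    (h₁ : g.HasCodirection ι₁ v₁ z₁) (h₂ : g.HasCodirection ι₂ v₂ z₂) :
    g.NullGeodesicJoins ι₁ ι₂ v₁ v₂ := by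
  refine ⟨maximalCurve g.spray z₁, maximalTimes g.spray z₁, isOpen_maximalTimes _,
    ordConnected_maximalTimes _, isNullGeodesicOn_maximalCurve hz, 0, zero_mem_maximalTimes _, t,
    ⟨_, h⟩, ?_, ?_⟩
  · rwa [maximalCurve_zero]
  · rwa [h.eq_maximalCurve g.contMDiff_spray]

/-- Existence: the maximal null geodesic of a lift of `v₁` meets the second surface, and the
covector there has a unit codirection. Uniqueness: any competing geodesic starts on the same ray of
covectors, so after rescaling it is part of that maximal curve and meets the surface at the same,
unique, time. -/
theorem existsUnique_nullGeodesicJoins (hι₁ : g.IsCauchySurface ι₁) (hι₂ : g.IsCauchySurface ι₂)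
    (v₁ : g.unitCotangent ι₁) : ∃! v₂ : g.unitCotangent ι₂, g.NullGeodesicJoins ι₁ ι₂ v₁ v₂ := by
  obtain ⟨z₁, hz₁⟩ := exists_hasCodirection hι₁.spacelike v₁.2
  have hnull := hz₁.mem_nullBundle hι₁.spacelike v₁.2
  obtain ⟨t, ⟨ht, ⟨x₂, hx₂⟩⟩, htu⟩ :=
    hι₂.meets_once _ _ (isInextendibleCausalCurve_maximalCurve hnull)
  have hflow := flowRel_maximalCurve ht
  obtain ⟨v₂, hv₂, hcod⟩ := exists_unitCotangent_hasCodirection hι₂.spacelike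
    (mem_nullBundle_of_flowRel hflow hnull) hx₂
  refine ⟨⟨v₂, hv₂⟩, nullGeodesicJoins_of_flowRel hnull hflow hz₁ hcod, fun v₂' h' => ?_⟩
  obtain ⟨z, t', z', hflow', hz, hz'⟩ := h'.exists_flowRel
  obtain ⟨k, hk, hkz⟩ := hz.exists_smul hι₁.spacelike v₁.2 hz₁
  have hflow'' := flowRel_smul hk hflow'
  rw [← hkz] at hflow''
  have hz'' := hz'.smul hι₂.spacelike v₂'.2 hk
  have hmax := hflow''.eq_maximalCurve g.contMDiff_spray
  have htt : t' / k = t := htu _ ⟨⟨_, hflow''⟩, by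
    simp only [hmax]
    exact hz''.proj_eq ▸ mem_range_self _⟩
  rw [← hmax, htt] at hz''
  exact Subtype.ext (hz''.eq_of_unit hι₂.spacelike hι₂.isSmoothEmbedding.isEmbedding.injective
    v₂'.2 hv₂ hcod)

theorem exists_equiv_nullGeodesicJoins (hι₁ : g.IsCauchySurface ι₁) (hι₂ : g.IsCauchySurface ι₂) :
    ∃ f : g.unitCotangent ι₁ ≃ g.unitCotangent ι₂,
      ∀ v₁ v₂, f v₁ = v₂ ↔ g.NullGeodesicJoins ι₁ ι₂ v₁ v₂ :=
  exists_equiv_of_existsUnique (existsUnique_nullGeodesicJoins hι₁ hι₂) fun v₂ =>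
    (existsUnique_congr fun _ => ⟨NullGeodesicJoins.symm, NullGeodesicJoins.symm⟩).1
      (existsUnique_nullGeodesicJoins hι₂ hι₁ v₂)

end Joins

end SpacetimeMetric

/-! ### Explicit formulas for null lifts and unit restrictions, and their smoothness. -/

section NormalLift

variable {V : Type*} [NormedAddCommGroup V] [NormedSpace ℝ V]
  {W : Type*} [NormedAddCommGroup W] [NormedSpace ℝ W]

/-- The form induced by `G` along `D`. -/
noncomputable def inducedForm (G : V →L[ℝ] V →L[ℝ] ℝ) (D : W →L[ℝ] V) : W →L[ℝ] W →L[ℝ] ℝ :=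
  ((ContinuousLinearMap.compL ℝ W V ℝ).flip D).comp (G.comp D)

theorem inducedForm_apply (G : V →L[ℝ] V →L[ℝ] ℝ) (D : W →L[ℝ] V) (u w : W) :
    inducedForm G D u w = G (D u) (D w) := rfl

/-- The unit future normal of the range of `D`. -/
noncomputable def normalVec (G : V →L[ℝ] V →L[ℝ] ℝ) (D : W →L[ℝ] V) (T : V) : V :=
  (√(-G (T - D ((inducedForm G D).inverse ((G T).comp D)))
    (T - D ((inducedForm G D).inverse ((G T).comp D)))))⁻¹ •
      (T - D ((inducedForm G D).inverse ((G T).comp D)))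

/-- The restriction of `q` along `D`, normalised to have unit length. -/
noncomputable def unitRestrict (G : V →L[ℝ] V →L[ℝ] ℝ) (D : W →L[ℝ] V) (q : V →L[ℝ] ℝ) : W →L[ℝ] ℝ :=
  (√(q (D ((inducedForm G D).inverse (q.comp D)))))⁻¹ • q.comp D

/-- The future null covector that restricts along `D` to the unit covector `ξ`. -/
noncomputable def nullLift (G : V →L[ℝ] V →L[ℝ] ℝ) (D : W →L[ℝ] V) (T : V) (ξ : W →L[ℝ] ℝ) :
    V →L[ℝ] ℝ :=
  G (D ((inducedForm G D).inverse ξ) + normalVec G D T)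

variable {G : V →L[ℝ] V →L[ℝ] ℝ} {D : W →L[ℝ] V} {T : V} (hD : IsSpacelikeMap G D)
  (hW : Module.finrank ℝ W = 3)
include hD hW

theorem isInvertible_inducedForm : (inducedForm G D).IsInvertible := by
  have : FiniteDimensional ℝ W := Module.finite_of_finrank_pos (by omega)
  have hrank : Module.finrank ℝ W = Module.finrank ℝ (W →L[ℝ] ℝ) := by
    rw [← (LinearMap.toContinuousLinearMap (𝕜 := ℝ) (E := W) (F' := ℝ)).finrank_eq]
    exact (Subspace.dual_finrank_eq).symm
  have hinj : Function.Injective (inducedForm G D).toLinearMap := fun v w h =>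
    IsLorentzForm.eq_of_forall_induced hD fun x =>
      DFunLike.congr_fun (show inducedForm G D v = inducedForm G D w from h) x
  exact ⟨(LinearEquiv.ofInjectiveOfFinrankEq _ hinj hrank).toContinuousLinearEquiv,
    by ext1 v; rfl⟩

theorem inducedForm_inverse (ξ : W →L[ℝ] ℝ) (w : W) :
    G (D ((inducedForm G D).inverse ξ)) (D w) = ξ w :=
  DFunLike.congr_fun ((isInvertible_inducedForm hD hW).self_apply_inverse ξ) w

theorem inducedForm_inverse_eq {ξ : W →L[ℝ] ℝ} {u : W} (h : ∀ w, ξ w = G (D u) (D w)) :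
    (inducedForm G D).inverse ξ = u :=
  IsLorentzForm.eq_of_forall_induced hD fun w => by rw [inducedForm_inverse hD hW, h]

variable (hG : IsLorentzForm G)
include hG

/-- The subtracted term is the tangential part of `T`. The remaining normal component is positive
because `T` and `N` lie in the same half cone. -/
theorem exists_sub_eq_smul_normal (hT : G T T < 0) : ∃ (N : V) (s : ℝ), 0 < s ∧ G N N = -1 ∧
    G N T < 0 ∧ (∀ u, G N (D u) = 0) ∧ T - D ((inducedForm G D).inverse ((G T).comp D)) = s • N := by
  obtain ⟨N, hN, hNT, hND⟩ := hG.exists_normal hD hW hT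
  obtain ⟨a, s, has⟩ := hG.exists_decomposition hD hW hN hND T
  refine ⟨N, s, ?_, hN, hNT, hND, ?_⟩
  · rw [has, map_add, map_smul, hND, hN, smul_eq_mul] at hNT
    linarith
  · rw [inducedForm_inverse_eq hD hW (u := a) fun w => ?_]
    · exact sub_eq_iff_eq_add'.2 has
    · change G T (D w) = _
      conv_lhs => rw [has]
      simp [hND]

theorem normalVec_spec (hT : G T T < 0) :
    G (normalVec G D T) (normalVec G D T) = -1 ∧ G (normalVec G D T) T < 0 ∧
      ∀ u, G (normalVec G D T) (D u) = 0 := by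
  obtain ⟨N, s, hs, hN, hNT, hND, h⟩ := exists_sub_eq_smul_normal hD hW hG hT
  have : normalVec G D T = N := by
    have h1 : -G (s • N) (s • N) = s ^ 2 := by
      simp only [map_smul, _root_.smul_apply, smul_eq_mul, hN]; ring
    rw [normalVec, h, h1, Real.sqrt_sq hs.le, smul_smul, inv_mul_cancel₀ hs.ne', one_smul]
  rw [this]
  exact ⟨hN, hNT, hND⟩

/-- The hypothesis on `ξ` says that its metric dual has unit length; adding the unit normal to that
dual gives a null vector. -/
theorem nullLift_spec (hT : G T T < 0) {ξ : W →L[ℝ] ℝ}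
    (hξ : ξ ((inducedForm G D).inverse ξ) = 1) :
    ∃ X, nullLift G D T ξ = G X ∧ G X X = 0 ∧ G X T < 0 ∧ ∀ w, G X (D w) = ξ w := by
  obtain ⟨hN, hNT, hND⟩ := normalVec_spec hD hW hG hT
  have h := hG.null_of_decomposition hT hN hNT hND one_pos (u := (inducedForm G D).inverse ξ)
    (by rw [inducedForm_inverse hD hW, hξ, one_pow])
  rw [one_smul] at h
  refine ⟨_, rfl, h.1, h.2, fun w => ?_⟩
  rw [map_add, _root_.add_apply, inducedForm_inverse hD hW, hND, add_zero]

/-- The quantity under the square root is the squared length of the tangential part of `X`, which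
for a null vector is the squared normal component. It is positive, which makes the normalisation
well defined and smooth. -/
theorem unitRestrict_spec (hT : G T T < 0) {X : V} (hX : G X X = 0) (hXT : G X T < 0) :
    0 < G X (D ((inducedForm G D).inverse ((G X).comp D))) ∧
    unitRestrict G D (G X) ((inducedForm G D).inverse (unitRestrict G D (G X))) = 1 ∧
      ∃ c, 0 < c ∧ ∀ w, G X (D w) = c * unitRestrict G D (G X) w := by
  obtain ⟨N, hN, hNT, hND⟩ := hG.exists_normal hD hW hT
  obtain ⟨u, s, hus, hs, hu⟩ := hG.exists_null_decomposition hD hW hT hN hNT hND hX hXT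
  have h0 : ∀ w, G X (D w) = G (D u) (D w) := fun w => by rw [hus]; simp [hND]
  have h1 : (inducedForm G D).inverse ((G X).comp D) = u := inducedForm_inverse_eq hD hW h0
  have h2 : unitRestrict G D (G X) = s⁻¹ • (G X).comp D := by
    rw [unitRestrict, h1, h0, hu, Real.sqrt_sq hs.le]
  refine ⟨by rw [h1, h0, hu]; positivity, ?_, s, hs, fun w => ?_⟩
  · rw [h2, map_smul, h1, map_smul]
    change s⁻¹ * (s⁻¹ * G X (D u)) = 1
    rw [h0, hu]
    field_simp
  · rw [h2]
    change _ = s * (s⁻¹ * G X (D w))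
    field_simp

end NormalLift

section NormalLiftSmooth

variable {V : Type*} [NormedAddCommGroup V] [NormedSpace ℝ V]
  {W : Type*} [NormedAddCommGroup W] [NormedSpace ℝ W] [FiniteDimensional ℝ W]
  {X : Type*} [NormedAddCommGroup X] [NormedSpace ℝ X]
  {G : X → V →L[ℝ] V →L[ℝ] ℝ} {D : X → W →L[ℝ] V} {T : X → V} {ξ : X → W →L[ℝ] ℝ}
  {q : X → V →L[ℝ] ℝ} {x : X}

set_option synthInstance.maxHeartbeats 200000 in
theorem ContDiffAt.inducedForm_inverse (hGx : ContDiffAt ℝ ∞ G x) (hDx : ContDiffAt ℝ ∞ D x)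
    (hD : IsSpacelikeMap (G x) (D x)) (hW : Module.finrank ℝ W = 3) :
    ContDiffAt ℝ ∞ (fun x => (inducedForm (G x) (D x)).inverse) x := by
  have h0 : ContDiff ℝ ∞ (fun p : (V →L[ℝ] V →L[ℝ] ℝ) × (W →L[ℝ] V) => inducedForm p.1 p.2) := by
    refine contDiff_clm_apply_iff.2 fun u => contDiff_clm_apply_iff.2 fun w => ?_
    simp only [inducedForm_apply]
    exact (contDiff_fst.clm_apply (contDiff_snd.clm_apply contDiff_const)).clm_apply
      (contDiff_snd.clm_apply contDiff_const)
  have h1 : ContDiffAt ℝ ∞ (fun x => inducedForm (G x) (D x)) x :=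
    h0.contDiffAt.comp x (hGx.prodMk hDx)
  exact ((isInvertible_inducedForm hD hW).contDiffAt_map_inverse).comp x h1

theorem ContDiffAt.nullLift (hGx : ContDiffAt ℝ ∞ G x) (hDx : ContDiffAt ℝ ∞ D x)
    (hTx : ContDiffAt ℝ ∞ T x) (hξx : ContDiffAt ℝ ∞ ξ x)
    (hD : IsSpacelikeMap (G x) (D x)) (hW : Module.finrank ℝ W = 3) (hG : IsLorentzForm (G x))
    (hT : G x (T x) (T x) < 0) :
    ContDiffAt ℝ ∞ (fun x => nullLift (G x) (D x) (T x) (ξ x)) x := by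
  have hI := hGx.inducedForm_inverse hDx hD hW
  have hN : ContDiffAt ℝ ∞ (fun x => T x - D x ((inducedForm (G x) (D x)).inverse
      ((G x (T x)).comp (D x)))) x :=
    hTx.sub (hDx.clm_apply (hI.clm_apply ((hGx.clm_apply hTx).clm_comp hDx)))
  have hpos : 0 < -G x (T x - D x ((inducedForm (G x) (D x)).inverse ((G x (T x)).comp (D x))))
      (T x - D x ((inducedForm (G x) (D x)).inverse ((G x (T x)).comp (D x)))) := by
    obtain ⟨N, s, hs, hN, -, -, h⟩ := exists_sub_eq_smul_normal hD hW hG hT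
    rw [h, map_smul, map_smul, _root_.smul_apply, hN, smul_eq_mul, smul_eq_mul]
    nlinarith
  have hs := ((hGx.clm_apply hN).clm_apply hN).neg.sqrt hpos.ne' |>.inv (Real.sqrt_ne_zero'.2 hpos)
  exact hGx.clm_apply ((hDx.clm_apply (hI.clm_apply hξx)).add (hs.smul hN))

theorem ContDiffAt.unitRestrict (hGx : ContDiffAt ℝ ∞ G x) (hDx : ContDiffAt ℝ ∞ D x)
    (hqx : ContDiffAt ℝ ∞ q x)
    (hD : IsSpacelikeMap (G x) (D x)) (hW : Module.finrank ℝ W = 3)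
    (hq : 0 < q x (D x ((inducedForm (G x) (D x)).inverse ((q x).comp (D x))))) :
    ContDiffAt ℝ ∞ (fun x => unitRestrict (G x) (D x) (q x)) x := by
  have hI := hGx.inducedForm_inverse hDx hD hW
  have hs := ((hqx.clm_apply (hDx.clm_apply (hI.clm_apply (hqx.clm_comp hDx)))).sqrt
    hq.ne').inv (Real.sqrt_ne_zero'.2 hq)
  exact hs.smul (hqx.clm_comp hDx)

end NormalLiftSmooth

/-! ### Coordinate expressions of maps between manifolds and of the surface data. -/

section ChartMap

variable {n m : ℕ} {X : Type*} [TopologicalSpace X] [ChartedSpace (EuclideanSpace ℝ (Fin n)) X]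
  [IsManifold (𝓡 n) ∞ X] {Y : Type*} [TopologicalSpace Y]
  [ChartedSpace (EuclideanSpace ℝ (Fin m)) Y] [IsManifold (𝓡 m) ∞ Y]

/-- The map `f` read in the preferred charts at `x₀` and `f x₀`. -/
noncomputable def chartMap (m : ℕ) {Y : Type*} [TopologicalSpace Y]
    [ChartedSpace (EuclideanSpace ℝ (Fin m)) Y] (f : X → Y) (x₀ : X) (a : EuclideanSpace ℝ (Fin n)) :
    EuclideanSpace ℝ (Fin m) :=
  extChartAt (𝓡 m) (f x₀) (f ((extChartAt (𝓡 n) x₀).symm a))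

/-- The set where the coordinate expression `chartMap` is meaningful. -/
def chartMapDomain (m : ℕ) {Y : Type*} [TopologicalSpace Y]
    [ChartedSpace (EuclideanSpace ℝ (Fin m)) Y] (f : X → Y) (x₀ : X) : Set (EuclideanSpace ℝ (Fin n)) :=
  {a | a ∈ (extChartAt (𝓡 n) x₀).target ∧
    f ((extChartAt (𝓡 n) x₀).symm a) ∈ (extChartAt (𝓡 m) (f x₀)).source}

variable {f : X → Y} (hf : ContMDiff (𝓡 n) (𝓡 m) ∞ f) (x₀ : X)
include hf

omit [IsManifold (𝓡 n) ∞ X] [IsManifold (𝓡 m) ∞ Y] in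
theorem eventually_mem_chartMapDomain :
    ∀ᶠ a in 𝓝 (extChartAt (𝓡 n) x₀ x₀), a ∈ chartMapDomain m f x₀ := by
  refine Filter.Eventually.and (extChartAt_target_mem_nhds (I := 𝓡 n) x₀) ?_
  refine ContinuousAt.eventually_mem (f := fun a => f ((extChartAt (𝓡 n) x₀).symm a))
    (hf.continuous.continuousAt.comp (continuousAt_extChartAt_symm (I := 𝓡 n) x₀)) ?_
  rw [extChartAt_to_inv]
  exact extChartAt_source_mem_nhds _

variable {x₀} {a : EuclideanSpace ℝ (Fin n)} (ha : a ∈ chartMapDomain m f x₀)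
include ha

theorem contDiffAt_chartMap : ContDiffAt ℝ ∞ (chartMap m f x₀) a := by
  have h1 : ContMDiffAt 𝓘(ℝ, EuclideanSpace ℝ (Fin n)) (𝓡 n) ∞ (extChartAt (𝓡 n) x₀).symm a :=
    (contMDiffOn_extChartAt_symm x₀).contMDiffAt ((isOpen_extChartAt_target x₀).mem_nhds ha.1)
  have h2 : ContMDiffAt (𝓡 m) 𝓘(ℝ, EuclideanSpace ℝ (Fin m)) ∞ (extChartAt (𝓡 m) (f x₀))
      (f ((extChartAt (𝓡 n) x₀).symm a)) :=
    contMDiffAt_extChartAt' (by simpa using ha.2)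
  exact (h2.comp a ((hf _).comp a h1)).contDiffAt

/-- Chain rule, after inserting the preferred charts at `x` and at `f x`, in which `mfderiv` is
computed. -/
theorem fderiv_chartMap (b : EuclideanSpace ℝ (Fin n)) :
    fderiv ℝ (chartMap m f x₀) a b = chartDeriv (f x₀) (f ((extChartAt (𝓡 n) x₀).symm a))
      (mfderiv (𝓡 n) (𝓡 m) f ((extChartAt (𝓡 n) x₀).symm a)
        (chartDerivSymm x₀ ((extChartAt (𝓡 n) x₀).symm a) b)) := by
  obtain ⟨x, hx⟩ : ∃ x, x = (extChartAt (𝓡 n) x₀).symm a := ⟨_, rfl⟩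
  have hxs : x ∈ (extChartAt (𝓡 n) x₀).source := hx ▸ (extChartAt (𝓡 n) x₀).map_target ha.1
  have hax : extChartAt (𝓡 n) x₀ x = a := by rw [hx, (extChartAt (𝓡 n) x₀).right_inv ha.1]
  have hfx : f x ∈ (extChartAt (𝓡 m) (f x₀)).source := hx ▸ ha.2
  have hxx := mem_extChartAt_source (I := 𝓡 n) x
  have hff := mem_extChartAt_source (I := 𝓡 m) (f x)
  rw [← hx]
  have h1 : HasFDerivAt (extChartAt (𝓡 n) x ∘ (extChartAt (𝓡 n) x₀).symm)
      (tangentCoordChange (𝓡 n) x₀ x x) a := by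
    have := hasFDerivWithinAt_tangentCoordChange (I := 𝓡 n) (x := x₀) (y := x) (z := x) ⟨hxs, hxx⟩
    rwa [ModelWithCorners.range_eq_univ, hasFDerivWithinAt_univ, hax] at this
  have h3 : HasFDerivAt (extChartAt (𝓡 m) (f x₀) ∘ (extChartAt (𝓡 m) (f x)).symm)
      (tangentCoordChange (𝓡 m) (f x) (f x₀) (f x)) (extChartAt (𝓡 m) (f x) (f x)) := by
    have := hasFDerivWithinAt_tangentCoordChange (I := 𝓡 m) (x := f x) (y := f x₀) (z := f x)
      ⟨hff, hfx⟩
    rwa [ModelWithCorners.range_eq_univ, hasFDerivWithinAt_univ] at this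
  let L : EuclideanSpace ℝ (Fin n) →L[ℝ] EuclideanSpace ℝ (Fin m) := mfderiv (𝓡 n) (𝓡 m) f x
  have h2 : HasFDerivAt (extChartAt (𝓡 m) (f x) ∘ f ∘ (extChartAt (𝓡 n) x).symm) L
      (extChartAt (𝓡 n) x x) := by
    have : HasFDerivWithinAt (extChartAt (𝓡 m) (f x) ∘ f ∘ (extChartAt (𝓡 n) x).symm) L
      (range (𝓡 n)) (extChartAt (𝓡 n) x x) :=
        ((hf x).mdifferentiableAt (by simp)).hasMFDerivAt.2
    rwa [ModelWithCorners.range_eq_univ, hasFDerivWithinAt_univ] at this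
  have p1 : (extChartAt (𝓡 n) x ∘ (extChartAt (𝓡 n) x₀).symm) a = extChartAt (𝓡 n) x x := by
    rw [Function.comp_apply, ← hx]
  have p2 : (extChartAt (𝓡 m) (f x) ∘ f ∘ (extChartAt (𝓡 n) x).symm) (extChartAt (𝓡 n) x x) =
      extChartAt (𝓡 m) (f x) (f x) := by
    simp only [Function.comp_apply, extChartAt_to_inv]
  rw [← p2] at h3
  have h4 := h3.comp _ h2
  rw [← p1] at h4
  have h5 := h4.comp _ h1
  have h6 : chartMap m f x₀ =ᶠ[𝓝 a] ((extChartAt (𝓡 m) (f x₀) ∘ (extChartAt (𝓡 m) (f x)).symm) ∘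
      (extChartAt (𝓡 m) (f x) ∘ f ∘ (extChartAt (𝓡 n) x).symm)) ∘
      (extChartAt (𝓡 n) x ∘ (extChartAt (𝓡 n) x₀).symm) := by
    have c1 : ContinuousAt (extChartAt (𝓡 n) x₀).symm a :=
      continuousAt_extChartAt_symm'' (I := 𝓡 n) ha.1
    have e1 := c1.eventually_mem (s := (extChartAt (𝓡 n) x).source)
      (by rw [← hx]; exact extChartAt_source_mem_nhds _)
    have c2 : ContinuousAt (fun a => f ((extChartAt (𝓡 n) x₀).symm a)) a :=
      hf.continuous.continuousAt.comp c1
    have e2 := c2.eventually_mem (s := (extChartAt (𝓡 m) (f x)).source)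
      (by rw [← hx]; exact extChartAt_source_mem_nhds _)
    filter_upwards [e1, e2] with a' h1 h2
    simp only [Function.comp_apply, chartMap]
    rw [(extChartAt (𝓡 n) x).left_inv h1, (extChartAt (𝓡 m) (f x)).left_inv h2]
  rw [(h5.congr_of_eventuallyEq h6).fderiv, chartDerivSymm_eq hxs]
  exact (chartDeriv_eq hfx _).symm

end ChartMap

theorem covectorOfCoords_extChartAt {n : ℕ} {X : Type*} [TopologicalSpace X]
    [ChartedSpace (EuclideanSpace ℝ (Fin n)) X] [IsManifold (𝓡 n) ∞ X] {x₀ x : X}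
    (hx : x ∈ (extChartAt (𝓡 n) x₀).source) (q : EuclideanSpace ℝ (Fin n) →L[ℝ] ℝ) :
    covectorOfCoords x₀ (extChartAt (𝓡 n) x₀ x, q) = ⟨x, q.comp (chartDeriv x₀ x)⟩ := by
  have key : ∀ x', x' = x → (⟨x', q.comp (chartDeriv x₀ x')⟩ : CotangentBundle n X) =
      ⟨x, q.comp (chartDeriv x₀ x)⟩ := by
    rintro _ rfl; rfl
  exact key _ ((extChartAt (𝓡 n) x₀).left_inv hx)

namespace SpacetimeMetric

variable {M : Type*} [TopologicalSpace M] [ChartedSpace (EuclideanSpace ℝ (Fin 4)) M]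
  [IsManifold (𝓡 4) ∞ M] (g : SpacetimeMetric M)

theorem metricCoords_extChartAt {x₀ x : M} (hx : x ∈ (extChartAt (𝓡 4) x₀).source)
    (a b : EuclideanSpace ℝ (Fin 4)) : g.metricCoords x₀ (extChartAt (𝓡 4) x₀ x) a b =
      g.val x (chartDerivSymm x₀ x a) (chartDerivSymm x₀ x b) := by
  rw [metricCoords_apply g ((extChartAt (𝓡 4) x₀).map_source hx),
    (extChartAt (𝓡 4) x₀).left_inv hx]

variable {g}

theorem metricCoords_futureCoords_neg {x₀ : M} {y : EuclideanSpace ℝ (Fin 4)}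
    (hy : y ∈ (extChartAt (𝓡 4) x₀).target) :
    g.metricCoords x₀ y (g.futureCoords x₀ y) (g.futureCoords x₀ y) < 0 := by
  rw [metricCoords_apply g hy, futureCoords,
    chartDerivSymm_chartDeriv ((extChartAt (𝓡 4) x₀).map_target hy)]
  exact g.future_timelike _

theorem mem_nullBundle_iff_coords {z₀ z : CotangentBundle 4 M}
    (hz : z ∈ (extChartAt (cotangentModel 4) z₀).source)
    {ζ : EuclideanSpace ℝ (Fin 4) × (EuclideanSpace ℝ (Fin 4) →L[ℝ] ℝ)}
    (hζ : extChartAt (cotangentModel 4) z₀ z = ζ) : z ∈ g.nullBundle ↔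
      ζ.2 (g.cometricCoords z₀.proj ζ.1 ζ.2) = 0 ∧ ζ.2 (g.futureCoords z₀.proj ζ.1) < 0 := by
  subst hζ
  rw [mem_nullBundle_iff, apply_futureCoords hz]
  refine and_congr_left' ?_
  have h := hamiltonian_eq g hz
  rw [hamiltonian, hamiltonianCoords] at h
  rw [mul_left_cancel₀ (by norm_num) h]

section Surface

variable {S : Type*} [TopologicalSpace S] [ChartedSpace (EuclideanSpace ℝ (Fin 3)) S]
  [IsManifold (𝓡 3) ∞ S] {ι : S → M} {x₀ : S} {a : EuclideanSpace ℝ (Fin 3)}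
  (hs : ContMDiff (𝓡 3) (𝓡 4) ∞ ι) (ha : a ∈ chartMapDomain 4 ι x₀)

omit [IsManifold (𝓡 4) ∞ M] [IsManifold (𝓡 3) ∞ S] in
include ha in
theorem chartMap_mem_target : chartMap 4 ι x₀ a ∈ (extChartAt (𝓡 4) (ι x₀)).target :=
  (extChartAt (𝓡 4) (ι x₀)).map_source ha.2

include hs ha

theorem push_chartDerivSymm (b : EuclideanSpace ℝ (Fin 3)) :
    push ι ((extChartAt (𝓡 3) x₀).symm a) (chartDerivSymm x₀ ((extChartAt (𝓡 3) x₀).symm a) b) =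
      chartDerivSymm (ι x₀) (ι ((extChartAt (𝓡 3) x₀).symm a))
        (fderiv ℝ (chartMap 4 ι x₀) a b) := by
  rw [fderiv_chartMap hs ha, chartDerivSymm_chartDeriv ha.2]
  rfl

theorem induced_chartDerivSymm (b b' : EuclideanSpace ℝ (Fin 3)) :
    g.induced ι ((extChartAt (𝓡 3) x₀).symm a)
      (chartDerivSymm x₀ ((extChartAt (𝓡 3) x₀).symm a) b)
      (chartDerivSymm x₀ ((extChartAt (𝓡 3) x₀).symm a) b') =
    g.metricCoords (ι x₀) (chartMap 4 ι x₀ a) (fderiv ℝ (chartMap 4 ι x₀) a b)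
      (fderiv ℝ (chartMap 4 ι x₀) a b') := by
  rw [induced, push_chartDerivSymm hs ha, push_chartDerivSymm hs ha, chartMap,
    metricCoords_extChartAt g ha.2]

variable (hι : ∀ (x : S) (u : TangentSpace (𝓡 3) x), u ≠ 0 → 0 < g.induced ι x u u)
include hι

theorem isSpacelikeMap_coords : IsSpacelikeMap (g.metricCoords (ι x₀) (chartMap 4 ι x₀ a))
    (fderiv ℝ (chartMap 4 ι x₀) a) := fun b hb => by
  rw [← induced_chartDerivSymm hs ha]
  refine hι _ _ fun h => hb ?_
  have := chartDeriv_chartDerivSymm ((extChartAt (𝓡 3) x₀).map_target ha.1) b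
  rw [h, map_zero] at this
  exact this.symm

/-- In coordinates the unit condition is a single equation for the inverse of the induced form, the
shape required by `nullLift_spec`. -/
theorem mem_unitCotangent_iff_coords (ξ : EuclideanSpace ℝ (Fin 3) →L[ℝ] ℝ) :
    covectorOfCoords x₀ (a, ξ) ∈ g.unitCotangent ι ↔
      ξ ((inducedForm (g.metricCoords (ι x₀) (chartMap 4 ι x₀ a))
        (fderiv ℝ (chartMap 4 ι x₀) a)).inverse ξ) = 1 := by
  have hx := (extChartAt (𝓡 3) x₀).map_target ha.1
  have hD := isSpacelikeMap_coords hs ha hι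
  have hW : Module.finrank ℝ (EuclideanSpace ℝ (Fin 3)) = 3 := finrank_euclideanSpace_fin
  change (∃ u : TangentSpace (𝓡 3) ((extChartAt (𝓡 3) x₀).symm a),
    (∀ w, ξ (chartDeriv x₀ ((extChartAt (𝓡 3) x₀).symm a) w) =
      g.induced ι ((extChartAt (𝓡 3) x₀).symm a) u w) ∧
      g.induced ι ((extChartAt (𝓡 3) x₀).symm a) u u = 1) ↔ _
  constructor
  · rintro ⟨u, hu, hu1⟩
    have h1 : ∀ w, ξ w = g.metricCoords (ι x₀) (chartMap 4 ι x₀ a)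
        (fderiv ℝ (chartMap 4 ι x₀) a (chartDeriv x₀ _ u)) (fderiv ℝ (chartMap 4 ι x₀) a w) := by
      intro w
      rw [← induced_chartDerivSymm hs ha, chartDerivSymm_chartDeriv hx, ← hu,
        chartDeriv_chartDerivSymm hx]
    rw [inducedForm_inverse_eq hD hW h1, hu]
    exact hu1
  · intro h
    set b := (inducedForm (g.metricCoords (ι x₀) (chartMap 4 ι x₀ a))
        (fderiv ℝ (chartMap 4 ι x₀) a)).inverse ξ with hb
    have h1 : ∀ w, ξ (chartDeriv x₀ ((extChartAt (𝓡 3) x₀).symm a) w) =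
      g.induced ι ((extChartAt (𝓡 3) x₀).symm a) (chartDerivSymm x₀ _ b) w := fun w => by
      conv_rhs => rw [← chartDerivSymm_chartDeriv hx w]
      rw [induced_chartDerivSymm hs ha, hb, inducedForm_inverse hD hW]
    refine ⟨chartDerivSymm x₀ _ b, h1, (h1 _).symm.trans ?_⟩
    rw [chartDeriv_chartDerivSymm hx, h]

theorem hasCodirection_nullLift {ξ : EuclideanSpace ℝ (Fin 3) →L[ℝ] ℝ}
    (hξ : covectorOfCoords x₀ (a, ξ) ∈ g.unitCotangent ι) :
    g.HasCodirection ι (covectorOfCoords x₀ (a, ξ)) (covectorOfCoords (ι x₀) (chartMap 4 ι x₀ a,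
      nullLift (g.metricCoords (ι x₀) (chartMap 4 ι x₀ a)) (fderiv ℝ (chartMap 4 ι x₀) a)
        (g.futureCoords (ι x₀) (chartMap 4 ι x₀ a)) ξ)) := by
  have hx := (extChartAt (𝓡 3) x₀).map_target ha.1
  have hD := isSpacelikeMap_coords hs ha hι
  have hy := chartMap_mem_target ha
  have hW : Module.finrank ℝ (EuclideanSpace ℝ (Fin 3)) = 3 := finrank_euclideanSpace_fin
  obtain ⟨X, hX, hX0, hXT, hXD⟩ := nullLift_spec hD hW (g.isLorentzForm_metricCoords hy)
    (metricCoords_futureCoords_neg hy) ((mem_unitCotangent_iff_coords hs ha hι ξ).1 hξ)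
  rw [hX]
  refine (hasCodirection_iff hι hξ _).2 ⟨?_, _, 1, one_pos, ?_,
    covectorOfCoords_extChartAt ha.2 _⟩
  · let z₀ : CotangentBundle 4 M := ⟨ι x₀, 0⟩
    have ht : (chartMap 4 ι x₀ a, g.metricCoords (ι x₀) (chartMap 4 ι x₀ a) X) ∈
        (extChartAt (cotangentModel 4) z₀).target := by
      rw [cotangent_target]; exact ⟨hy, mem_univ _⟩
    have h1 := cotangent_extChartAt_symm z₀
      (ζ := (chartMap 4 ι x₀ a, g.metricCoords (ι x₀) (chartMap 4 ι x₀ a) X)) hy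
    change covectorOfCoords z₀.proj _ ∈ _
    rw [← h1, mem_nullBundle_iff_coords ((extChartAt (cotangentModel 4) z₀).map_target ht)
      ((extChartAt (cotangentModel 4) z₀).right_inv ht)]
    refine ⟨?_, hXT⟩
    change g.metricCoords (ι x₀) (chartMap 4 ι x₀ a) X (g.cometricCoords (ι x₀) _ _) = 0
    rw [cometricCoords_metricCoords hy]
    exact hX0
  · intro u
    change g.metricCoords (ι x₀) (chartMap 4 ι x₀ a) X
      (chartDeriv (ι x₀) (ι ((extChartAt (𝓡 3) x₀).symm a))
        (push ι ((extChartAt (𝓡 3) x₀).symm a) u)) =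
      1 * ξ (chartDeriv x₀ ((extChartAt (𝓡 3) x₀).symm a) u)
    conv_lhs => rw [← chartDerivSymm_chartDeriv hx u]
    rw [push_chartDerivSymm hs ha, chartDeriv_chartDerivSymm ha.2, hXD, one_mul]

/-- Counterpart of `hasCodirection_nullLift`: it recovers the unit covector from a null covector.
The positivity clause keeps the square root in `unitRestrict` away from its singularity. -/
theorem unitRestrict_hasCodirection {z₀ z : CotangentBundle 4 M} (hz₀ : z₀.proj = ι x₀)
    (hz : z ∈ g.nullBundle) (hzx : z.proj = ι ((extChartAt (𝓡 3) x₀).symm a))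
    {q : EuclideanSpace ℝ (Fin 4) →L[ℝ] ℝ} (hq : (extChartAt (cotangentModel 4) z₀ z).2 = q) :
    0 < q (fderiv ℝ (chartMap 4 ι x₀) a ((inducedForm (g.metricCoords (ι x₀) (chartMap 4 ι x₀ a))
      (fderiv ℝ (chartMap 4 ι x₀) a)).inverse (q.comp (fderiv ℝ (chartMap 4 ι x₀) a)))) ∧
    covectorOfCoords x₀ (a, unitRestrict (g.metricCoords (ι x₀) (chartMap 4 ι x₀ a))
      (fderiv ℝ (chartMap 4 ι x₀) a) q) ∈ g.unitCotangent ι ∧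
    g.HasCodirection ι (covectorOfCoords x₀ (a, unitRestrict
      (g.metricCoords (ι x₀) (chartMap 4 ι x₀ a)) (fderiv ℝ (chartMap 4 ι x₀) a) q)) z := by
  obtain ⟨m₀, p₀⟩ := z₀
  obtain ⟨m, p⟩ := z
  obtain rfl : m₀ = ι x₀ := hz₀
  obtain rfl : m = ι ((extChartAt (𝓡 3) x₀).symm a) := hzx
  have hx := (extChartAt (𝓡 3) x₀).map_target ha.1
  have hD := isSpacelikeMap_coords hs ha hι
  have hy := chartMap_mem_target ha
  have hW : Module.finrank ℝ (EuclideanSpace ℝ (Fin 3)) = 3 := finrank_euclideanSpace_fin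
  have hzs : (⟨ι ((extChartAt (𝓡 3) x₀).symm a), p⟩ : CotangentBundle 4 M) ∈
      (extChartAt (cotangentModel 4) (⟨ι x₀, p₀⟩ : CotangentBundle 4 M)).source :=
    mem_cotangent_source.2 ha.2
  have hζ : extChartAt (cotangentModel 4) (⟨ι x₀, p₀⟩ : CotangentBundle 4 M)
      ⟨ι ((extChartAt (𝓡 3) x₀).symm a), p⟩ = (chartMap 4 ι x₀ a, q) := by
    rw [← hq, cotangent_extChartAt]
    rfl
  have hqp : q = p.comp (chartDerivSymm (ι x₀) (ι ((extChartAt (𝓡 3) x₀).symm a))) := by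
    rw [← hq, cotangent_extChartAt]
  obtain ⟨hn1, hn2⟩ := (mem_nullBundle_iff_coords hzs hζ).1 hz
  have hK : g.metricCoords (ι x₀) (chartMap 4 ι x₀ a)
      (g.cometricCoords (ι x₀) (chartMap 4 ι x₀ a) q) = q := metricCoords_cometricCoords hy q
  have h := unitRestrict_spec hD hW (g.isLorentzForm_metricCoords hy)
    (metricCoords_futureCoords_neg hy) (X := g.cometricCoords (ι x₀) (chartMap 4 ι x₀ a) q)
    (by rw [hK]; exact hn1) (by rw [hK]; exact hn2)
  rw [hK] at h
  obtain ⟨h1, h2, c, hc, h3⟩ := h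
  have hu := (mem_unitCotangent_iff_coords hs ha hι _).2 h2
  refine ⟨h1, hu, (hasCodirection_iff hι hu _).2 ⟨hz, p, c, hc, fun u => ?_, rfl⟩⟩
  have h4 := h3 (chartDeriv x₀ ((extChartAt (𝓡 3) x₀).symm a) u)
  refine Eq.trans ?_ h4
  conv_lhs => rw [← chartDerivSymm_chartDeriv hx u]
  rw [hqp]
  exact congrArg p (push_chartDerivSymm hs ha _)

end Surface

end SpacetimeMetric

/-! ### Smooth dependence of the intersection with a transversal hypersurface. -/

/-- A family of curves `t ↦ ρ (t, ζ)` that meets a hypersurface `c` transversally at `t = 0`,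
`ζ = ζ₀` meets it smoothly in `ζ`. -/
theorem exists_smooth_transversal {A E Z : Type*} [NormedAddCommGroup A] [NormedSpace ℝ A]
    [FiniteDimensional ℝ A] [NormedAddCommGroup E] [NormedSpace ℝ E] [FiniteDimensional ℝ E]
    [NormedAddCommGroup Z] [NormedSpace ℝ Z] [FiniteDimensional ℝ Z]
    {c : A → E} {ρ : ℝ × Z → E} {a₀ : A} {ζ₀ : Z} (hc : ∀ᶠ a in 𝓝 a₀, ContDiffAt ℝ ∞ c a)
    (hρ : ∀ᶠ p in 𝓝 (0, ζ₀), ContDiffAt ℝ ∞ ρ p) (h0 : c a₀ = ρ (0, ζ₀)) {X : E}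
    (hX : HasDerivAt (fun t => ρ (t, ζ₀)) X 0)
    (htrans : ∀ (α : A) (t : ℝ), fderiv ℝ c a₀ α = t • X → α = 0 ∧ t = 0)
    (hdim : Module.finrank ℝ A + 1 = Module.finrank ℝ E) :
    ∃ (α : Z → A) (τ : Z → ℝ), α ζ₀ = a₀ ∧ τ ζ₀ = 0 ∧ ∀ᶠ ζ in 𝓝 ζ₀,
      ContDiffAt ℝ ∞ α ζ ∧ ContDiffAt ℝ ∞ τ ζ ∧ c (α ζ) = ρ (τ ζ, ζ) := by
  have := FiniteDimensional.complete ℝ A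
  have := FiniteDimensional.complete ℝ Z
  let p₀ : (A × ℝ) × Z := ((a₀, 0), ζ₀)
  -- Intersections are zeros of the first component, with `ζ` carried along as a parameter. By
  -- transversality the derivative of `Ψ` is injective, and the dimensions agree, so the inverse
  -- function theorem applies.
  let Ψ : (A × ℝ) × Z → E × Z := fun P => (c P.1.1 - ρ (P.1.2, P.2), P.2)
  have c1 : Continuous fun P : (A × ℝ) × Z => P.1.1 := by fun_prop
  have c2 : Continuous fun P : (A × ℝ) × Z => (P.1.2, P.2) := by fun_prop
  have hΨ : ∀ᶠ P in 𝓝 p₀, ContDiffAt ℝ ∞ Ψ P := by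
    filter_upwards [(c1.continuousAt (x := p₀)).eventually hc,
      (c2.continuousAt (x := p₀)).eventually hρ]
      with P h1 h2
    have d1 : ContDiffAt ℝ ∞ (fun P : (A × ℝ) × Z => P.1.1) P := by fun_prop
    have d2 : ContDiffAt ℝ ∞ (fun P : (A × ℝ) × Z => (P.1.2, P.2)) P := by fun_prop
    exact ((ContDiffAt.comp P h1 d1).sub (ContDiffAt.comp P h2 d2)).prodMk contDiffAt_snd
  have hc' := (hc.self_of_nhds.differentiableAt (by simp)).hasFDerivAt
  have hρ' := (hρ.self_of_nhds.differentiableAt (by simp)).hasFDerivAt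
  let Q := fderiv ℝ ρ (0, ζ₀)
  have hQ : Q (1, 0) = X := by
    have h1 : HasDerivAt (fun t : ℝ => (t, ζ₀)) ((1 : ℝ), (0 : Z)) 0 :=
      (hasDerivAt_id (0 : ℝ)).prodMk (hasDerivAt_const 0 ζ₀)
    exact (HasFDerivAt.comp_hasDerivAt (f := fun t : ℝ => (t, ζ₀)) 0 hρ' h1).unique hX
  let f' : (A × ℝ) × Z →L[ℝ] E × Z :=
    (((fderiv ℝ c a₀).comp ((ContinuousLinearMap.fst ℝ A ℝ).comp (ContinuousLinearMap.fst ℝ _ Z))) -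
      Q.comp (((ContinuousLinearMap.snd ℝ A ℝ).comp (ContinuousLinearMap.fst ℝ _ Z)).prod
        (ContinuousLinearMap.snd ℝ _ Z))).prod (ContinuousLinearMap.snd ℝ _ Z)
  have hf' : HasFDerivAt Ψ f' p₀ := by
    have e1 : HasFDerivAt (fun P : (A × ℝ) × Z => P.1.1)
        ((ContinuousLinearMap.fst ℝ A ℝ).comp (ContinuousLinearMap.fst ℝ _ Z)) p₀ :=
      ((ContinuousLinearMap.fst ℝ A ℝ).comp (ContinuousLinearMap.fst ℝ _ Z)).hasFDerivAt
    have e2 : HasFDerivAt (fun P : (A × ℝ) × Z => (P.1.2, P.2))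
        (((ContinuousLinearMap.snd ℝ A ℝ).comp (ContinuousLinearMap.fst ℝ _ Z)).prod
        (ContinuousLinearMap.snd ℝ _ Z)) p₀ :=
      (((ContinuousLinearMap.snd ℝ A ℝ).comp (ContinuousLinearMap.fst ℝ _ Z)).prod
        (ContinuousLinearMap.snd ℝ _ Z)).hasFDerivAt
    exact ((HasFDerivAt.comp p₀ hc' e1).sub (HasFDerivAt.comp p₀ hρ' e2)).prodMk hasFDerivAt_snd
  have hinj : Function.Injective f'.toLinearMap := by
    rw [injective_iff_map_eq_zero]
    rintro ⟨⟨α, t⟩, ζ⟩ h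
    have h1 : fderiv ℝ c a₀ α - Q (t, ζ) = 0 := congrArg Prod.fst h
    obtain rfl : ζ = 0 := congrArg Prod.snd h
    have h2 : ((t, 0) : ℝ × Z) = t • (1, 0) := by simp
    rw [h2, map_smul, hQ, sub_eq_zero] at h1
    obtain ⟨rfl, rfl⟩ := htrans α t h1
    rfl
  have hrank : Module.finrank ℝ ((A × ℝ) × Z) = Module.finrank ℝ (E × Z) := by
    rw [Module.finrank_prod, Module.finrank_prod, Module.finrank_prod, Module.finrank_self, hdim]
  let e := (LinearEquiv.ofInjectiveOfFinrankEq _ hinj hrank).toContinuousLinearEquiv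
  have he : (e : (A × ℝ) × Z →L[ℝ] E × Z) = f' := ContinuousLinearMap.ext fun _ => rfl
  rw [← he] at hf'
  obtain ⟨G, hG0, hG⟩ := exists_smooth_localInverse hΨ hf'
  have hp₀ : Ψ p₀ = (0, ζ₀) := by simp only [Ψ, p₀, h0, sub_self]
  rw [hp₀] at hG0 hG
  refine ⟨fun ζ => (G (0, ζ)).1.1, fun ζ => (G (0, ζ)).1.2, congrArg (fun P => P.1.1) hG0,
    congrArg (fun P => P.1.2) hG0, ?_⟩
  have hcont : Continuous fun ζ : Z => ((0 : E), ζ) := by fun_prop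
  filter_upwards [(hcont.continuousAt (x := ζ₀)).eventually hG] with ζ ⟨h1, h2⟩
  have d : ContDiffAt ℝ ∞ (fun ζ : Z => ((0 : E), ζ)) ζ := by fun_prop
  have h3 := ContDiffAt.comp ζ h1 d
  have h4 : c (G (0, ζ)).1.1 - ρ ((G (0, ζ)).1.2, (G (0, ζ)).2) = 0 := congrArg Prod.fst h2
  have h5 : (G (0, ζ)).2 = ζ := congrArg Prod.snd h2
  rw [h5, sub_eq_zero] at h4
  exact ⟨h3.fst.fst, h3.fst.snd, h4⟩

theorem contMDiffAt_covectorOfCoords {n : ℕ} {X : Type*} [TopologicalSpace X]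
    [ChartedSpace (EuclideanSpace ℝ (Fin n)) X] [IsManifold (𝓡 n) ∞ X] (x₀ : X)
    {ζ : EuclideanSpace ℝ (Fin n) × (EuclideanSpace ℝ (Fin n) →L[ℝ] ℝ)}
    (hζ : ζ.1 ∈ (extChartAt (𝓡 n) x₀).target) :
    ContMDiffAt 𝓘(ℝ, EuclideanSpace ℝ (Fin n) × (EuclideanSpace ℝ (Fin n) →L[ℝ] ℝ))
      (cotangentModel n) ∞ (covectorOfCoords x₀) ζ := by
  let z₀ : CotangentBundle n X := ⟨x₀, 0⟩
  have hopen := isOpen_extChartAt_target (I := cotangentModel n) z₀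
  have ht : ζ ∈ (extChartAt (cotangentModel n) z₀).target := by
    rw [cotangent_target]; exact ⟨hζ, mem_univ _⟩
  refine ((contMDiffOn_extChartAt_symm (I := cotangentModel n) (n := ∞) z₀).contMDiffAt
    (hopen.mem_nhds ht)).congr_of_eventuallyEq ?_
  filter_upwards [hopen.mem_nhds ht] with ζ' hζ'
  rw [cotangent_target] at hζ'
  exact (cotangent_extChartAt_symm z₀ hζ'.1).symm

namespace SpacetimeMetric

variable {M : Type*} [TopologicalSpace M] [ChartedSpace (EuclideanSpace ℝ (Fin 4)) M]
  [IsManifold (𝓡 4) ∞ M] {g : SpacetimeMetric M}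
  {S : Type*} [TopologicalSpace S] [ChartedSpace (EuclideanSpace ℝ (Fin 3)) S]
  [IsManifold (𝓡 3) ∞ S] {ι : S → M}
  (hs : ContMDiff (𝓡 3) (𝓡 4) ∞ ι)
  (hι : ∀ (x : S) (u : TangentSpace (𝓡 3) x), u ≠ 0 → 0 < g.induced ι x u u)
include hs

section

variable {x₀ : S} {a : EuclideanSpace ℝ (Fin 3)} (ha : a ∈ chartMapDomain 4 ι x₀)
include ha

theorem contDiffAt_fderiv_chartMap : ContDiffAt ℝ ∞ (fderiv ℝ (chartMap 4 ι x₀)) a :=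
  (contDiffAt_chartMap hs ha).fderiv_right (by simp)

theorem contDiffAt_metricCoords_chartMap :
    ContDiffAt ℝ ∞ (fun a => g.metricCoords (ι x₀) (chartMap 4 ι x₀ a)) a :=
  (g.contDiffAt_metricCoords (ι x₀) (chartMap_mem_target ha)).comp a (contDiffAt_chartMap hs ha)

theorem contDiffAt_futureCoords_chartMap :
    ContDiffAt ℝ ∞ (fun a => g.futureCoords (ι x₀) (chartMap 4 ι x₀ a)) a :=
  (g.contDiffAt_futureCoords (ι x₀) (chartMap_mem_target ha)).comp a (contDiffAt_chartMap hs ha)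

end

include hι

/-- The null lift of unit covectors extends to a smooth map. -/
theorem exists_smooth_codirection (v₀ : CotangentBundle 3 S) :
    ∃ A : CotangentBundle 3 S → CotangentBundle 4 M, ∀ᶠ v in 𝓝 v₀,
      ContMDiffAt (cotangentModel 3) (cotangentModel 4) ∞ A v ∧
        (v ∈ g.unitCotangent ι → g.HasCodirection ι v (A v)) := by
  let x₀ := v₀.proj
  -- The formula for the null lift is defined and smooth for all nearby covectors, not only for unit
  -- ones, so it extends the lift to an open set.
  let L : EuclideanSpace ℝ (Fin 3) × (EuclideanSpace ℝ (Fin 3) →L[ℝ] ℝ) →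
      EuclideanSpace ℝ (Fin 4) × (EuclideanSpace ℝ (Fin 4) →L[ℝ] ℝ) := fun ζ =>
    (chartMap 4 ι x₀ ζ.1, nullLift (g.metricCoords (ι x₀) (chartMap 4 ι x₀ ζ.1))
      (fderiv ℝ (chartMap 4 ι x₀) ζ.1) (g.futureCoords (ι x₀) (chartMap 4 ι x₀ ζ.1)) ζ.2)
  refine ⟨fun v => covectorOfCoords (ι x₀) (L (extChartAt (cotangentModel 3) v₀ v)), ?_⟩
  have hc : ContinuousAt (fun v => (extChartAt (cotangentModel 3) v₀ v).1) v₀ :=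
    (continuousAt_extChartAt (I := cotangentModel 3) v₀).fst
  have hc' := hc.eventually (p := fun a => a ∈ chartMapDomain 4 ι x₀) (by
    have := eventually_mem_chartMapDomain hs x₀
    simp only [cotangent_extChartAt]
    exact this)
  filter_upwards [extChartAt_source_mem_nhds (I := cotangentModel 3) v₀, hc'] with v hv hdom
  obtain ⟨⟨a, ξ⟩, hζ⟩ : ∃ ζ, ζ = extChartAt (cotangentModel 3) v₀ v := ⟨_, rfl⟩
  rw [← hζ] at hdom ⊢
  have hv' : v = covectorOfCoords x₀ (a, ξ) := by
    rw [← (extChartAt (cotangentModel 3) v₀).left_inv hv, ← hζ]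
    exact cotangent_extChartAt_symm v₀ hdom.1
  constructor
  · have hL : ContDiffAt ℝ ∞ L (a, ξ) := by
      have hf : ContDiffAt ℝ ∞ (Prod.fst : EuclideanSpace ℝ (Fin 3) ×
        (EuclideanSpace ℝ (Fin 3) →L[ℝ] ℝ) → _) (a, ξ) := contDiffAt_fst
      exact ((contDiffAt_chartMap hs hdom).comp (a, ξ) hf).prodMk
        (ContDiffAt.nullLift ((contDiffAt_metricCoords_chartMap hs hdom).comp (a, ξ) hf)
          ((contDiffAt_fderiv_chartMap hs hdom).comp (a, ξ) hf)
          ((contDiffAt_futureCoords_chartMap hs hdom).comp (a, ξ) hf) contDiffAt_snd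
          (isSpacelikeMap_coords hs hdom hι) finrank_euclideanSpace_fin
          (g.isLorentzForm_metricCoords (chartMap_mem_target hdom))
          (metricCoords_futureCoords_neg (chartMap_mem_target hdom)))
    have h1 := contMDiffAt_covectorOfCoords (ι x₀) (ζ := L (a, ξ)) (chartMap_mem_target hdom)
    have h2 : ContMDiffAt (cotangentModel 3)
      𝓘(ℝ, EuclideanSpace ℝ (Fin 3) × (EuclideanSpace ℝ (Fin 3) →L[ℝ] ℝ)) ∞
      (extChartAt (cotangentModel 3) v₀) v := contMDiffAt_extChartAt' (by simpa using hv)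
    exact (h1.comp_of_eq hL.contMDiffAt rfl).comp_of_eq h2 hζ.symm
  · intro hvu
    rw [hv'] at hvu ⊢
    exact hasCodirection_nullLift hs hdom hι hvu

variable [T2Space M]

omit hs hι [IsManifold (𝓡 3) ∞ S] in
/-- The partial derivative in time of a local flow of the geodesic spray, read in a chart. -/
theorem hasDerivAt_flow {z₀ : CotangentBundle 4 M} {Φ : ℝ × CotangentBundle 4 M → CotangentBundle 4 M}
    (hΦ : ∀ᶠ p in 𝓝 ((0, z₀) : ℝ × CotangentBundle 4 M), FlowRel g.spray p.2 p.1 (Φ p)) :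
    HasDerivAt (fun t => extChartAt (cotangentModel 4) z₀ (Φ (t, z₀)))
      (g.sprayCoords z₀.proj (extChartAt (cotangentModel 4) z₀ z₀)) 0 := by
  have h0 := zero_mem_maximalTimes (g := g) z₀
  have hz := maximalCurve_zero (g := g) z₀
  have h1 := hasDerivAt_chart_of_spray (((isMIntegralCurveOn_maximalCurve g.contMDiff_spray z₀) 0
    h0).hasMFDerivAt ((isOpen_maximalTimes z₀).mem_nhds h0)) (z₀ := z₀)
    (by rw [hz]; exact mem_extChartAt_source _)
  rw [hz] at h1
  refine h1.congr_of_eventuallyEq ?_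
  have hc : ContinuousAt (fun t : ℝ => (t, z₀)) 0 := by fun_prop
  filter_upwards [hc.eventually hΦ] with t ht
  rw [Function.comp_apply, ht.eq_maximalCurve g.contMDiff_spray]

end SpacetimeMetric

namespace SpacetimeMetric

variable {M : Type*} [TopologicalSpace M] [ChartedSpace (EuclideanSpace ℝ (Fin 4)) M]
  [IsManifold (𝓡 4) ∞ M] {g : SpacetimeMetric M}
  {S : Type*} [TopologicalSpace S] [ChartedSpace (EuclideanSpace ℝ (Fin 3)) S]
  [IsManifold (𝓡 3) ∞ S] {ι : S → M}
  (hs : ContMDiff (𝓡 3) (𝓡 4) ∞ ι)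
  (hι : ∀ (x : S) (u : TangentSpace (𝓡 3) x), u ≠ 0 → 0 < g.induced ι x u u)
include hs hι

variable [T2Space M]

/-- The null geodesics near one that meets the hypersurface meet it at points, and with covectors,
depending smoothly on the initial covector. -/
theorem exists_smooth_hit {x₀ : S} {z₀ : CotangentBundle 4 M} (hz₀ : z₀ ∈ g.nullBundle)
    (hproj : z₀.proj = ι x₀) :
    ∃ (α : CotangentBundle 4 M → EuclideanSpace ℝ (Fin 3))
      (Θ : CotangentBundle 4 M → CotangentBundle 4 M), Θ z₀ = z₀ ∧ α z₀ = extChartAt (𝓡 3) x₀ x₀ ∧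
      ∀ᶠ z in 𝓝 z₀,
        ContMDiffAt (cotangentModel 4) 𝓘(ℝ, EuclideanSpace ℝ (Fin 3)) ∞ α z ∧
        ContMDiffAt (cotangentModel 4) (cotangentModel 4) ∞ Θ z ∧
        α z ∈ chartMapDomain 4 ι x₀ ∧ Θ z ∈ (extChartAt (cotangentModel 4) z₀).source ∧
        (∃ t, FlowRel g.spray z t (Θ z)) ∧ (Θ z).proj = ι ((extChartAt (𝓡 3) x₀).symm (α z)) := by
  obtain ⟨m₀, p₀⟩ := z₀
  obtain rfl : m₀ = ι x₀ := hproj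
  set z₀ : CotangentBundle 4 M := ⟨ι x₀, p₀⟩ with hz₀def
  let φ := extChartAt (cotangentModel 4) z₀
  have hφs : z₀ ∈ φ.source := mem_extChartAt_source _
  have hφt : φ z₀ ∈ φ.target := mem_extChartAt_target _
  have hφopen : IsOpen φ.target := isOpen_extChartAt_target _
  have hφinv : φ.symm (φ z₀) = z₀ := φ.left_inv hφs
  obtain ⟨Φ, hΦ0, hΦ⟩ := exists_local_flow g.contMDiff_spray z₀
  let a₀ := extChartAt (𝓡 3) x₀ x₀
  let Z := EuclideanSpace ℝ (Fin 4) × (EuclideanSpace ℝ (Fin 4) →L[ℝ] ℝ)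
  let Φc : ℝ × (EuclideanSpace ℝ (Fin 4) × (EuclideanSpace ℝ (Fin 4) →L[ℝ] ℝ)) →
    EuclideanSpace ℝ (Fin 4) × (EuclideanSpace ℝ (Fin 4) →L[ℝ] ℝ) :=
    fun p => φ (Φ (p.1, φ.symm p.2))
  have hΦc0 : Φc (0, φ z₀) = φ z₀ := by simp only [Φc, hφinv, hΦ0]
  have hΦs : ∀ᶠ p in 𝓝 ((0, z₀) : ℝ × CotangentBundle 4 M), Φ p ∈ φ.source :=
    hΦ.self_of_nhds.1.continuousAt.eventually_mem (by
      rw [hΦ0]; exact extChartAt_source_mem_nhds _)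
  have hτ : Tendsto (fun p : ℝ × (EuclideanSpace ℝ (Fin 4) × (EuclideanSpace ℝ (Fin 4) →L[ℝ] ℝ)) =>
      (p.1, φ.symm p.2)) (𝓝 (0, φ z₀)) (𝓝 (0, z₀)) := by
    have : ContinuousAt (fun p : ℝ × (EuclideanSpace ℝ (Fin 4) × (EuclideanSpace ℝ (Fin 4) →L[ℝ] ℝ))
        => (p.1, φ.symm p.2)) (0, φ z₀) :=
      continuousAt_fst.prodMk ((continuousAt_extChartAt_symm (I := cotangentModel 4) z₀).comp
        (f := Prod.snd) (x := (0, φ z₀)) continuousAt_snd)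
    simpa only [ContinuousAt, hφinv] using this
  have hΦc : ∀ᶠ p in 𝓝 ((0, φ z₀) : ℝ × (EuclideanSpace ℝ (Fin 4) ×
      (EuclideanSpace ℝ (Fin 4) →L[ℝ] ℝ))), ContDiffAt ℝ ∞ Φc p := by
    have ht : ∀ᶠ p in 𝓝 ((0, φ z₀) : ℝ × (EuclideanSpace ℝ (Fin 4) ×
      (EuclideanSpace ℝ (Fin 4) →L[ℝ] ℝ))), p.2 ∈ φ.target :=
      continuousAt_snd.eventually_mem (hφopen.mem_nhds hφt)
    filter_upwards [hτ.eventually (hΦ.and hΦs), ht] with p ⟨⟨h1, _⟩, h2⟩ h3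
    have e1 : ContMDiffAt 𝓘(ℝ, ℝ × (EuclideanSpace ℝ (Fin 4) × (EuclideanSpace ℝ (Fin 4) →L[ℝ] ℝ)))
        (𝓘(ℝ, ℝ).prod (cotangentModel 4)) ∞ (fun p : ℝ × (EuclideanSpace ℝ (Fin 4) ×
          (EuclideanSpace ℝ (Fin 4) →L[ℝ] ℝ)) => (p.1, φ.symm p.2)) p :=
      contDiffAt_fst.contMDiffAt.prodMk
        (((contMDiffOn_extChartAt_symm z₀).contMDiffAt (hφopen.mem_nhds h3)).comp p
          contDiffAt_snd.contMDiffAt)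
    have e2 : ContMDiffAt (cotangentModel 4)
        𝓘(ℝ, EuclideanSpace ℝ (Fin 4) × (EuclideanSpace ℝ (Fin 4) →L[ℝ] ℝ)) ∞ φ
        (Φ (p.1, φ.symm p.2)) := contMDiffAt_extChartAt' (by simpa [φ] using h2)
    exact (e2.comp p (h1.comp p e1)).contDiffAt
  have hfst : HasDerivAt (fun t => (Φc (t, φ z₀)).1) (g.cometricCoords (ι x₀) (φ z₀).1 (φ z₀).2) 0 := by
    have h := hasDerivAt_flow (g := g) (z₀ := z₀) (hΦ.mono fun _ h => h.2)
    have h' := (ContinuousLinearMap.fst ℝ (EuclideanSpace ℝ (Fin 4))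
      (EuclideanSpace ℝ (Fin 4) →L[ℝ] ℝ)).hasFDerivAt.comp_hasDerivAt (0 : ℝ) h
    simp only [Φc, hφinv]
    exact h'
  have hdom := eventually_mem_chartMapDomain hs x₀
  have hbase : chartMap 4 ι x₀ a₀ = (φ z₀).1 := by
    simp only [chartMap, a₀, φ, extChartAt_to_inv, cotangent_extChartAt]
    rfl
  -- A null geodesic is transversal to the surface: tangent vectors of the surface are spacelike,
  -- whereas the velocity is null and nonzero.
  have htrans : ∀ (α : EuclideanSpace ℝ (Fin 3)) (t : ℝ), fderiv ℝ (chartMap 4 ι x₀) a₀ α =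
      t • g.cometricCoords (ι x₀) (φ z₀).1 (φ z₀).2 → α = 0 ∧ t = 0 := by
    intro α t h
    have hD := isSpacelikeMap_coords (g := g) hs hdom.self_of_nhds hι
    have hy := chartMap_mem_target hdom.self_of_nhds
    obtain ⟨hn1, hn2⟩ := (mem_nullBundle_iff_coords (g := g) hφs rfl).1 hz₀
    rw [hbase] at hD hy
    have hK := metricCoords_cometricCoords (g := g) hy (φ z₀).2
    have hα : α = 0 := by
      by_contra hne
      have h1 := hD α hne
      rw [h, map_smul, map_smul, _root_.smul_apply, hK] at h1
      change 0 < t • t • (φ z₀).2 _ at h1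
      have h2 : (φ z₀).2 (g.cometricCoords (ι x₀) (φ z₀).1 (φ z₀).2) = 0 := hn1
      simp [h2] at h1
    subst hα
    refine ⟨rfl, (smul_eq_zero.1 (h.symm.trans (map_zero _))).resolve_right fun h0 => ?_⟩
    have h2 : (φ z₀).2 (g.futureCoords (ι x₀) (φ z₀).1) < 0 := hn2
    rw [← hK, h0] at h2
    simp at h2
  obtain ⟨α, τ, hα0, hτ0, hατ⟩ := exists_smooth_transversal (c := chartMap 4 ι x₀)
    (ρ := fun p => (Φc p).1) (a₀ := a₀) (ζ₀ := φ z₀)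
    (hdom.mono fun a ha => contDiffAt_chartMap hs ha) (hΦc.mono fun p hp => hp.fst)
    (by simp only [hΦc0]; exact hbase) hfst htrans (by simp)
  have hφc : ContinuousAt φ z₀ := continuousAt_extChartAt (I := cotangentModel 4) z₀
  have hταc : ContinuousAt (fun z => (τ (φ z), z)) z₀ :=
    (ContinuousAt.comp (f := φ) hατ.self_of_nhds.2.1.continuousAt hφc).prodMk continuousAt_id
  have hταc' : Tendsto (fun z => (τ (φ z), z)) (𝓝 z₀) (𝓝 (0, z₀)) := by
    simpa only [ContinuousAt, hτ0] using hταc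
  have hαc : Tendsto (fun z => α (φ z)) (𝓝 z₀) (𝓝 a₀) := by
    have := ContinuousAt.comp (f := φ) hατ.self_of_nhds.1.continuousAt hφc
    simpa only [ContinuousAt, Function.comp_def, hα0] using this
  refine ⟨fun z => α (φ z), fun z => Φ (τ (φ z), z), by simp only [hτ0, hΦ0], hα0, ?_⟩
  filter_upwards [hφc.eventually hατ, hταc'.eventually (hΦ.and hΦs), hαc.eventually hdom,
    extChartAt_source_mem_nhds (I := cotangentModel 4) z₀] with z ⟨h1, h2, h3⟩ ⟨⟨h4, h5⟩, h6⟩ h7 h8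
  have hφz : ContMDiffAt (cotangentModel 4)
      𝓘(ℝ, EuclideanSpace ℝ (Fin 4) × (EuclideanSpace ℝ (Fin 4) →L[ℝ] ℝ)) ∞ φ z :=
    contMDiffAt_extChartAt' (by simpa using h8)
  refine ⟨h1.contMDiffAt.comp z hφz, ContMDiffAt.comp z h4 ((h2.contMDiffAt.comp z hφz).prodMk
    contMDiffAt_id), h7, h6, ⟨_, h5⟩, ?_⟩
  simp only [Φc, φ.left_inv h8] at h3
  -- The intersection was found for coordinate expressions; both points lie in the domain of the
  -- same chart, where equal coordinates mean equal points.
  have h9 : extChartAt (𝓡 4) (ι x₀) (ι ((extChartAt (𝓡 3) x₀).symm (α (φ z)))) =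
      extChartAt (𝓡 4) (ι x₀) (Φ (τ (φ z), z)).proj := by
    refine h3.trans ?_
    simp only [φ, cotangent_extChartAt]
    rfl
  exact ((extChartAt (𝓡 4) (ι x₀)).injOn h7.2 (mem_cotangent_source.1 h6) h9).symm

end SpacetimeMetric

/-! ### Local smooth formula for the map between the unit cotangent bundles. -/

namespace SpacetimeMetric

variable {M : Type*} [TopologicalSpace M] [ChartedSpace (EuclideanSpace ℝ (Fin 4)) M]
  [IsManifold (𝓡 4) ∞ M] [T2Space M] {g : SpacetimeMetric M}

section Surface

variable {S : Type*} [TopologicalSpace S] [ChartedSpace (EuclideanSpace ℝ (Fin 3)) S]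
  [IsManifold (𝓡 3) ∞ S] {ι : S → M}
  (hs : ContMDiff (𝓡 3) (𝓡 4) ∞ ι)
  (hι : ∀ (x : S) (u : TangentSpace (𝓡 3) x), u ≠ 0 → 0 < g.induced ι x u u)
include hs hι

/-- Near a null covector over the hypersurface, the unit covector of the hypersurface that specifies
the null geodesic of a null covector depends smoothly on the latter. -/
theorem exists_smooth_drop {x₀ : S} {z₀ : CotangentBundle 4 M} (hz₀ : z₀ ∈ g.nullBundle)
    (hproj : z₀.proj = ι x₀) :
    ∃ B : CotangentBundle 4 M → CotangentBundle 3 S, ∀ᶠ z in 𝓝 z₀,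
      ContMDiffAt (cotangentModel 4) (cotangentModel 3) ∞ B z ∧ (z ∈ g.nullBundle →
        B z ∈ g.unitCotangent ι ∧ ∃ t z', FlowRel g.spray z t z' ∧ g.HasCodirection ι (B z) z') := by
  obtain ⟨α, Θ, hΘ0, hα0, hev⟩ := exists_smooth_hit hs hι hz₀ hproj
  have hdom := eventually_mem_chartMapDomain hs x₀
  let φ := extChartAt (cotangentModel 4) z₀
  let pos : EuclideanSpace ℝ (Fin 3) × (EuclideanSpace ℝ (Fin 4) →L[ℝ] ℝ) → ℝ := fun p =>
    p.2 (fderiv ℝ (chartMap 4 ι x₀) p.1 ((inducedForm (g.metricCoords (ι x₀) (chartMap 4 ι x₀ p.1))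
      (fderiv ℝ (chartMap 4 ι x₀) p.1)).inverse (p.2.comp (fderiv ℝ (chartMap 4 ι x₀) p.1))))
  have hW : Module.finrank ℝ (EuclideanSpace ℝ (Fin 3)) = 3 := finrank_euclideanSpace_fin
  have hG : ∀ p : EuclideanSpace ℝ (Fin 3) × (EuclideanSpace ℝ (Fin 4) →L[ℝ] ℝ),
      p.1 ∈ chartMapDomain 4 ι x₀ →
      ContDiffAt ℝ ∞ (fun p : EuclideanSpace ℝ (Fin 3) × (EuclideanSpace ℝ (Fin 4) →L[ℝ] ℝ) =>
        g.metricCoords (ι x₀) (chartMap 4 ι x₀ p.1)) p ∧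
      ContDiffAt ℝ ∞ (fun p : EuclideanSpace ℝ (Fin 3) × (EuclideanSpace ℝ (Fin 4) →L[ℝ] ℝ) =>
        fderiv ℝ (chartMap 4 ι x₀) p.1) p := fun p hp =>
    ⟨(contDiffAt_metricCoords_chartMap hs hp).comp p contDiffAt_fst,
      (contDiffAt_fderiv_chartMap hs hp).comp p contDiffAt_fst⟩
  -- The radicand of `unitRestrict` is positive at `z₀` by nullness. By continuity it stays positive
  -- nearby, also at covectors that are not null, as needed for smoothness on an open set.
  have hposc : ContinuousAt pos (extChartAt (𝓡 3) x₀ x₀, (φ z₀).2) := by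
    obtain ⟨h1, h2⟩ := hG (extChartAt (𝓡 3) x₀ x₀, (φ z₀).2) hdom.self_of_nhds
    have h3 := h1.inducedForm_inverse h2 (isSpacelikeMap_coords hs hdom.self_of_nhds hι) hW
    exact (contDiffAt_snd.clm_apply (h2.clm_apply (h3.clm_apply
      (contDiffAt_snd.clm_comp h2)))).continuousAt
  have hpos0 : 0 < pos (extChartAt (𝓡 3) x₀ x₀, (φ z₀).2) :=
    (unitRestrict_hasCodirection hs hdom.self_of_nhds hι hproj hz₀
      (by rw [extChartAt_to_inv, hproj]) rfl).1
  have hφΘ : ContinuousAt (fun z => φ (Θ z)) z₀ := ContinuousAt.comp (f := Θ) (g := φ)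
    (by rw [hΘ0]; exact continuousAt_extChartAt (I := cotangentModel 4) z₀)
    hev.self_of_nhds.2.1.continuousAt
  have hpc : Tendsto (fun z => (α z, (φ (Θ z)).2)) (𝓝 z₀) (𝓝 (extChartAt (𝓡 3) x₀ x₀, (φ z₀).2)) := by
    have := hev.self_of_nhds.1.continuousAt.prodMk hφΘ.snd
    simpa only [ContinuousAt, hα0, hΘ0] using this
  refine ⟨fun z => covectorOfCoords x₀ (α z, unitRestrict
    (g.metricCoords (ι x₀) (chartMap 4 ι x₀ (α z))) (fderiv ℝ (chartMap 4 ι x₀) (α z))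
    (φ (Θ z)).2), ?_⟩
  filter_upwards [hev, hpc.eventually (hposc.eventually (lt_mem_nhds hpos0))]
    with z ⟨h1, h2, h3, h4, ⟨t, h5⟩, h6⟩ h7
  constructor
  · have hq : ContMDiffAt (cotangentModel 4) 𝓘(ℝ, EuclideanSpace ℝ (Fin 4) ×
        (EuclideanSpace ℝ (Fin 4) →L[ℝ] ℝ)) ∞ (fun z => φ (Θ z)) z :=
      (contMDiffAt_extChartAt' (by simpa using h4) : ContMDiffAt (cotangentModel 4) 𝓘(ℝ,
        EuclideanSpace ℝ (Fin 4) × (EuclideanSpace ℝ (Fin 4) →L[ℝ] ℝ)) ∞ φ (Θ z)).comp z h2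
    have hq' : ContMDiffAt (cotangentModel 4) 𝓘(ℝ, EuclideanSpace ℝ (Fin 4) →L[ℝ] ℝ) ∞
        (fun z => (φ (Θ z)).2) z := ContMDiffAt.comp (g := Prod.snd) z contDiffAt_snd.contMDiffAt hq
    obtain ⟨e1, e2⟩ := hG (α z, (φ (Θ z)).2) h3
    have e3 := contDiffAt_fst.prodMk (ContDiffAt.unitRestrict e1 e2 contDiffAt_snd
      (isSpacelikeMap_coords hs h3 hι) hW h7)
    exact (contMDiffAt_covectorOfCoords x₀ h3.1).comp z
      (e3.contMDiffAt.comp z (h1.prodMk_space hq'))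
  · intro hz
    obtain ⟨-, h8, h9⟩ := unitRestrict_hasCodirection hs h3 hι hproj
      (mem_nullBundle_of_flowRel h5 hz) h6 (q := (φ (Θ z)).2) rfl
    exact ⟨h8, t, Θ z, h5, h9⟩

end Surface

section Joins

variable {S₁ : Type*} [TopologicalSpace S₁] [ChartedSpace (EuclideanSpace ℝ (Fin 3)) S₁]
  [IsManifold (𝓡 3) ∞ S₁] {S₂ : Type*} [TopologicalSpace S₂]
  [ChartedSpace (EuclideanSpace ℝ (Fin 3)) S₂] [IsManifold (𝓡 3) ∞ S₂] {ι₁ : S₁ → M} {ι₂ : S₂ → M}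

/-- Near `v₀` the map is `B ∘ Ψ ∘ A`. The time of `Ψ` is the fixed one that brings the lift of `v₀`
to the second surface; for neighbouring covectors `B` absorbs the small remaining time to the
surface. -/
theorem isSmoothBetween_of_nullGeodesicJoins (hι₁ : g.IsCauchySurface ι₁)
    (hι₂ : g.IsCauchySurface ι₂) {f : g.unitCotangent ι₁ → g.unitCotangent ι₂}
    (hf : ∀ v : g.unitCotangent ι₁, g.NullGeodesicJoins ι₁ ι₂ v (f v)) : IsSmoothBetween f := by
  intro v₀
  obtain ⟨A, hA⟩ := exists_smooth_codirection hι₁.isSmoothEmbedding.contMDiff hι₁.spacelike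
    (v₀ : CotangentBundle 3 S₁)
  have hA0 := hA.self_of_nhds.2 v₀.2
  obtain ⟨z₁, t, z₂, hflow, hz₁, hz₂⟩ := (hf v₀).exists_flowRel
  -- The given geodesic may start at another multiple of the lift `A v₀`; it is rescaled so as to
  -- start exactly there.
  obtain ⟨k, hk, hkz⟩ := hz₁.exists_smul hι₁.spacelike v₀.2 hA0
  have hflow' := flowRel_smul hk hflow
  rw [← hkz] at hflow'
  have hz₂' := hz₂.smul hι₂.spacelike (f v₀).2 hk
  have hnull := hA0.mem_nullBundle hι₁.spacelike v₀.2
  obtain ⟨Ψ, hΨ0, hΨ⟩ := FlowRel.exists_smooth g.contMDiff_spray hflow'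
  obtain ⟨B, hB⟩ := exists_smooth_drop hι₂.isSmoothEmbedding.contMDiff hι₂.spacelike
    (mem_nullBundle_of_flowRel hflow' hnull) hz₂'.proj_eq
  have hAc := hA.self_of_nhds.1.continuousAt
  have hΨc := ContinuousAt.comp (f := A) hΨ.self_of_nhds.1.continuousAt hAc
  rw [← hΨ0] at hB
  obtain ⟨U, hU, hUo, hvU⟩ := eventually_nhds_iff.1
    (hA.and ((hAc.eventually hΨ).and (hΨc.eventually hB)))
  refine ⟨U, fun v => B (Ψ (A v)), hUo, hvU, fun v hv => ?_, fun v hv => ?_⟩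
  · obtain ⟨h1, h2, h3⟩ := hU v hv
    exact (ContMDiffAt.comp v h3.1 (ContMDiffAt.comp v h2.1 h1.1)).contMDiffWithinAt
  · obtain ⟨h1, h2, h3⟩ := hU v hv
    have h4 := h1.2 v.2
    have h5 := h4.mem_nullBundle hι₁.spacelike v.2
    obtain ⟨h6, s, z', h7, h8⟩ := h3.2 (mem_nullBundle_of_flowRel h2.2 h5)
    -- `B (Ψ (A v))` is joined to `v` by a null geodesic, so uniqueness of the joined covector
    -- identifies it with `f v`.
    exact congrArg Subtype.val ((existsUnique_nullGeodesicJoins hι₁ hι₂ v).unique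
      (y₁ := ⟨_, h6⟩) (nullGeodesicJoins_of_flowRel h5 (h2.2.trans g.contMDiff_spray h7) h4 h8) (hf v))

end Joins

end SpacetimeMetric

theorem mainTheorem7
    {M : Type*} [TopologicalSpace M] [ChartedSpace (EuclideanSpace ℝ (Fin 4)) M]
    [IsManifold (𝓡 4) ∞ M] [T2Space M] [SecondCountableTopology M] [ConnectedSpace M]
    (g : SpacetimeMetric M) (hg : g.GloballyHyperbolic)
    {S₁ : Type*} [TopologicalSpace S₁] [ChartedSpace (EuclideanSpace ℝ (Fin 3)) S₁]
    [IsManifold (𝓡 3) ∞ S₁]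
    {S₂ : Type*} [TopologicalSpace S₂] [ChartedSpace (EuclideanSpace ℝ (Fin 3)) S₂]
    [IsManifold (𝓡 3) ∞ S₂]
    (ι₁ : S₁ → M) (hι₁ : g.IsCauchySurface ι₁)
    (ι₂ : S₂ → M) (hι₂ : g.IsCauchySurface ι₂) :
    ∃ f : g.unitCotangent ι₁ ≃ g.unitCotangent ι₂,
      (∀ v₁ v₂, f v₁ = v₂ ↔ g.NullGeodesicJoins ι₁ ι₂ v₁ v₂) ∧
      IsSmoothBetween f ∧ IsSmoothBetween f.symm := by
  obtain ⟨f, hf⟩ := g.exists_equiv_nullGeodesicJoins hι₁ hι₂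
  have hf' : ∀ v : g.unitCotangent ι₁, g.NullGeodesicJoins ι₁ ι₂ v (f v) := fun v => (hf v _).1 rfl
  refine ⟨f, hf, SpacetimeMetric.isSmoothBetween_of_nullGeodesicJoins hι₁ hι₂ hf',
    SpacetimeMetric.isSmoothBetween_of_nullGeodesicJoins hι₂ hι₁ fun v : g.unitCotangent ι₂ => ?_⟩
  simpa using (hf' (f.symm v)).symm
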